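/- A run-length straight-line program (RLSLP) $G$ over an alphabet $\Sigma$ has variables ordered so that every rule refers only to smaller variables and the greatest variable is the starting one; each variable $A$ has exactly one rule, of one of the forms $A\to a$ ($a\in\Sigma$; size $1$), $A\to A_1A_2\cdots A_k$ with $k>1$ variables (size $k$), or the run-length rule $A\to B^t$ with $t>2$ (size $2$). Unfolding $A\to B^t$ into $A\to BB\cdots B$ ($t$ times), $G$ generates a unique string; its size $|G|$ is the sum of the sizes of its rules, and its depth is the height of the parse tree of the starting variable in the unfolded grammar. **Theorem.** There are a constant $c$ and an algorithm (a fixed program for the unit-cost word RAM) such that the following holds. Let $G$ be an RLSLP generating a string $w$ of length $n$, given as the list of its rules in the order of its variables (terminals being represented by distinct natural numbers), and let the machine words have enough bits to hold every number in this list and every natural number less than $c\,(n+|G|)$. Then in at most $c\,|G|$ steps the algorithm outputs an RLSLP $G'$, in the same format, that generates $w$, has size at most $c\,|G|$ and depth at most $c\,(1+\lfloor\log_2 n\rfloor)$, and has only rules of the forms $A\to a$, $A\to BC$ and $A\to B^t$ with $t>2$, where $a$ is a terminal and $B$, $C$ are variables. -/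

import Mathlib

/-! ## Run-length straight-line programs -/

/-- The right-hand side of a rule.  Variables are natural numbers, terminals are elements of `α`. -/
inductive RLRule (α : Type*) where
  /-- `A → a` -/
  | term (a : α)
  /-- `A → A₁ A₂ ⋯ A_k` -/
  | seq (l : List ℕ)
  /-- `A → B ^ t`, the run-length rule -/
  | run (B t : ℕ)

namespace RLRule

variable {α : Type*}

/-- Side conditions on the right-hand sides: `k > 1` in `A₁ ⋯ A_k`, and `t > 2` in `B ^ t`. -/
def Admissible : RLRule α → Prop
  | term _ => True
  | seq l => 1 < l.length
  | run _ t => 2 < t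

/-- The size of a right-hand side is its length, except that a run-length rule has size 2. -/
def size : RLRule α → ℕ
  | term _ => 1
  | seq l => l.length
  | run _ _ => 2

/-- The right-hand side as a string over variables (`Sum.inl`) and terminals (`Sum.inr`), where
`B ^ t` is unfolded into `B B ⋯ B` of length `t`. -/
def unfold : RLRule α → List (ℕ ⊕ α)
  | term a => [Sum.inr a]
  | seq l => l.map Sum.inl
  | run B t => List.replicate t (Sum.inl B)

/-- Every right-hand side that is a sequence of variables has exactly two of them, so that
(together with `Admissible`) the rule is `A → a`, or `A → B C`, or `A → B ^ t` with `t > 2`. -/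
def IsBinary : RLRule α → Prop
  | term _ => True
  | seq l => l.length = 2
  | run _ _ => True

/-- A rule as a sequence of machine words, the terminal `a` being represented by `code a`. -/
def encode (code : α → ℕ) : RLRule α → List ℕ
  | term a => [0, code a]
  | seq l => 1 :: l.length :: l
  | run B t => [2, B, t]

end RLRule

/-- A run-length straight-line program with terminals in `α`.  Its variables are
`0, 1, …, rules.length - 1`, variable `A` has the rule `rules[A]` and refers to smaller variables
only; the greatest variable is the starting variable. -/
structure RLSLP (α : Type*) where
  /-- the rules, listed in the order of their variables -/
  rules : List (RLRule α)
  nonempty : rules ≠ []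
  admissible : ∀ r ∈ rules, r.Admissible
  ordered : ∀ (A : ℕ) (hA : A < rules.length) (B : ℕ), Sum.inl B ∈ (rules[A]).unfold → B < A

namespace RLSLP

variable {α : Type*} (G : RLSLP α)

/-- The starting variable. -/
def start : ℕ := G.rules.length - 1

/-- The right-hand side of the rule of `A` in the straight-line program that is obtained by
unfolding the run-length rules (empty if `A` is not a variable). -/
def rhs (A : ℕ) : List (ℕ ⊕ α) := (G.rules[A]?.map RLRule.unfold).getD []

theorem lt_of_mem_rhs {A B : ℕ} (h : Sum.inl B ∈ G.rhs A) : B < A := by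
  unfold rhs at h
  by_cases hA : A < G.rules.length
  · rw [List.getElem?_eq_getElem hA] at h
    exact G.ordered A hA B (by simpa using h)
  · rw [List.getElem?_eq_none (by omega)] at h
    simp at h

/-- The string derived from the variable `A`. -/
def exp (A : ℕ) : List α :=
  (G.rhs A).attach.flatMap fun s =>
    match s with
    | ⟨Sum.inl B, _⟩ => exp B
    | ⟨Sum.inr a, _⟩ => [a]
termination_by A
decreasing_by exact G.lt_of_mem_rhs ‹_›

/-- The depth (height) of the parse tree of `A` in the unfolded straight-line program, in edges;
its leaves are the terminals. -/
def depthOf (A : ℕ) : ℕ :=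
  1 + ((G.rhs A).attach.map fun s =>
    match s with
    | ⟨Sum.inl B, _⟩ => depthOf B
    | ⟨Sum.inr _, _⟩ => 0).foldr max 0
termination_by A
decreasing_by exact G.lt_of_mem_rhs ‹_›

/-- The string generated by `G`. -/
def word : List α := G.exp G.start

/-- The depth of `G`, that is, of its parse tree. -/
def depth : ℕ := G.depthOf G.start

/-- The size of `G`: the sum of the sizes of the right-hand sides. -/
def size : ℕ := (G.rules.map RLRule.size).sum

/-- `G` as a sequence of machine words: the number of variables, then the rules in order. -/
def encode (code : α → ℕ) : List ℕ :=
  G.rules.length :: G.rules.flatMap (RLRule.encode code)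

end RLSLP

/-! ## The word RAM

A machine with words of `w` bits, finitely many registers (those that the program mentions) and a
random access memory of words that is addressed by words.  Programs are built from elementary
instructions with the usual control structures; each elementary instruction and each evaluation of
a test takes one unit of time. -/

namespace WordRAM

/-- The arithmetic and bitwise instructions. -/
inductive Op where
  | add | sub | mul | div | mod | band | bor | bxor | shl | shr

/-- The operations on words of `w` bits.  Results are truncated to `w` bits, and subtraction is
truncated at zero. -/
def Op.eval (w : ℕ) : Op → ℕ → ℕ → ℕ
  | add, x, y => (x + y) % 2 ^ w
  | sub, x, y => x - y
  | mul, x, y => (x * y) % 2 ^ w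
  | div, x, y => x / y
  | mod, x, y => x % y
  | band, x, y => x &&& y
  | bor, x, y => x ||| y
  | bxor, x, y => x ^^^ y
  | shl, x, y => (x <<< y) % 2 ^ w
  | shr, x, y => x >>> y

/-- Tests compare two registers. -/
inductive Test where
  | lt (a b : ℕ)
  | eq (a b : ℕ)

/-- Programs.  Lower-case letters are names of registers, `k` is a constant. -/
inductive Prog where
  | skip
  /-- `r_d := k` -/
  | const (d k : ℕ)
  /-- `r_d := r_a ∘ r_b` -/
  | op (o : Op) (d a b : ℕ)
  /-- `r_d := mem[r_a]` -/
  | load (d a : ℕ)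
  /-- `mem[r_a] := r_b` -/
  | store (a b : ℕ)
  | seq (P Q : Prog)
  | ite (b : Test) (P Q : Prog)
  | loop (b : Test) (P : Prog)

/-- The contents of the registers and of the memory. -/
structure State where
  reg : ℕ → ℕ
  mem : ℕ → ℕ

/-- Whether a test succeeds. -/
def Test.Holds (s : State) : Test → Prop
  | lt a b => s.reg a < s.reg b
  | eq a b => s.reg a = s.reg b

/-- Write the word `x` into register `d`. -/
def State.setReg (s : State) (d x : ℕ) : State := { s with reg := Function.update s.reg d x }

/-- Write the word `x` into the memory cell `i`. -/
def State.setMem (s : State) (i x : ℕ) : State := { s with mem := Function.update s.mem i x }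

/-- `Exec w P s t s'`: with words of `w` bits, the program `P` started in state `s` halts in state
`s'` after exactly `t` steps. -/
inductive Exec (w : ℕ) : Prog → State → ℕ → State → Prop where
  | skip (s : State) : Exec w .skip s 1 s
  | const (s : State) (d k : ℕ) : Exec w (.const d k) s 1 (s.setReg d (k % 2 ^ w))
  | op (s : State) (o : Op) (d a b : ℕ) :
      Exec w (.op o d a b) s 1 (s.setReg d (o.eval w (s.reg a) (s.reg b)))
  | load (s : State) (d a : ℕ) : Exec w (.load d a) s 1 (s.setReg d (s.mem (s.reg a)))
  | store (s : State) (a b : ℕ) : Exec w (.store a b) s 1 (s.setMem (s.reg a) (s.reg b))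
  | seq {P Q : Prog} {s s₁ s₂ : State} {t₁ t₂ : ℕ} (h₁ : Exec w P s t₁ s₁)
      (h₂ : Exec w Q s₁ t₂ s₂) : Exec w (.seq P Q) s (t₁ + t₂) s₂
  | ite_true {b : Test} {P Q : Prog} {s s₁ : State} {t : ℕ} (hb : b.Holds s)
      (h : Exec w P s t s₁) : Exec w (.ite b P Q) s (1 + t) s₁
  | ite_false {b : Test} {P Q : Prog} {s s₁ : State} {t : ℕ} (hb : ¬ b.Holds s)
      (h : Exec w Q s t s₁) : Exec w (.ite b P Q) s (1 + t) s₁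
  | loop_true {b : Test} {P : Prog} {s s₁ s₂ : State} {t₁ t₂ : ℕ} (hb : b.Holds s)
      (h₁ : Exec w P s t₁ s₁) (h₂ : Exec w (.loop b P) s₁ t₂ s₂) :
      Exec w (.loop b P) s (1 + t₁ + t₂) s₂
  | loop_false {b : Test} {P : Prog} {s : State} (hb : ¬ b.Holds s) :
      Exec w (.loop b P) s 1 s

/-- The initial state on an input: the input is in the memory from address `0` on; all other cells
and all registers are zero. -/
def State.init (input : List ℕ) : State where
  reg _ := 0
  mem i := input.getD i 0

/-- The state presents an output: it is in the memory from the address in register `0` on. -/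
def State.HasOutput (s : State) (output : List ℕ) : Prop :=
  ∀ (i : ℕ) (hi : i < output.length), s.mem (s.reg 0 + i) = output[i]

end WordRAM

/-!
The algorithm brings the rules into normal form (leaves, pairs and powers), which makes the grammar
a directed acyclic multigraph, and rebalances it along the paths of its symmetric centroid
decomposition.

*The decomposition.*  Let `n` be the length of the generated string, let `len v` be the length of
the string of the variable `v` and let `P v` be the number of paths from the greatest variable to
`v`, that is, the number of occurrences of `v` in the parse tree, so that `P v * len v ≤ n`.  Along
an edge from `v` to `a` the number `λ = log₂ (len v)` does not increase and `ρ = log₂ (P v)` does not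
decrease.  The edge is *central* if both stay the same.  A variable has at most one central child
and at most one central parent, since a second one would double `len` or `P`, and a variable with a
run-length rule has no central child at all, as `t > 2`.  Hence the central edges form disjoint
paths (`CountsFrom.pair_cases`, `CentralChild.unique`), each of which ends in a variable without
central child, its *core*.

*Balancing a path.*  On a central path the string of `v` consists of the string of the central child
and, to its left or right, of the string of the other child.  Every `v` on the path has to be
expressed by `O(1)` amortized new rules, in such a way that the depth telescopes over the
noncentral edges of the parse tree.  The variables of the path get positions `β`, increasing from
the core upwards, where the step between `u` and its parent `v` is at least
`len a * P v + (P v - p) * len v` up to constant factors; `a` is the noncentral child of `v` and `p`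
the number of paths that enter `v` by its central parent.  The key of `v` is the exclusive
disjunction of the positions of `v` and `u`; its logarithm `κ` is the greatest digit in which these
differ.  The successor `next v` is the first variable on the way to the core whose `κ` is greater,
and `v` becomes `Zl ++ next v ++ Zr`, where `Zl` and `Zr` collect what lies between.  These pieces
are found by following the chain of successors of `u` (`Popping`), which costs amortized constant
time and rules per variable, because the new chain of `v` skips all visited variables but the last
one (`Balanced`).  No visited variable has the same `κ` as `v` (`Popping.log_ne`, which is also why
comparing keys is as good as comparing logarithms), so `κ` strictly increases along chains and the
depth of the pieces is bounded in terms of `κ`; and `κ` is at least `λ a + ρ v` and at least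
`log₂ (P v - p) + λ v` (`Built.itemKey`).  The first bound pays for the noncentral edge to `a`, the
second one for the noncentral edges into `v`.  Altogether the depth below `v` is at most
`20 λ + 17 (log₂ n - ρ) + 2 ρ + 7 - 2 κ` (`Built.dep_le`), which is `O(log n)` for the greatest
variable.

*The machine.*  The program is written in a language with variables, arrays and expressions that is
compiled to the word RAM.  `Cmd.wp` computes weakest preconditions together with the number of
steps, and `Runs.loop` is a rule for loops with a potential for the running time.  Logarithms are
never computed: two positive numbers have the same logarithm if and only if their exclusive
disjunction is less than their conjunction (`log_eq_log_iff_xor_lt_and`).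
-/

/-! ### A structured language on top of the word RAM -/

namespace WordRAM

/-- A store of the structured language: variables, and arrays `arr a` indexed by natural numbers.
Values are unbounded; `Expr.Fits` says when an evaluation stays within the machine words. -/
structure Store where
  var : ℕ → ℕ
  arr : ℕ → ℕ → ℕ

namespace Store

/-- Assign to a variable. -/
def setVar (h : Store) (d x : ℕ) : Store := { h with var := Function.update h.var d x }

/-- Assign to an array cell. -/
def setArr (h : Store) (a i x : ℕ) : Store :=
  { h with arr := Function.update h.arr a (Function.update (h.arr a) i x) }

@[simp] theorem setVar_var (h : Store) (d x e : ℕ) :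
    (h.setVar d x).var e = if e = d then x else h.var e := by
  simp [setVar, Function.update_apply]

@[simp] theorem setVar_arr (h : Store) (d x : ℕ) : (h.setVar d x).arr = h.arr := rfl

@[simp] theorem setArr_var (h : Store) (a i x : ℕ) : (h.setArr a i x).var = h.var := rfl

@[simp] theorem setArr_arr (h : Store) (a i x a' i' : ℕ) :
    (h.setArr a i x).arr a' i' = if a' = a ∧ i' = i then x else h.arr a' i' := by
  by_cases ha : a' = a
  · subst ha; simp [setArr, Function.update_apply]
  · simp [setArr, ha]

end Store

/-- Arithmetic expressions; `rd a e` reads cell `e` of array `a`. -/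
inductive Expr where
  | lit (k : ℕ)
  | var (r : ℕ)
  | op (o : Op) (e f : Expr)
  | rd (a : ℕ) (e : Expr)

/-- The untruncated value of an operation. -/
def Op.val : Op → ℕ → ℕ → ℕ
  | .add, x, y => x + y
  | .sub, x, y => x - y
  | .mul, x, y => x * y
  | .div, x, y => x / y
  | .mod, x, y => x % y
  | .band, x, y => x &&& y
  | .bor, x, y => x ||| y
  | .bxor, x, y => x ^^^ y
  | .shl, x, y => x <<< y
  | .shr, x, y => x >>> y

/-- A condition under which an operation on words is not truncated. -/
def Op.Fits (w : ℕ) : Op → ℕ → ℕ → Prop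
  | .add, x, y => x + y < 2 ^ w
  | .mul, x, y => x * y < 2 ^ w
  | .shl, x, y => x <<< y < 2 ^ w
  | _, _, _ => True

theorem Op.eval_eq_val {w : ℕ} {o : Op} {x y : ℕ} (h : o.Fits w x y) :
    o.eval w x y = o.val x y := by
  cases o <;> simp only [Op.Fits] at h <;> simp [Op.eval, Op.val] <;>
    exact Nat.mod_eq_of_lt h

/-- The array cells that the memory layout accommodates when the input has `b` cells: array `0` is
the input, the arrays `1, …, 16` are work space and array `17` is the output. -/
def Cell (b a i : ℕ) : Prop := (a ≤ 16 ∧ i < b) ∨ (a = 17 ∧ i < 40 * b)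

@[simp] theorem cell_iff {b a i : ℕ} (h : a ≤ 16) : Cell b a i ↔ i < b := by
  unfold Cell; omega

@[simp] theorem cell_output_iff {b i : ℕ} : Cell b 17 i ↔ i < 40 * b := by
  unfold Cell; omega

/-- The memory layout: the input is followed by `b` records, whose 16 fields belong to the arrays
`1, …, 16`, and these by the output. -/
def addr (b a i : ℕ) : ℕ := if a = 0 then i else if a = 17 then 17 * b + i else b + 16 * i + (a - 1)

theorem addr_inj {b a i a' i' : ℕ} (h : Cell b a i) (h' : Cell b a' i')
    (e : addr b a i = addr b a' i') : a = a' ∧ i = i' := by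
  unfold Cell at h h'
  unfold addr at e
  split_ifs at e <;> omega

/-- The first register that is used for intermediate results. -/
abbrev scratch : ℕ := 64

namespace Expr

instance : Add Expr := ⟨op .add⟩
instance : Sub Expr := ⟨op .sub⟩
instance : Mul Expr := ⟨op .mul⟩
instance (n : ℕ) : OfNat Expr n := ⟨lit n⟩

/-- The value of an expression. -/
def eval (h : Store) : Expr → ℕ
  | lit k => k
  | var r => h.var r
  | op o e f => o.val (e.eval h) (f.eval h)
  | rd a e => h.arr a (e.eval h)

/-- The evaluation of an expression involves only small literals, the variables and the cells of
the memory layout, and no overflow.  Array accesses need the input length in variable `1`. -/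
def Fits (b w : ℕ) (h : Store) : Expr → Prop
  | lit k => k ≤ 64
  | var r => r < scratch
  | op o e f => e.Fits b w h ∧ f.Fits b w h ∧ o.Fits w (e.eval h) (f.eval h)
  | rd a e => e.Fits b w h ∧ Cell b a (e.eval h) ∧ (a ≠ 0 → h.var 1 = b)

/-- The number of steps of `addrCode`. -/
def addrCost (a : ℕ) : ℕ := if a = 0 then 1 else if a = 17 then 3 else 5

/-- The number of steps that evaluate an expression. -/
def cost : Expr → ℕ
  | lit _ => 1
  | var _ => 1
  | op _ e f => e.cost + f.cost + 1
  | rd a e => e.cost + addrCost a + 1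

/-- Replace the index in register `scratch + k` by the address of that cell of array `a`. -/
def addrCode (k a : ℕ) : Prog :=
  if a = 0 then .skip
  else if a = 17 then
    .seq (.const (scratch + k + 1) 17) (.seq
      (.op .mul (scratch + k + 1) (scratch + k + 1) 1)
      (.op .add (scratch + k) (scratch + k + 1) (scratch + k)))
  else
    .seq (.const (scratch + k + 1) 16) (.seq
      (.op .mul (scratch + k) (scratch + k + 1) (scratch + k)) (.seq
      (.op .add (scratch + k) 1 (scratch + k)) (.seq
      (.const (scratch + k + 1) (a - 1))
      (.op .add (scratch + k) (scratch + k) (scratch + k + 1)))))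

/-- Evaluate an expression into register `scratch + k`, using no lower registers. -/
def code (k : ℕ) : Expr → Prog
  | lit c => .const (scratch + k) c
  | var r => .op .band (scratch + k) r r
  | op o e f => .seq (e.code k) (.seq (f.code (k + 1))
      (.op o (scratch + k) (scratch + k) (scratch + k + 1)))
  | rd a e => .seq (e.code k) (.seq (addrCode k a) (.load (scratch + k) (scratch + k)))

section
variable (h : Store) (b w : ℕ) (e f : Expr) (o : Op) (k a : ℕ)

@[simp] theorem eval_ofNat : (ofNat(k) : Expr).eval h = OfNat.ofNat k := rfl
@[simp] theorem eval_var : (var k).eval h = h.var k := rfl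
@[simp] theorem eval_add : (e + f).eval h = e.eval h + f.eval h := rfl
@[simp] theorem eval_sub : (e - f).eval h = e.eval h - f.eval h := rfl
@[simp] theorem eval_mul : (e * f).eval h = e.eval h * f.eval h := rfl
@[simp] theorem eval_xor : (op .bxor e f).eval h = e.eval h ^^^ f.eval h := rfl
@[simp] theorem eval_and : (op .band e f).eval h = e.eval h &&& f.eval h := rfl
@[simp] theorem eval_rd : (rd a e).eval h = h.arr a (e.eval h) := rfl

@[simp] theorem fits_ofNat : (ofNat(k) : Expr).Fits b w h ↔ (OfNat.ofNat k : ℕ) ≤ 64 := Iff.rfl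
@[simp] theorem fits_var : (var k).Fits b w h ↔ k < 64 := Iff.rfl
@[simp] theorem fits_add : (e + f).Fits b w h ↔
    e.Fits b w h ∧ f.Fits b w h ∧ e.eval h + f.eval h < 2 ^ w := Iff.rfl
@[simp] theorem fits_mul : (e * f).Fits b w h ↔
    e.Fits b w h ∧ f.Fits b w h ∧ e.eval h * f.eval h < 2 ^ w := Iff.rfl
@[simp] theorem fits_sub : (e - f).Fits b w h ↔ e.Fits b w h ∧ f.Fits b w h := by
  change _ ∧ _ ∧ True ↔ _
  simp
@[simp] theorem fits_xor : (op .bxor e f).Fits b w h ↔ e.Fits b w h ∧ f.Fits b w h := by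
  change _ ∧ _ ∧ True ↔ _
  simp
@[simp] theorem fits_and : (op .band e f).Fits b w h ↔ e.Fits b w h ∧ f.Fits b w h := by
  change _ ∧ _ ∧ True ↔ _
  simp
@[simp] theorem fits_rd : (rd a e).Fits b w h ↔
    e.Fits b w h ∧ Cell b a (e.eval h) ∧ (a ≠ 0 → h.var 1 = b) := Iff.rfl

@[simp] theorem cost_ofNat : (ofNat(k) : Expr).cost = 1 := rfl
@[simp] theorem cost_var : (var k).cost = 1 := rfl
@[simp] theorem cost_op : (op o e f).cost = e.cost + f.cost + 1 := rfl
@[simp] theorem cost_add : (e + f).cost = e.cost + f.cost + 1 := rfl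
@[simp] theorem cost_sub : (e - f).cost = e.cost + f.cost + 1 := rfl
@[simp] theorem cost_mul : (e * f).cost = e.cost + f.cost + 1 := rfl
@[simp] theorem cost_rd : (rd a e).cost = e.cost + addrCost a + 1 := rfl

end

end Expr

/-- The machine state `s` represents the store `h`. -/
structure Represents (b : ℕ) (s : State) (h : Store) : Prop where
  reg : ∀ r < scratch, s.reg r = h.var r
  mem : ∀ a i, Cell b a i → s.mem (addr b a i) = h.arr a i

theorem Exec.of_eq {w : ℕ} {P : Prog} {s s' : State} {t t' : ℕ} (h : Exec w P s t s')
    (e : t = t') : Exec w P s t' s' := e ▸ h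

namespace Expr

variable {b w : ℕ}

theorem addrCode_exec (hw : 64 * b + 64 < 2 ^ w) (k : ℕ) {a i : ℕ} {s : State}
    (hs : s.reg (scratch + k) = i) (hc : Cell b a i) (hb : a ≠ 0 → s.reg 1 = b) :
    ∃ s', Exec w (addrCode k a) s (addrCost a) s' ∧ s'.mem = s.mem ∧
      (∀ r < scratch + k, s'.reg r = s.reg r) ∧ s'.reg (scratch + k) = addr b a i := by
  have hm : ∀ x, x ≤ 64 * b + 64 → x % 2 ^ w = x := fun x hx => Nat.mod_eq_of_lt (by omega)
  unfold addrCode addrCost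
  split_ifs with h0 h17
  · exact ⟨s, .skip s, rfl, fun _ _ => rfl, by simp [addr, h0, hs]⟩
  · refine ⟨_, .seq (.const s _ _) (.seq (.op _ _ _ _ _) (.op _ _ _ _ _)), rfl, ?_, ?_⟩
    · intro r hr
      have h1 : r ≠ scratch + k := by omega
      have h2 : r ≠ scratch + k + 1 := by omega
      simp only [State.setReg, Function.update_of_ne h1, Function.update_of_ne h2]
    · have h2 : (1 : ℕ) ≠ scratch + k + 1 := by unfold scratch; omega
      have hb' := hb h0
      have hi : i < 40 * b := by unfold Cell at hc; omega
      simp only [State.setReg, Op.eval, Function.update_apply, hs, hb', addr, h17, if_true,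
        if_false, h2, Nat.left_eq_add, one_ne_zero]
      rw [hm 17 (by omega), hm (17 * b) (by omega), hm _ (by omega)]
      simp
  · refine ⟨_, .seq (.const s _ _) (.seq (.op _ _ _ _ _) (.seq (.op _ _ _ _ _)
      (.seq (.const _ _ _) (.op _ _ _ _ _)))), rfl, ?_, ?_⟩
    · intro r hr
      have h1 : r ≠ scratch + k := by omega
      have h2 : r ≠ scratch + k + 1 := by omega
      simp only [State.setReg, Function.update_of_ne h1, Function.update_of_ne h2]
    · have hb' := hb h0
      have hi : i < b ∧ a ≤ 16 := by unfold Cell at hc; omega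
      have h1 : (1 : ℕ) ≠ scratch + k := by unfold scratch; omega
      have h2 : (1 : ℕ) ≠ scratch + k + 1 := by unfold scratch; omega
      simp only [State.setReg, Op.eval, Function.update_apply, hs, hb', addr, h17, h0, if_true,
        if_false, h1, h2, Nat.add_eq_left, Nat.left_eq_add, one_ne_zero]
      rw [hm 16 (by omega), hm (16 * i) (by omega), hm (b + 16 * i) (by omega), hm (a - 1) (by omega),
        hm _ (by omega)]

theorem code_exec (hw : 64 * b + 64 < 2 ^ w) {h : Store} (e : Expr) :
    ∀ (k : ℕ) (s : State), Represents b s h → e.Fits b w h →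
    ∃ s', Exec w (e.code k) s e.cost s' ∧ s'.mem = s.mem ∧
      (∀ r < scratch + k, s'.reg r = s.reg r) ∧ s'.reg (scratch + k) = e.eval h := by
  have rep : ∀ (k : ℕ) (s s' : State), Represents b s h → s'.mem = s.mem →
      (∀ r < scratch + k, s'.reg r = s.reg r) → Represents b s' h := fun k s s' hs h1 h2 =>
    ⟨fun r hr => by rw [h2 r (by omega), hs.reg r hr], fun a i hc => by rw [h1, hs.mem a i hc]⟩
  induction e with
  | lit c =>
    intro k s hs hf
    refine ⟨_, .const s _ _, rfl, fun r hr => ?_, ?_⟩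
    · simp [State.setReg, Function.update_of_ne (show r ≠ scratch + k by omega)]
    · have : c ≤ 64 := hf
      simp only [State.setReg, Function.update_self, eval]
      exact Nat.mod_eq_of_lt (by omega)
  | var r =>
    intro k s hs hf
    refine ⟨_, .op s .band _ _ _, rfl, fun r' hr => ?_, ?_⟩
    · simp [State.setReg, Function.update_of_ne (show r' ≠ scratch + k by omega)]
    · simp [State.setReg, Op.eval, eval, hs.reg r hf]
  | op o e f ihe ihf =>
    intro k s hs ⟨he, hf, ho⟩
    obtain ⟨s₁, x₁, m₁, r₁, v₁⟩ := ihe k s hs he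
    obtain ⟨s₂, x₂, m₂, r₂, v₂⟩ := ihf (k + 1) s₁ (rep k s s₁ hs m₁ r₁) hf
    have ec : e.cost + (f.cost + 1) = (op o e f).cost := by simp only [cost]; omega
    refine ⟨_, (Exec.seq x₁ (.seq x₂ (.op s₂ o _ _ _))).of_eq ec, m₂.trans m₁, fun r hr => ?_, ?_⟩
    · simp only [State.setReg, Function.update_of_ne (show r ≠ scratch + k by omega)]
      rw [r₂ r (by omega), r₁ r hr]
    · simp only [State.setReg, Function.update_self, eval]
      rw [show scratch + k + 1 = scratch + (k + 1) by omega, v₂, r₂ _ (by omega), v₁,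
        Op.eval_eq_val ho]
  | rd a e ihe =>
    intro k s hs ⟨he, hc, hb⟩
    obtain ⟨s₁, x₁, m₁, r₁, v₁⟩ := ihe k s hs he
    have hs₁ := rep k s s₁ hs m₁ r₁
    obtain ⟨s₂, x₂, m₂, r₂, v₂⟩ := addrCode_exec hw k v₁ hc
      (fun h0 => by rw [hs₁.reg 1 (by unfold scratch; omega), hb h0])
    have ec : e.cost + (addrCost a + 1) = (rd a e).cost := by simp only [cost]; omega
    refine ⟨_, (Exec.seq x₁ (.seq x₂ (.load s₂ _ _))).of_eq ec, m₂.trans m₁, fun r hr => ?_, ?_⟩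
    · simp only [State.setReg, Function.update_of_ne (show r ≠ scratch + k by omega)]
      rw [r₂ r (by omega), r₁ r hr]
    · simp only [State.setReg, Function.update_self, eval]
      rw [v₂, m₂, hs₁.mem _ _ hc]

end Expr

/-- Whether a test succeeds in a store. -/
def Test.InStore (h : Store) : Test → Prop
  | lt x y => h.var x < h.var y
  | eq x y => h.var x = h.var y

@[simp] theorem Test.inStore_lt (h : Store) (x y : ℕ) :
    (lt x y).InStore h ↔ h.var x < h.var y := Iff.rfl

@[simp] theorem Test.inStore_eq (h : Store) (x y : ℕ) :
    (eq x y).InStore h ↔ h.var x = h.var y := Iff.rfl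

/-- The test compares variables. -/
def Test.Fits : Test → Prop
  | lt x y => x < scratch ∧ y < scratch
  | eq x y => x < scratch ∧ y < scratch

@[simp] theorem Test.fits_lt (x y : ℕ) : (lt x y).Fits ↔ x < 64 ∧ y < 64 := Iff.rfl

@[simp] theorem Test.fits_eq (x y : ℕ) : (eq x y).Fits ↔ x < 64 ∧ y < 64 := Iff.rfl

theorem Test.holds_iff {b : ℕ} {s : State} {h : Store} (hs : Represents b s h) {t : Test}
    (ht : t.Fits) : t.Holds s ↔ t.InStore h := by
  cases t <;> simp [Test.Holds, Test.InStore, hs.reg _ ht.1, hs.reg _ ht.2]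

/-- Commands: assignments to variables and to array cells, and control structures. -/
inductive Cmd where
  | asg (d : ℕ) (e : Expr)
  | wr (a : ℕ) (i e : Expr)
  | seq (c c' : Cmd)
  | ite (t : Test) (c c' : Cmd)
  | loop (t : Test) (c : Cmd)

/-- The value of a variable as an expression. -/
prefix:max "♯" => Expr.var

/-- Sequential composition of commands. -/
infixr:60 " ;; " => Cmd.seq

/-- The translation of commands to programs. -/
def Cmd.code : Cmd → Prog
  | asg d e => .seq (e.code 0) (.op .band d scratch scratch)
  | wr a i e => .seq (i.code 0) (.seq (Expr.addrCode 0 a) (.seq (e.code 1)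
      (.store scratch (scratch + 1))))
  | seq c c' => .seq c.code c'.code
  | ite t c c' => .ite t c.code c'.code
  | loop t c => .loop t c.code

/-- Started in the store `h`, the translation of `c` halts after `t` steps in a store `h'` such that
`Q t h'`. -/
def Runs (b w : ℕ) (c : Cmd) (h : Store) (Q : ℕ → Store → Prop) : Prop :=
  ∀ s, Represents b s h → ∃ t s' h', Exec w c.code s t s' ∧ Represents b s' h' ∧ Q t h'

variable {b w : ℕ}

theorem Runs.mono {c : Cmd} {h : Store} {Q Q' : ℕ → Store → Prop} (H : Runs b w c h Q)
    (hQ : ∀ t h', Q t h' → Q' t h') : Runs b w c h Q' := fun s hs =>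
  let ⟨t, s', h', x, r, q⟩ := H s hs
  ⟨t, s', h', x, r, hQ _ _ q⟩

theorem Runs.asg (hw : 64 * b + 64 < 2 ^ w) {d : ℕ} {e : Expr} {h : Store}
    {Q : ℕ → Store → Prop} (he : e.Fits b w h)
    (hQ : Q (e.cost + 1) (h.setVar d (e.eval h))) : Runs b w (.asg d e) h Q := by
  intro s hs
  obtain ⟨s₁, x₁, m₁, r₁, v₁⟩ := e.code_exec hw 0 s hs he
  refine ⟨_, _, _, .seq x₁ (.op s₁ _ _ _ _), ⟨fun r hr => ?_, fun a i hc => ?_⟩, hQ⟩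
  · simp only [State.setReg, Op.eval, Function.update_apply, Store.setVar_var]
    split_ifs with h1
    · simpa using v₁
    · rw [r₁ r (by omega), hs.reg r hr]
  · change s₁.mem _ = _
    rw [m₁, hs.mem a i hc]
    rfl

theorem Runs.wr (hw : 64 * b + 64 < 2 ^ w) {a : ℕ} {i e : Expr} {h : Store}
    {Q : ℕ → Store → Prop} (hi : i.Fits b w h) (he : e.Fits b w h) (hc : Cell b a (i.eval h))
    (hb : h.var 1 = b)
    (hQ : Q (i.cost + Expr.addrCost a + e.cost + 1) (h.setArr a (i.eval h) (e.eval h))) :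
    Runs b w (.wr a i e) h Q := by
  intro s hs
  obtain ⟨s₁, x₁, m₁, r₁, v₁⟩ := i.code_exec hw 0 s hs hi
  obtain ⟨s₂, x₂, m₂, r₂, v₂⟩ := Expr.addrCode_exec hw 0 v₁ hc
    (fun _ => by rw [r₁ 1 (by unfold scratch; omega), hs.reg 1 (by unfold scratch; omega), hb])
  have hs₂ : Represents b s₂ h := ⟨fun r hr => by rw [r₂ r (by omega), r₁ r (by omega), hs.reg r hr],
    fun a i hc => by rw [m₂, m₁, hs.mem a i hc]⟩
  obtain ⟨s₃, x₃, m₃, r₃, v₃⟩ := e.code_exec hw 1 s₂ hs₂ he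
  have hcost : i.cost + Expr.addrCost a + e.cost + 1 =
      i.cost + (Expr.addrCost a + (e.cost + 1)) := by omega
  rw [hcost] at hQ
  refine ⟨_, _, _, .seq x₁ (.seq x₂ (.seq x₃ (.store s₃ _ _))), ⟨fun r hr => ?_, fun a' i' hc' => ?_⟩,
    hQ⟩
  · change s₃.reg r = h.var r
    rw [r₃ r (by omega), hs₂.reg r hr]
  · have e1 : s₃.reg scratch = addr b a (i.eval h) := by
      rw [r₃ scratch (by omega)]; simpa using v₂
    simp only [State.setMem, Function.update_apply, e1, v₃, Store.setArr_arr]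
    by_cases hx : a' = a ∧ i' = i.eval h
    · rw [if_pos hx, if_pos (by rw [hx.1, hx.2])]
    · rw [if_neg hx, if_neg (fun hh => hx (addr_inj hc' hc hh)), m₃, hs₂.mem _ _ hc']

theorem Runs.seq {c c' : Cmd} {h : Store} {Q : ℕ → Store → Prop}
    (H : Runs b w c h fun t h₁ => Runs b w c' h₁ fun t' h₂ => Q (t + t') h₂) :
    Runs b w (c ;; c') h Q := by
  intro s hs
  obtain ⟨t₁, s₁, h₁, x₁, rep₁, H₁⟩ := H s hs
  obtain ⟨t₂, s₂, h₂, x₂, rep₂, H₂⟩ := H₁ s₁ rep₁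
  exact ⟨_, s₂, h₂, .seq x₁ x₂, rep₂, H₂⟩

theorem Runs.ite {t : Test} {c c' : Cmd} {h : Store} {Q : ℕ → Store → Prop} (ht : t.Fits)
    (H : t.InStore h → Runs b w c h fun τ h' => Q (1 + τ) h')
    (H' : ¬ t.InStore h → Runs b w c' h fun τ h' => Q (1 + τ) h') :
    Runs b w (.ite t c c') h Q := by
  intro s hs
  by_cases hh : t.InStore h
  · obtain ⟨t₁, s₁, h₁, x₁, rep₁, H₁⟩ := H hh s hs
    exact ⟨_, s₁, h₁, .ite_true ((Test.holds_iff hs ht).2 hh) x₁, rep₁, H₁⟩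
  · obtain ⟨t₁, s₁, h₁, x₁, rep₁, H₁⟩ := H' hh s hs
    exact ⟨_, s₁, h₁, .ite_false (fun h2 => hh ((Test.holds_iff hs ht).1 h2)) x₁, rep₁, H₁⟩

/-- The rule for loops.  The invariant `I` refers to a ghost value, whose potential `Φ` pays for the
steps; as every iteration takes a step, the potential also shows that the loop terminates. -/
theorem Runs.loop {γ : Type*} (I : γ → Store → Prop) (Φ : γ → ℕ) {t : Test} {c : Cmd}
    (ht : t.Fits)
    (body : ∀ g h, I g h → t.InStore h →
      Runs b w c h fun τ h' => ∃ g', I g' h' ∧ τ + 1 + Φ g' ≤ Φ g)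
    (g : γ) (h : Store) (hI : I g h) :
    Runs b w (.loop t c) h fun τ h' =>
      ∃ g', I g' h' ∧ ¬ t.InStore h' ∧ τ + Φ g' ≤ Φ g + 1 := by
  induction hn : Φ g using Nat.strong_induction_on generalizing g h with
  | _ n ih =>
    intro s hs
    by_cases hh : t.InStore h
    · obtain ⟨t₁, s₁, h₁, x₁, rep₁, g₁, I₁, le₁⟩ := body g h hI hh s hs
      obtain ⟨t₂, s₂, h₂, x₂, rep₂, g₂, I₂, n₂, le₂⟩ := ih (Φ g₁) (by omega) g₁ h₁ I₁ rfl s₁ rep₁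
      exact ⟨_, s₂, h₂, .loop_true ((Test.holds_iff hs ht).2 hh) x₁ x₂, rep₂, g₂, I₂, n₂,
        by omega⟩
    · exact ⟨1, s, h, .loop_false (fun h2 => hh ((Test.holds_iff hs ht).1 h2)), hs, g, hI, hh,
        by omega⟩

/-- The weakest precondition of a command, computed by recursion except for loops. -/
def Cmd.wp (b w : ℕ) : Cmd → (ℕ → Store → Prop) → Store → Prop
  | asg d e, Q, h => e.Fits b w h ∧ Q (e.cost + 1) (h.setVar d (e.eval h))
  | wr a i e, Q, h => i.Fits b w h ∧ e.Fits b w h ∧ Cell b a (i.eval h) ∧ h.var 1 = b ∧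
      Q (i.cost + Expr.addrCost a + e.cost + 1) (h.setArr a (i.eval h) (e.eval h))
  | seq c c', Q, h => c.wp b w (fun t h₁ => c'.wp b w (fun t' h₂ => Q (t + t') h₂) h₁) h
  | ite t c c', Q, h => t.Fits ∧ (t.InStore h → c.wp b w (fun τ h' => Q (1 + τ) h') h) ∧
      (¬ t.InStore h → c'.wp b w (fun τ h' => Q (1 + τ) h') h)
  | loop t c, Q, h => Runs b w (.loop t c) h Q

theorem Runs.of_wp (hw : 64 * b + 64 < 2 ^ w) (c : Cmd) :
    ∀ {h : Store} {Q : ℕ → Store → Prop}, c.wp b w Q h → Runs b w c h Q := by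
  induction c with
  | asg d e => exact fun ⟨he, hQ⟩ => Runs.asg hw he hQ
  | wr a i e => exact fun ⟨hi, he, hc, hb, hQ⟩ => Runs.wr hw hi he hc hb hQ
  | seq c c' ih ih' => exact fun H => Runs.seq ((ih H).mono fun t h₁ H' => ih' H')
  | ite t c c' ih ih' => 
    rintro h Q ⟨ht, H, H'⟩
    exact Runs.ite ht (fun hh => ih (H hh)) (fun hh => ih' (H' hh))
  | loop t c ih => exact fun H => H

/-- A variant of `Runs.of_wp` in which the postcondition is opaque, so that simplification of the
weakest precondition leaves it alone. -/
theorem Runs.intro (hw : 64 * b + 64 < 2 ^ w) {c : Cmd} {h : Store} {Q : ℕ → Store → Prop}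
    (H : ∀ Q' : ℕ → Store → Prop, (∀ t h', Q t h' → Q' t h') → c.wp b w Q' h) :
    Runs b w c h Q :=
  Runs.of_wp hw c (H Q fun _ _ => id)

end WordRAM

/-! ### Binary digits -/

namespace BinGram

/-- A test whether two words have the same leading digit that uses no logarithms. -/
theorem log_eq_log_iff_xor_lt_and {x y : ℕ} (hx : 0 < x) (hy : 0 < y) :
    Nat.log 2 x = Nat.log 2 y ↔ x ^^^ y < x &&& y := by
  have bit : ∀ {z k : ℕ}, 0 < z → Nat.log 2 z = k → z.testBit k = true := by
    rintro z k hz rfl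
    have h1 := Nat.pow_log_le_self 2 hz.ne'
    have h2 := Nat.lt_pow_succ_log_self (b := 2) (by norm_num) z
    rw [Nat.testBit_eq_decide_div_mod_eq,
      Nat.div_eq_of_lt_le (k := 1) (by omega) (by rw [pow_succ] at h2; omega)]
    rfl
  have nobit : ∀ {z k : ℕ}, Nat.log 2 z < k → z.testBit k = false := fun {z k} h =>
    Nat.testBit_lt_two_pow (Nat.lt_pow_of_log_lt (by norm_num) h)
  have apart : ∀ {x y : ℕ}, 0 < y → Nat.log 2 x < Nat.log 2 y → x &&& y ≤ x ^^^ y := by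
    intro x y hy h
    have h1 : x < 2 ^ Nat.log 2 y := Nat.lt_pow_of_log_lt (by norm_num) h
    have h2 : (x ^^^ y).testBit (Nat.log 2 y) = true := by
      rw [Nat.testBit_xor, bit hy rfl, nobit h]; rfl
    exact (Nat.and_le_left.trans h1.le).trans (Nat.ge_two_pow_of_testBit h2)
  constructor
  · intro h
    have h1 : 2 ^ Nat.log 2 x ≤ x &&& y :=
      Nat.ge_two_pow_of_testBit (by rw [Nat.testBit_and, bit hx rfl, bit hy h.symm]; rfl)
    refine lt_of_lt_of_le (Nat.lt_pow_two_of_testBit _ fun i hi => ?_) h1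
    rw [Nat.testBit_xor]
    rcases hi.lt_or_eq with h2 | h2
    · rw [nobit h2, nobit (h ▸ h2)]; rfl
    · rw [bit hx h2, bit hy (h ▸ h2)]; rfl
  · intro h
    by_contra hne
    rcases Nat.lt_or_gt_of_ne hne with h1 | h1
    · exact absurd (apart hy h1) (by omega)
    · have := apart hx h1
      rw [Nat.and_comm, Nat.xor_comm] at this
      omega

theorem log_add_log_le {x y : ℕ} (hx : 0 < x) (hy : 0 < y) :
    Nat.log 2 x + Nat.log 2 y ≤ Nat.log 2 (x * y) := by
  apply Nat.le_log_of_pow_le (by norm_num)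
  rw [pow_add]
  exact Nat.mul_le_mul (Nat.pow_log_le_self 2 hx.ne') (Nat.pow_log_le_self 2 hy.ne')

theorem log_mul_lt {x y : ℕ} (hx : 0 < x) (hy : 0 < y) :
    Nat.log 2 (x * y) < Nat.log 2 x + Nat.log 2 y + 2 := by
  apply Nat.log_lt_of_lt_pow (Nat.mul_pos hx hy).ne'
  have h1 := Nat.lt_pow_succ_log_self (b := 2) (by norm_num) x
  have h2 := Nat.lt_pow_succ_log_self (b := 2) (by norm_num) y
  have := Nat.mul_lt_mul'' h1 h2
  rwa [← pow_add, show (Nat.log 2 x).succ + (Nat.log 2 y).succ =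
    Nat.log 2 x + Nat.log 2 y + 2 by omega] at this

theorem lt_two_mul_of_log_eq {x y : ℕ} (hy : 0 < y) (h : Nat.log 2 x = Nat.log 2 y) :
    x < 2 * y := by
  have h1 := Nat.lt_pow_succ_log_self (b := 2) (by norm_num) x
  have h2 := Nat.pow_log_le_self 2 hy.ne'
  rw [h, pow_succ] at h1
  omega

theorem div_two_pow_eq_of_le {x y i j : ℕ} (h : x / 2 ^ i = y / 2 ^ i) (hij : i ≤ j) :
    x / 2 ^ j = y / 2 ^ j := by
  obtain ⟨d, rfl⟩ := Nat.exists_eq_add_of_le hij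
  rw [pow_add, ← Nat.div_div_eq_div_mul, ← Nat.div_div_eq_div_mul, h]

theorem sub_le_xor (q p : ℕ) : q - p ≤ q ^^^ p := by
  induction q using Nat.strong_induction_on generalizing p with
  | _ q ih =>
    rcases Nat.eq_zero_or_pos q with rfl | hq
    · simp
    · have h1 := ih (q / 2) (by omega) (p / 2)
      have h2 : (q ^^^ p) / 2 = q / 2 ^^^ p / 2 := Nat.xor_div_two
      have h3 : (q ^^^ p) % 2 = (q + p) % 2 := Nat.xor_mod_two_eq
      omega

theorem xor_pos_of_lt {p q : ℕ} (h : p < q) : 0 < q ^^^ p :=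
  lt_of_lt_of_le (by omega) (sub_le_xor q p)

/-- Above the leading digit of `q ^^^ p`, the digits of `p` and `q` agree. -/
theorem div_two_pow_log_xor (p q : ℕ) : q / 2 ^ (Nat.log 2 (q ^^^ p) + 1) =
    p / 2 ^ (Nat.log 2 (q ^^^ p) + 1) := by
  have h1 := Nat.lt_pow_succ_log_self (b := 2) (by norm_num) (q ^^^ p)
  rw [← Nat.shiftRight_eq_div_pow, ← Nat.shiftRight_eq_div_pow]
  have h2 : (q ^^^ p) >>> (Nat.log 2 (q ^^^ p) + 1) = 0 := by
    rw [Nat.shiftRight_eq_div_pow]; exact Nat.div_eq_of_lt h1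
  rw [Nat.shiftRight_xor_distrib] at h2
  exact Nat.xor_eq_zero_iff.1 h2

/-- At the leading digit of `q ^^^ p`, the larger number has the digit `1`. -/
theorem div_two_pow_log_xor_mod {p q : ℕ} (h : p < q) :
    q / 2 ^ Nat.log 2 (q ^^^ p) % 2 = 1 ∧ p / 2 ^ Nat.log 2 (q ^^^ p) % 2 = 0 := by
  have h0 := div_two_pow_log_xor p q
  have h3 : (q ^^^ p).testBit (Nat.log 2 (q ^^^ p)) = true := by
    have h1 := Nat.pow_log_le_self 2 (xor_pos_of_lt h).ne'
    have h2 := Nat.lt_pow_succ_log_self (b := 2) (by norm_num) (q ^^^ p)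
    rw [Nat.testBit_eq_decide_div_mod_eq,
      Nat.div_eq_of_lt_le (k := 1) (by omega) (by rw [pow_succ] at h2; omega)]
    rfl
  generalize Nat.log 2 (q ^^^ p) = k at *
  rw [Nat.testBit_xor, Nat.testBit_eq_decide_div_mod_eq, Nat.testBit_eq_decide_div_mod_eq] at h3
  rw [pow_succ, ← Nat.div_div_eq_div_mul, ← Nat.div_div_eq_div_mul] at h0
  have h4 : p / 2 ^ k ≤ q / 2 ^ k := Nat.div_le_div_right h.le
  have h5 : q / 2 ^ k % 2 ≠ p / 2 ^ k % 2 := by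
    intro h6
    rw [h6] at h3
    simp at h3
  omega

end BinGram

/-! ### Binary grammars -/

/-- The right-hand sides of the normal form. -/
inductive BinRule (α : Type*) where
  | leaf (a : α)
  | pair (i j : ℕ)
  | pow (i t : ℕ)

namespace BinRule

variable {α : Type*}

/-- The right-hand side may be used for the variable `j`: it refers to smaller variables, and the
exponent of a power is greater than two. -/
def Ok (j : ℕ) : BinRule α → Prop
  | leaf _ => True
  | pair x y => x < j ∧ y < j
  | pow x t => x < j ∧ 2 < t

/-- The string derived from a right-hand side, given the strings `s` of the variables. -/
def str (s : ℕ → List α) : BinRule α → List α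
  | leaf a => [a]
  | pair x y => s x ++ s y
  | pow x t => (List.replicate t (s x)).flatten

/-- The depth of a right-hand side, given the depths `d` of the variables. -/
def dep (d : ℕ → ℕ) : BinRule α → ℕ
  | leaf _ => 1
  | pair x y => 1 + max (d x) (d y)
  | pow x _ => 1 + d x

/-- A right-hand side of the normal form as a rule of a run-length straight-line program. -/
def toRule : BinRule α → RLRule α
  | leaf a => .term a
  | pair x y => .seq [x, y]
  | pow x t => .run x t

/-- The number of occurrences of a variable in a right-hand side. -/
def mult (a : ℕ) : BinRule α → ℕ
  | leaf _ => 0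
  | pair x y => (if x = a then 1 else 0) + (if y = a then 1 else 0)
  | pow x t => if x = a then t else 0

theorem str_congr {s s' : ℕ → List α} {n : ℕ} (h : ∀ i < n, s i = s' i) {r : BinRule α}
    (hr : r.Ok n) : r.str s = r.str s' := by
  cases r with
  | leaf a => rfl
  | pair x y => simp only [str, h x hr.1, h y hr.2]
  | pow x t => simp only [str, h x hr.1]

theorem dep_congr {s s' : ℕ → ℕ} {n : ℕ} (h : ∀ i < n, s i = s' i) {r : BinRule α}
    (hr : r.Ok n) : r.dep s = r.dep s' := by
  cases r with
  | leaf a => rfl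
  | pair x y => simp only [dep, h x hr.1, h y hr.2]
  | pow x t => simp only [dep, h x hr.1]

theorem Ok.mult_eq_zero {r : BinRule α} {j a : ℕ} (h : r.Ok j) (ha : j ≤ a) : r.mult a = 0 := by
  cases r with
  | leaf a => rfl
  | pair x y =>
    have := h.1
    have := h.2
    simp only [mult]
    rw [if_neg (by omega), if_neg (by omega)]
  | pow x t =>
    have := h.1
    simp only [mult]
    rw [if_neg (by omega)]

end BinRule

/-- A grammar in normal form with variables `0, …, card - 1`, together with the strings that the
variables derive and the depths of their parse trees.  The functions are arbitrary from `card` on. -/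
structure BinGram (α : Type*) where
  card : ℕ
  rule : ℕ → BinRule α
  str : ℕ → List α
  dep : ℕ → ℕ
  ok : ∀ j < card, (rule j).Ok j
  str_eq : ∀ j < card, str j = (rule j).str str
  dep_eq : ∀ j < card, dep j = (rule j).dep dep

namespace BinGram

variable {α : Type*}

/-- The grammar without variables. -/
def empty : BinGram α := ⟨0, fun _ => .pair 0 0, fun _ => [], fun _ => 0, by simp, by simp, by simp⟩

/-- Add a variable with a given rule. -/
def push (B : BinGram α) (r : BinRule α) (hr : r.Ok B.card) : BinGram α where
  card := B.card + 1
  rule := Function.update B.rule B.card r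
  str := Function.update B.str B.card (r.str B.str)
  dep := Function.update B.dep B.card (r.dep B.dep)
  ok j hj := by
    rcases Nat.lt_succ_iff_lt_or_eq.1 hj with h | rfl
    · rw [Function.update_of_ne h.ne]; exact B.ok j h
    · rw [Function.update_self]; exact hr
  str_eq j hj := by
    rcases Nat.lt_succ_iff_lt_or_eq.1 hj with h | rfl
    · rw [Function.update_of_ne h.ne, Function.update_of_ne h.ne, B.str_eq j h]
      exact BinRule.str_congr (fun i hi => by rw [Function.update_of_ne (by omega)]) (B.ok j h)
    · rw [Function.update_self, Function.update_self]
      exact BinRule.str_congr (fun i hi => by rw [Function.update_of_ne (by omega)]) hr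
  dep_eq j hj := by
    rcases Nat.lt_succ_iff_lt_or_eq.1 hj with h | rfl
    · rw [Function.update_of_ne h.ne, Function.update_of_ne h.ne, B.dep_eq j h]
      exact BinRule.dep_congr (fun i hi => by rw [Function.update_of_ne (by omega)]) (B.ok j h)
    · rw [Function.update_self, Function.update_self]
      exact BinRule.dep_congr (fun i hi => by rw [Function.update_of_ne (by omega)]) hr

section
variable (B : BinGram α) {r : BinRule α} (hr : r.Ok B.card)

@[simp] theorem push_card : (B.push r hr).card = B.card + 1 := rfl

theorem push_rule_of_lt {j : ℕ} (h : j < B.card) : (B.push r hr).rule j = B.rule j :=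
  Function.update_of_ne h.ne _ _

theorem push_str_of_lt {j : ℕ} (h : j < B.card) : (B.push r hr).str j = B.str j :=
  Function.update_of_ne h.ne _ _

theorem push_dep_of_lt {j : ℕ} (h : j < B.card) : (B.push r hr).dep j = B.dep j :=
  Function.update_of_ne h.ne _ _

@[simp] theorem push_rule_card : (B.push r hr).rule B.card = r := Function.update_self _ _ _

@[simp] theorem push_str_card : (B.push r hr).str B.card = r.str B.str := Function.update_self _ _ _

@[simp] theorem push_dep_card : (B.push r hr).dep B.card = r.dep B.dep := Function.update_self _ _ _

end

/-- `B'` extends `B` by further variables. -/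
structure Extends (B B' : BinGram α) : Prop where
  card_le : B.card ≤ B'.card
  rule_eq : ∀ j < B.card, B'.rule j = B.rule j
  str_eq : ∀ j < B.card, B'.str j = B.str j
  dep_eq : ∀ j < B.card, B'.dep j = B.dep j

theorem Extends.refl (B : BinGram α) : B.Extends B :=
  ⟨le_rfl, fun _ _ => rfl, fun _ _ => rfl, fun _ _ => rfl⟩

theorem Extends.trans {B B' B'' : BinGram α} (h : B.Extends B') (h' : B'.Extends B'') :
    B.Extends B'' :=
  ⟨h.card_le.trans h'.card_le,
    fun j hj => (h'.rule_eq j (hj.trans_le h.card_le)).trans (h.rule_eq j hj),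
    fun j hj => (h'.str_eq j (hj.trans_le h.card_le)).trans (h.str_eq j hj),
    fun j hj => (h'.dep_eq j (hj.trans_le h.card_le)).trans (h.dep_eq j hj)⟩

theorem extends_push (B : BinGram α) {r : BinRule α} (hr : r.Ok B.card) : B.Extends (B.push r hr) :=
  ⟨Nat.le_succ _, fun _ h => B.push_rule_of_lt hr h, fun _ h => B.push_str_of_lt hr h,
    fun _ h => B.push_dep_of_lt hr h⟩

theorem str_ne_nil (B : BinGram α) : ∀ j < B.card, B.str j ≠ [] := by
  intro j
  induction j using Nat.strong_induction_on with
  | _ j ih =>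
    intro hj
    have ok := B.ok j hj
    rw [B.str_eq j hj]
    cases hr : B.rule j with
    | leaf a => simp [BinRule.str]
    | pair x y =>
      rw [hr] at ok
      have := ih x ok.1 (ok.1.trans hj)
      simp [BinRule.str, this]
    | pow x t =>
      rw [hr] at ok
      obtain ⟨h1, h2⟩ := ok
      have := ih x h1 (h1.trans hj)
      obtain ⟨t, rfl⟩ : ∃ s, t = s + 1 := ⟨t - 1, by omega⟩
      simp [BinRule.str, List.replicate_succ, this]

/-- The rules of the grammar. -/
def rules (B : BinGram α) : List (RLRule α) := (List.range B.card).map fun j => (B.rule j).toRule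

theorem rules_push (B : BinGram α) {r : BinRule α} (hr : r.Ok B.card) :
    (B.push r hr).rules = B.rules ++ [r.toRule] := by
  unfold rules
  rw [push_card, List.range_succ, List.map_append, List.map_singleton, push_rule_card]
  congr 1
  refine List.map_congr_left fun j hj => ?_
  rw [push_rule_of_lt _ _ (List.mem_range.1 hj)]

/-- A nonempty grammar in normal form as a run-length straight-line program. -/
def toRLSLP (B : BinGram α) (h : 0 < B.card) : RLSLP α where
  rules := B.rules
  nonempty := by
    intro e
    have := congrArg List.length e
    simp [rules] at this
    omega
  admissible := by
    intro r hr
    simp only [rules, List.mem_map, List.mem_range] at hr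
    obtain ⟨j, hj, rfl⟩ := hr
    have := B.ok j hj
    cases hr : B.rule j with
    | leaf a => trivial
    | pair x y => simp [BinRule.toRule, RLRule.Admissible]
    | pow x t => rw [hr] at this; exact this.2
  ordered := by
    intro A hA C hC
    simp only [rules, List.length_map, List.length_range] at hA
    have := B.ok A hA
    simp only [rules, List.getElem_map, List.getElem_range] at hC
    cases hr : B.rule A with
    | leaf a => rw [hr] at hC; simp [BinRule.toRule, RLRule.unfold] at hC
    | pair x y =>
      rw [hr] at hC this
      simp only [BinRule.toRule, RLRule.unfold, List.map_cons, List.map_nil, List.mem_cons,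
        Sum.inl.injEq, List.not_mem_nil, or_false] at hC
      rcases hC with rfl | rfl
      exacts [this.1, this.2]
    | pow x t =>
      rw [hr] at hC this
      simp only [BinRule.toRule, RLRule.unfold, List.mem_replicate, Sum.inl.injEq] at hC
      rw [hC.2]
      exact this.1

theorem isBinary_toRLSLP (B : BinGram α) (h : 0 < B.card) :
    ∀ r ∈ (B.toRLSLP h).rules, r.Admissible ∧ r.IsBinary := by
  intro r hr
  refine ⟨(B.toRLSLP h).admissible r hr, ?_⟩
  simp only [toRLSLP, rules, List.mem_map, List.mem_range] at hr
  obtain ⟨j, hj, rfl⟩ := hr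
  cases B.rule j <;> simp [BinRule.toRule, RLRule.IsBinary]

theorem size_toRLSLP_le (B : BinGram α) (h : 0 < B.card) : (B.toRLSLP h).size ≤ 2 * B.card := by
  unfold RLSLP.size
  simp only [toRLSLP, rules]
  have : ((List.range B.card).map fun j => (B.rule j).toRule).length = B.card := by simp
  have le := List.sum_le_card_nsmul
    (((List.range B.card).map fun j => (B.rule j).toRule).map RLRule.size) 2 fun x hx => ?_
  · rw [List.length_map, this, smul_eq_mul, mul_comm] at le
    exact le
  simp only [List.mem_map, List.mem_range] at hx
  obtain ⟨r, ⟨j, -, rfl⟩, rfl⟩ := hx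
  cases B.rule j <;> simp [BinRule.toRule, RLRule.size]

end BinGram

namespace RLSLP

variable {α : Type*} (G : RLSLP α)

theorem exp_eq (A : ℕ) : G.exp A =
    (G.rhs A).flatMap (Sum.elim G.exp fun a => [a]) := by
  rw [exp]
  conv_rhs => rw [← List.attach_map_subtype_val (G.rhs A), List.flatMap_map]
  congr 1
  funext ⟨s, hs⟩
  cases s <;> rfl

theorem depthOf_eq (A : ℕ) : G.depthOf A =
    1 + ((G.rhs A).map (Sum.elim G.depthOf fun _ => 0)).foldr max 0 := by
  rw [depthOf]
  conv_rhs => rw [← List.attach_map_subtype_val (G.rhs A), List.map_map]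
  congr 3
  funext ⟨s, hs⟩
  cases s <;> rfl

theorem rhs_eq {A : ℕ} (h : A < G.rules.length) : G.rhs A = (G.rules[A]).unfold := by
  simp [rhs, h]

end RLSLP

namespace BinGram

variable {α : Type*}

theorem rhs_toRLSLP (B : BinGram α) (h : 0 < B.card) {j : ℕ} (hj : j < B.card) :
    (B.toRLSLP h).rhs j = ((B.rule j).toRule).unfold := by
  have : j < (B.toRLSLP h).rules.length := by simpa [toRLSLP, rules] using hj
  rw [RLSLP.rhs_eq _ this]
  simp [toRLSLP, rules]

theorem exp_toRLSLP (B : BinGram α) (h : 0 < B.card) (j : ℕ) (hj : j < B.card) :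
    (B.toRLSLP h).exp j = B.str j := by
  induction j using Nat.strong_induction_on with
  | _ j ih =>
    have ok := B.ok j hj
    rw [RLSLP.exp_eq, rhs_toRLSLP _ _ hj, B.str_eq j hj]
    cases hr : B.rule j with
    | leaf a => simp [BinRule.toRule, RLRule.unfold, BinRule.str]
    | pair x y =>
      rw [hr] at ok
      simp [BinRule.toRule, RLRule.unfold, BinRule.str, ih x ok.1 (ok.1.trans hj),
        ih y ok.2 (ok.2.trans hj)]
    | pow x t =>
      rw [hr] at ok
      simp [BinRule.toRule, RLRule.unfold, BinRule.str, ih x ok.1 (ok.1.trans hj), List.flatMap]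

theorem foldr_max_replicate_le (t d : ℕ) : (List.replicate t d).foldr max 0 ≤ d := by
  induction t with
  | zero => simp
  | succ t ih => simpa [List.replicate_succ] using ih

theorem depthOf_toRLSLP_le (B : BinGram α) (h : 0 < B.card) (j : ℕ) (hj : j < B.card) :
    (B.toRLSLP h).depthOf j ≤ B.dep j := by
  induction j using Nat.strong_induction_on with
  | _ j ih =>
    have ok := B.ok j hj
    rw [RLSLP.depthOf_eq, rhs_toRLSLP _ _ hj, B.dep_eq j hj]
    cases hr : B.rule j with
    | leaf a => simp [BinRule.toRule, RLRule.unfold, BinRule.dep]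
    | pair x y =>
      rw [hr] at ok
      have h1 := ih x ok.1 (ok.1.trans hj)
      have h2 := ih y ok.2 (ok.2.trans hj)
      simp [BinRule.toRule, RLRule.unfold, BinRule.dep]
      omega
    | pow x t =>
      rw [hr] at ok
      have h1 := ih x ok.1 (ok.1.trans hj)
      simp only [BinRule.toRule, RLRule.unfold, BinRule.dep, List.map_replicate, Sum.elim_inl]
      exact Nat.add_le_add_left ((foldr_max_replicate_le _ _).trans h1) 1

end BinGram

/-! ### Parsing and binarizing the input -/

/-- The sequence `l` is stored from position `p` on. -/
def At (f : ℕ → ℕ) (p : ℕ) (l : List ℕ) : Prop := ∀ (i : ℕ) (hi : i < l.length), f (p + i) = l[i]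

namespace At

variable {f : ℕ → ℕ} {p x : ℕ} {l l' : List ℕ}

@[simp] theorem nil : At f p [] := fun i hi => by simp at hi

@[simp] theorem cons_iff : At f p (x :: l) ↔ f p = x ∧ At f (p + 1) l := by
  constructor
  · intro h
    refine ⟨h 0 (Nat.succ_pos _), fun i hi => ?_⟩
    have := h (i + 1) (by simpa using hi)
    rw [show p + (i + 1) = p + 1 + i by omega] at this
    simpa using this
  · rintro ⟨h0, h⟩ i hi
    cases i with
    | zero => simpa using h0
    | succ i =>
      rw [show p + (i + 1) = p + 1 + i by omega, h i (by simpa using hi)]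
      simp

@[simp] theorem append_iff : At f p (l ++ l') ↔ At f p l ∧ At f (p + l.length) l' := by
  induction l generalizing p with
  | nil => simp
  | cons x l ih => simp [ih, and_assoc, show p + 1 + l.length = p + (l.length + 1) by omega]

theorem congr {g : ℕ → ℕ} (h : At f p l) (hfg : ∀ i < p + l.length, g i = f i) : At g p l :=
  fun i hi => by rw [hfg _ (by omega), h i hi]

end At

/-!
Names of arrays and variables.  Input: the input `aIn`, its length `rB`, the number `rM` of rules,
the reading position `rPos`, the end `rEnd` of the current rule.  Binarized grammar: the number `rN`
of variables, the records `aKind`, `aX`, `aY` of their rules, the translation `aMap` of the variables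
of the input, and the numbers `aP` of paths.  The current variable is `rI`, its kind `rK`; `rCur` is
the variable that derives the part of the current rule read so far; `rOne` and `rTwo` are constants.
-/
notation "aIn" => (0 : ℕ)
notation "aKind" => (1 : ℕ)
notation "aX" => (2 : ℕ)
notation "aY" => (3 : ℕ)
notation "aMap" => (4 : ℕ)
notation "aP" => (5 : ℕ)
notation "rB" => (1 : ℕ)
notation "rM" => (2 : ℕ)
notation "rI" => (3 : ℕ)
notation "rPos" => (4 : ℕ)
notation "rK" => (5 : ℕ)
notation "rOne" => (6 : ℕ)
notation "rTwo" => (7 : ℕ)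
notation "rN" => (8 : ℕ)
notation "rCur" => (9 : ℕ)
notation "rEnd" => (10 : ℕ)

open WordRAM

namespace RLRule

variable {α : Type*}

theorem length_encode_le (code : α → ℕ) (r : RLRule α) (hr : r.Admissible) :
    r.size < (r.encode code).length ∧ (r.encode code).length ≤ 2 * r.size ∧ 0 < r.size := by
  cases r with
  | term a => simp [size, encode]
  | seq l =>
    have : 1 < l.length := hr
    simp only [size, encode, List.length_cons]
    omega
  | run B t => simp [size, encode]

end RLRule

namespace RLSLP

variable {α : Type*} (G : RLSLP α)

theorem exp_eq_of_rule {A : ℕ} {r : RLRule α} (h : G.rules[A]? = some r) :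
    G.exp A = r.unfold.flatMap (Sum.elim G.exp fun a => [a]) := by
  rw [exp_eq, rhs, h]
  rfl

theorem lt_of_mem_unfold {A B : ℕ} {r : RLRule α} (h : G.rules[A]? = some r)
    (hB : Sum.inl B ∈ r.unfold) : B < A :=
  G.lt_of_mem_rhs (by rw [rhs, h]; exact hB)

theorem length_rules_le_size (l : List (RLRule α)) (h : ∀ r ∈ l, r.Admissible) (code : α → ℕ) :
    l.length ≤ (l.map RLRule.size).sum ∧
    (l.map RLRule.size).sum ≤ (l.flatMap (RLRule.encode code)).length ∧
    (l.flatMap (RLRule.encode code)).length ≤ 2 * (l.map RLRule.size).sum := by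
  induction l with
  | nil => simp
  | cons r l ih =>
    have h1 := ih fun r hr => h r (List.mem_cons_of_mem _ hr)
    have h2 := RLRule.length_encode_le code r (h r List.mem_cons_self)
    simp only [List.length_cons, List.map_cons, List.sum_cons, List.flatMap_cons,
      List.length_append]
    omega

end RLSLP

namespace WordRAM

/-- Find the end of the input. -/
def scan : Cmd :=
  .asg rM (.rd aIn 0) ;; .asg rOne 1 ;; .asg rTwo 2 ;; .asg rPos 1 ;; .asg rI 0 ;;
  .loop (.lt rI rM) (
    .asg rK (.rd aIn ♯rPos) ;;
    .ite (.eq rK rOne) (.asg rPos (♯rPos + (.rd aIn (♯rPos + 1) + 2)))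
      (.ite (.eq rK rTwo) (.asg rPos (♯rPos + 3)) (.asg rPos (♯rPos + 2))) ;;
    .asg rI (♯rI + 1)) ;;
  .asg rB ♯rPos

theorem runs_scan {α : Type*} {code : α → ℕ} {G : RLSLP α} {b w : ℕ} (hw : 64 * b + 64 < 2 ^ w)
    {h : Store} (hlen : (G.encode code).length = b) (hin : At (h.arr aIn) 0 (G.encode code)) :
    Runs b w scan h fun t h' => t ≤ 60 * G.rules.length + 60 ∧ h'.arr = h.arr ∧ h'.var rB = b ∧
      h'.var rM = G.rules.length ∧ h'.var rOne = 1 ∧ h'.var rTwo = 2 := by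
  unfold scan
  simp only [RLSLP.encode, List.length_cons] at hlen
  simp only [RLSLP.encode, At.cons_iff] at hin
  obtain ⟨hm, hin⟩ := hin
  apply Runs.of_wp hw
  simp [Cmd.wp, hm, Expr.addrCost]
  refine ⟨by omega, ?_⟩
  refine (Runs.loop (fun (l : List (RLRule α)) h' => h'.arr = h.arr ∧ h'.var rM = G.rules.length ∧
      h'.var rOne = 1 ∧ h'.var rTwo = 2 ∧ h'.var rI + l.length = G.rules.length ∧
      h'.var rPos + (l.flatMap (RLRule.encode code)).length = b ∧
      At (h.arr aIn) (h'.var rPos) (l.flatMap (RLRule.encode code)))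
    (fun l => 50 * l.length) (by simp) ?_ G.rules _ ?_).mono ?_
  · rintro (_ | ⟨r, l⟩) h' ⟨ha, hM, h1, h2, hI, hP, hat⟩ ht
    · simp only [Test.inStore_lt, List.length_nil] at ht hI
      omega
    simp only [List.flatMap_cons, List.length_append, At.append_iff, List.length_cons] at hP hI hat
    obtain ⟨hr, hl⟩ := hat
    have hb := RLSLP.length_rules_le_size G.rules G.admissible code
    apply Runs.of_wp hw
    cases r with
    | term a =>
      simp only [RLRule.encode, At.cons_iff, List.length_cons, List.length_nil] at hr hP hl
      simp [Cmd.wp, ha, h1, h2, Expr.addrCost, hr, -List.length_flatMap]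
      refine ⟨by omega, by omega, by omega, l, ⟨hM, by omega, by omega, ?_⟩, by omega⟩
      simpa [add_assoc] using hl
    | seq s =>
      simp only [RLRule.encode, At.cons_iff, List.length_cons] at hr hP hl
      simp [Cmd.wp, ha, h1, h2, Expr.addrCost, hr, -List.length_flatMap]
      refine ⟨by omega, by omega, by omega, l, ⟨hM, by omega, by omega, ?_⟩, by omega⟩
      simpa [add_assoc] using hl
    | run B t =>
      simp only [RLRule.encode, At.cons_iff, List.length_cons, List.length_nil] at hr hP hl
      simp [Cmd.wp, ha, h1, h2, Expr.addrCost, hr, -List.length_flatMap]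
      refine ⟨by omega, by omega, by omega, l, ⟨hM, by omega, by omega, ?_⟩, by omega⟩
      simpa [add_assoc] using hl
  · simp [-List.length_flatMap]
    exact ⟨by omega, by simpa using hin⟩
  · rintro t h' ⟨l, ⟨ha, hM, h1, h2, hI, hP, hat⟩, ht, hle⟩
    simp only [Test.inStore_lt] at ht
    obtain rfl : l = [] := List.length_eq_zero_iff.1 (by omega)
    simp at hP hle
    exact ⟨by omega, ha, hP, hM, h1, h2⟩

/-- The rule is stored as a kind and two arguments. -/
def _root_.BinRule.Stored {α : Type*} (code : α → ℕ) (k x y : ℕ) : BinRule α → Prop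
  | .leaf a => k = 0 ∧ x = code a
  | .pair i j => k = 1 ∧ x = i ∧ y = j
  | .pow i t => k = 2 ∧ x = i ∧ y = t

/-- The rules of the grammar are stored in the arrays `aKind`, `aX` and `aY`. -/
def _root_.BinGram.Stored {α : Type*} (B : BinGram α) (code : α → ℕ) (f : ℕ → ℕ → ℕ) : Prop :=
  ∀ j < B.card, (B.rule j).Stored code (f aKind j) (f aX j) (f aY j)

theorem _root_.BinGram.Stored.push {α : Type*} {B : BinGram α} {code : α → ℕ} {f f' : ℕ → ℕ → ℕ}
    (h : B.Stored code f) (hf : ∀ j < B.card, f' aKind j = f aKind j ∧ f' aX j = f aX j ∧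
      f' aY j = f aY j) {r : BinRule α} (hr : r.Ok B.card)
    (hs : r.Stored code (f' aKind B.card) (f' aX B.card) (f' aY B.card)) :
    (B.push r hr).Stored code f' := by
  intro j hj
  rcases Nat.lt_succ_iff_lt_or_eq.1 hj with h1 | rfl
  · rw [B.push_rule_of_lt hr h1, (hf j h1).1, (hf j h1).2.1, (hf j h1).2.2]
    exact h j h1
  · rw [B.push_rule_card hr]
    exact hs

/-- Read the rules, store them as records and replace the rules with more than two variables on the
right-hand side by left combs. -/
def binarize : Cmd :=
  .asg rPos 1 ;; .asg rI 0 ;; .asg rN 0 ;;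
  .loop (.lt rI rM) (
    .asg rK (.rd aIn ♯rPos) ;;
    .ite (.eq rK rOne)
      (.asg rEnd (♯rPos + (.rd aIn (♯rPos + 1) + 2)) ;;
       .asg rCur (.rd aMap (.rd aIn (♯rPos + 2))) ;;
       .asg rPos (♯rPos + 3) ;;
       .loop (.lt rPos rEnd) (
         .wr aKind ♯rN 1 ;; .wr aX ♯rN ♯rCur ;; .wr aY ♯rN (.rd aMap (.rd aIn ♯rPos)) ;;
         .asg rCur ♯rN ;; .asg rN (♯rN + 1) ;; .asg rPos (♯rPos + 1)))
      (.wr aKind ♯rN ♯rK ;;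
       .ite (.eq rK rTwo)
         (.wr aX ♯rN (.rd aMap (.rd aIn (♯rPos + 1))) ;; .wr aY ♯rN (.rd aIn (♯rPos + 2)) ;;
          .asg rPos (♯rPos + 3))
         (.wr aX ♯rN (.rd aIn (♯rPos + 1)) ;; .asg rPos (♯rPos + 2)) ;;
       .asg rCur ♯rN ;; .asg rN (♯rN + 1)) ;;
    .wr aMap ♯rI ♯rCur ;; .asg rI (♯rI + 1))

/-- The first `i` variables of `G` have been translated to variables of `B`. -/
structure Binarized {α : Type*} (code : α → ℕ) (G : RLSLP α) (b : ℕ) (h₀ : Store) (i : ℕ)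
    (B : BinGram α) (h : Store) : Prop where
  input : h.arr aIn = h₀.arr aIn
  zero : ∀ a, 5 ≤ a → h.arr a = h₀.arr a
  varB : h.var rB = b
  varM : h.var rM = G.rules.length
  one : h.var rOne = 1
  two : h.var rTwo = 2
  varI : h.var rI = i
  varN : h.var rN = B.card
  stored : B.Stored code h.arr
  map_lt : ∀ A < i, h.arr aMap A < B.card
  map_str : ∀ A < i, B.str (h.arr aMap A) = G.exp A

/-- The inner loop of `binarize`: translate the remaining variables of a right-hand side. -/
theorem runs_comb {α : Type*} {code : α → ℕ} {G : RLSLP α} {b w : ℕ} (hw : 64 * b + 64 < 2 ^ w)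
    {h₀ h : Store} {B : BinGram α} {i : ℕ} (hi : Binarized code G b h₀ i B h) {l : List ℕ}
    (hl : ∀ A ∈ l, A < i) (hat : At (h₀.arr aIn) (h.var rPos) l)
    (hE : h.var rPos + l.length = h.var rEnd) (hE' : h.var rEnd ≤ b) (hl0 : l ≠ [])
    (hib : i ≤ b) (hB : B.card + l.length < b) (hc : h.var rCur < B.card) :
    Runs b w (.loop (.lt rPos rEnd) (
         .wr aKind ♯rN 1 ;; .wr aX ♯rN ♯rCur ;; .wr aY ♯rN (.rd aMap (.rd aIn ♯rPos)) ;;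
         .asg rCur ♯rN ;; .asg rN (♯rN + 1) ;; .asg rPos (♯rPos + 1))) h fun t h' =>
      ∃ B' : BinGram α, t ≤ 50 * l.length + 1 ∧ Binarized code G b h₀ i B' h' ∧
        B'.card = B.card + l.length ∧ h'.var rCur + 1 = B'.card ∧ h'.var rPos = h.var rEnd ∧
        B'.str (h'.var rCur) = B.str (h.var rCur) ++ l.flatMap G.exp := by
  refine (Runs.loop (fun (g : List ℕ × BinGram α) h' =>
    Binarized code G b h₀ i g.2 h' ∧ (∀ A ∈ g.1, A < i) ∧ At (h₀.arr aIn) (h'.var rPos) g.1 ∧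
    h'.var rEnd = h.var rEnd ∧ h'.var rPos + g.1.length = h.var rEnd ∧
    g.2.card + g.1.length = B.card + l.length ∧ h'.var rCur < g.2.card ∧
    (g.1 = [] → h'.var rCur + 1 = g.2.card) ∧
    g.2.str (h'.var rCur) ++ g.1.flatMap G.exp = B.str (h.var rCur) ++ l.flatMap G.exp)
    (fun g => 50 * g.1.length) (by simp) ?_ (l, B) _
    ⟨hi, hl, hat, rfl, hE, rfl, hc, fun h => absurd h hl0, rfl⟩).mono ?_
  · rintro ⟨_ | ⟨A, g⟩, C⟩ h' ⟨hi, hl, hat, e1, e2, e3, e4, -, e5⟩ ht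
    · simp at ht e2; omega
    simp only [List.length_cons, At.cons_iff, List.mem_cons, forall_eq_or_imp] at hat e2 e3 e5 hl
    have hA := hi.map_lt A hl.1
    have hm : C.str (h'.arr aMap A) = G.exp A := hi.map_str A hl.1
    have hr : (BinRule.pair (h'.var rCur) (h'.arr aMap A) : BinRule α).Ok C.card := ⟨e4, hA⟩
    have hn := hi.varN
    have hI := hi.input
    apply Runs.of_wp hw
    simp [Cmd.wp, Expr.addrCost, hI, hat.1, hi.varB, hn]
    refine ⟨by omega, by omega, by omega, by omega, by omega, g, ⟨C.push _ hr, ?_, hl.2, hat.2, e1,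
      by omega, ?_, ?_, fun _ => ?_, ?_⟩, by omega⟩
    · exact
      { input := by funext j; simp [hI]
        zero := fun a ha => by
          funext j
          have := hi.zero a ha
          simp [show a ≠ 1 by omega, show a ≠ 2 by omega, show a ≠ 3 by omega, this]
        varB := by simpa using hi.varB
        varM := by simpa using hi.varM
        one := by simpa using hi.one
        two := by simpa using hi.two
        varI := by simpa using hi.varI
        varN := by simp
        stored := hi.stored.push (fun j hj => by simp [hj.ne]) hr (by simp [BinRule.Stored])
        map_lt := fun A hA => by simpa using (hi.map_lt A hA).le
        map_str := fun A hA => by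
          simpa [C.push_str_of_lt hr (hi.map_lt A hA)] using hi.map_str A hA }
    · simp; omega
    · simp
    · simp
    · simp only [BinGram.push_str_card, BinRule.str, hm, ← e5, List.flatMap_cons,
        List.append_assoc]
  · rintro t h' ⟨⟨g, C⟩, ⟨hi, hl, hat, e1, e2, e3, e4, e6, e5⟩, ht, hle⟩
    simp only [Test.inStore_lt] at ht
    obtain rfl : g = [] := List.length_eq_zero_iff.1 (by simp at e2; omega)
    simp at hle e2 e5 e3
    exact ⟨C, hle, hi, e3, e6 rfl, by omega, e5⟩

/-- A single new variable translates the next rule. -/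
theorem Binarized.push {α : Type*} {code : α → ℕ} {G : RLSLP α} {b i : ℕ} {h₀ h h' : Store}
    {B : BinGram α} (hi : Binarized code G b h₀ i B h) {r : BinRule α} (hr : r.Ok B.card)
    (hx : r.str B.str = G.exp i)
    (hs : r.Stored code (h'.arr aKind B.card) (h'.arr aX B.card) (h'.arr aY B.card))
    (hf : ∀ j < B.card, h'.arr aKind j = h.arr aKind j ∧ h'.arr aX j = h.arr aX j ∧
      h'.arr aY j = h.arr aY j)
    (hm : ∀ A, h'.arr aMap A = if A = i then B.card else h.arr aMap A)
    (h0 : h'.arr aIn = h.arr aIn) (h5 : ∀ a, 5 ≤ a → h'.arr a = h.arr a)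
    (hv : h'.var rB = h.var rB ∧ h'.var rM = h.var rM ∧ h'.var rOne = h.var rOne ∧
      h'.var rTwo = h.var rTwo ∧ h'.var rI = i + 1 ∧ h'.var rN = B.card + 1) :
    Binarized code G b h₀ (i + 1) (B.push r hr) h' where
  input := h0.trans hi.input
  zero a ha := (h5 a ha).trans (hi.zero a ha)
  varB := hv.1.trans hi.varB
  varM := hv.2.1.trans hi.varM
  one := hv.2.2.1.trans hi.one
  two := hv.2.2.2.1.trans hi.two
  varI := hv.2.2.2.2.1
  varN := hv.2.2.2.2.2
  stored := hi.stored.push hf hr hs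
  map_lt A hA := by
    rw [hm]
    split_ifs with h1
    · simp
    · exact (hi.map_lt A (by omega)).trans (by simp)
  map_str A hA := by
    rw [hm]
    split_ifs with h1
    · simpa [h1] using hx
    · rw [B.push_str_of_lt hr (hi.map_lt A (by omega)), hi.map_str A (by omega)]

theorem runs_binarize {α : Type*} {code : α → ℕ} {G : RLSLP α} {b w : ℕ}
    (hw : 64 * b + 64 < 2 ^ w) {h : Store} (hlen : (G.encode code).length = b)
    (hin : At (h.arr aIn) 0 (G.encode code)) (hB : h.var rB = b)
    (hM : h.var rM = G.rules.length) (h1 : h.var rOne = 1) (h2 : h.var rTwo = 2) :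
    Runs b w binarize h fun t h' => ∃ B : BinGram α, t ≤ 100 * G.size + 10 ∧
      Binarized code G b h G.rules.length B h' ∧ B.card ≤ G.size ∧ 0 < B.card ∧
      B.str (B.card - 1) = G.word := by
  have hsz := RLSLP.length_rules_le_size G.rules G.admissible code
  unfold binarize
  simp only [RLSLP.encode, List.length_cons] at hlen
  simp only [RLSLP.encode, At.cons_iff] at hin
  obtain ⟨hm, hin⟩ := hin
  have hb' : G.rules.length < b := by omega
  have hsb : G.size < b := by unfold RLSLP.size; omega
  apply Runs.of_wp hw
  simp [Cmd.wp]
  refine (Runs.loop (fun (g : (List (RLRule α) × List (RLRule α)) × BinGram α) h' =>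
      Binarized code G b h g.1.1.length g.2 h' ∧ G.rules = g.1.1 ++ g.1.2 ∧
      h'.var rPos + (g.1.2.flatMap (RLRule.encode code)).length = b ∧
      At (h.arr aIn) (h'.var rPos) (g.1.2.flatMap (RLRule.encode code)) ∧
      g.2.card + (g.1.2.map RLRule.size).sum ≤ G.size ∧
      (0 < g.1.1.length → h'.arr aMap (g.1.1.length - 1) + 1 = g.2.card))
    (fun g => 100 * (g.1.2.map RLRule.size).sum) (by simp) ?_ (([], G.rules), BinGram.empty)
    _ ?_).mono ?_
  · rintro ⟨⟨pre, _ | ⟨r, l⟩⟩, B⟩ h' ⟨hi, hG, hP, hat, hc, hlast⟩ ht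
    · have := hi.varI
      have := hi.varM
      simp only [Test.inStore_lt] at ht
      simp only [List.append_nil] at hG
      subst hG
      dsimp only at *
      omega
    simp only [List.flatMap_cons, List.length_append, At.append_iff, List.map_cons,
      List.sum_cons] at hP hat hc ⊢
    obtain ⟨hr, hl⟩ := hat
    have hrule : G.rules[pre.length]? = some r := by rw [hG]; simp
    have hlen' : pre.length < G.rules.length := by rw [hG]; simp
    have hexp := G.exp_eq_of_rule hrule
    have hlt := fun A => G.lt_of_mem_unfold (B := A) hrule
    have hI := hi.input
    have hn : h'.var rN = B.card := hi.varN
    have hi' : h'.var rI = pre.length := hi.varI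
    have h1 := hi.one
    have h2 := hi.two
    have hvB := hi.varB
    apply Runs.of_wp hw
    have hadm : r.Admissible := G.admissible r (by rw [hG]; simp)
    have hsize := RLRule.length_encode_le code r hadm
    cases r with
    | term a =>
      simp only [RLRule.encode, At.cons_iff, List.length_cons, List.length_nil, RLRule.size]
        at hr hP hl hc
      have ok : (BinRule.leaf a).Ok B.card := trivial
      simp [Cmd.wp, hI, h1, h2, Expr.addrCost, hr, -List.length_flatMap, hvB, hn, hi']
      repeat refine And.intro (by omega) ?_
      refine ⟨pre ++ [.term a], l,
        ⟨B.push (.leaf a) ok, ?_, by simpa using hG, by omega, by simpa [add_assoc] using hl, by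
          simp; omega, by simp⟩, by simp [RLRule.size]; omega⟩
      rw [List.length_append]
      exact hi.push ok (by simp [hexp, BinRule.str, RLRule.unfold]) (by simp [BinRule.Stored])
        (fun j hj => by simp [hj.ne]) (fun A => by simp) (by funext j; simp)
        (fun a' ha' => by
          funext j
          simp [show a' ≠ 1 by omega, show a' ≠ 2 by omega, show a' ≠ 4 by omega]) (by simp)
    | seq s =>
      have hs2 : 1 < s.length := hadm
      obtain ⟨A, s, rfl⟩ : ∃ A s', s = A :: s' := List.exists_cons_of_ne_nil (by
        rintro rfl; simp at hs2)
      simp only [RLRule.encode, At.cons_iff, List.length_cons, RLRule.size] at hr hP hl hc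
      have hlt' : ∀ C ∈ A :: s, C < pre.length := fun C hC =>
        hlt C (List.mem_map.2 ⟨C, hC, rfl⟩)
      have hA := hi.map_lt A (hlt' A List.mem_cons_self)
      have hlt0 := hlt' A List.mem_cons_self
      have hs : h'.arr aMap A < B.card := hA
      have hmA : B.str (h'.arr aMap A) = G.exp A := hi.map_str A hlt0
      simp [Cmd.wp, hI, h1, h2, Expr.addrCost, hr, -List.length_flatMap, hvB]
      repeat refine And.intro (by omega) ?_
      refine (runs_comb (code := code) (G := G) (B := B) (i := pre.length) (l := s) (h₀ := h) hw ?_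
        (fun C hC => hlt' C (List.mem_cons_of_mem _ hC)) ?_ ?_ ?_ ?_ ?_ ?_ ?_).mono ?_
      · exact
        { input := hi.input, zero := hi.zero, varB := by simpa using hi.varB,
          varM := by simpa using hi.varM, one := by simpa using hi.one,
          two := by simpa using hi.two, varI := by simpa using hi.varI,
          varN := by simpa using hi.varN, stored := hi.stored, map_lt := hi.map_lt,
          map_str := hi.map_str }
      · simpa [add_assoc] using hr.2.2.2
      · simp; omega
      · simp; omega
      · rintro rfl; simp at hs2
      · omega
      · omega
      · simpa using hs
      · rintro t h'' ⟨C, ht', hC, hcard, hcur, hpos, hstr⟩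
        have hi'' : h''.var rI = pre.length := hC.varI
        have hvB' := hC.varB
        simp at hpos hstr
        simp [hi'', hvB', -List.length_flatMap]
        repeat refine And.intro (by omega) ?_
        refine ⟨pre ++ [.seq (A :: s)], l, ⟨C, ?_, by simpa using hG, by omega, ?_, by omega,
          by simpa using hcur⟩, ?_⟩
        · rw [List.length_append]
          exact
          { input := by funext j; simp [hC.input]
            zero := fun a ha => by
              funext j
              simp [show a ≠ 4 by omega, hC.zero a ha]
            varB := by simpa using hC.varB
            varM := by simpa using hC.varM
            one := by simpa using hC.one
            two := by simpa using hC.two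
            varI := by simp
            varN := by simpa using hC.varN
            stored := hC.stored
            map_lt := fun D hD => by
              by_cases hD' : D = pre.length
              · simp [hD']; omega
              · simp only [List.length_singleton] at hD
                simpa [hD'] using hC.map_lt D (by omega)
            map_str := fun D hD => by
              by_cases hD' : D = pre.length
              · simp [hD', hexp, hstr, RLRule.unfold, hmA, List.flatMap_map]
              · simp only [List.length_singleton] at hD
                simpa [hD'] using hC.map_str D (by omega) }
        · rw [hpos]
          convert hl using 1
        · simp only [RLRule.size, List.length_cons]
          omega
    | run A k =>
      simp only [RLRule.encode, At.cons_iff, List.length_cons, List.length_nil, RLRule.size]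
        at hr hP hl hc
      have hk : 2 < k := hadm
      have hA : A < pre.length := hlt A (by simp [RLRule.unfold]; omega)
      have hA' : h'.arr aMap A < B.card := hi.map_lt A hA
      have hmA : B.str (h'.arr aMap A) = G.exp A := hi.map_str A hA
      have ok : (BinRule.pow (h'.arr aMap A) k : BinRule α).Ok B.card := ⟨hA', hk⟩
      simp [Cmd.wp, hI, h1, h2, Expr.addrCost, hr, -List.length_flatMap, hvB, hn, hi']
      repeat refine And.intro (by omega) ?_
      refine ⟨pre ++ [.run A k], l,
        ⟨B.push (.pow (h'.arr aMap A) k) ok, ?_, by simpa using hG, by omega,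
          by simpa [add_assoc] using hl, by simp; omega, by simp⟩, by simp [RLRule.size]; omega⟩
      rw [List.length_append]
      exact hi.push ok (by simp [hexp, BinRule.str, RLRule.unfold, hmA, List.flatMap])
        (by simp [BinRule.Stored])
        (fun j hj => by simp [hj.ne]) (fun A => by simp) (by funext j; simp)
        (fun a' ha' => by
          funext j
          simp [show a' ≠ 1 by omega, show a' ≠ 2 by omega, show a' ≠ 3 by omega,
            show a' ≠ 4 by omega]) (by simp)
  · refine ⟨⟨by simp, by simp, by simpa using hB, by simpa using hM, by simpa using h1,
      by simpa using h2, by simp, by simp [BinGram.empty], fun j hj => absurd hj (by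
        simp [BinGram.empty]), by simp, by simp⟩, by simp, ?_, by simpa using hin,
      by simp [BinGram.empty, RLSLP.size], by simp⟩
    simp [-List.length_flatMap]
    omega
  · rintro t h' ⟨⟨⟨pre, l⟩, B⟩, ⟨hi, hG, hP, hat, hc, hlast⟩, ht, hle⟩
    have e1 := hi.varI
    have e2 := hi.varM
    simp only [Test.inStore_lt] at ht
    have e3 := congrArg List.length hG
    simp only [List.length_append] at e3
    dsimp only at *
    obtain rfl : l = [] := List.length_eq_zero_iff.1 (by omega)
    have hpos : 0 < pre.length := by
      have := List.length_pos_iff.2 G.nonempty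
      simp at e3
      omega
    simp at hc hG
    have hl := hlast hpos
    refine ⟨?_, B, ?_, hc, by omega, ?_⟩
    · have : (G.rules.map RLRule.size).sum = G.size := rfl
      simp [this] at hle
      omega
    · rw [hG]
      exact ⟨hi.1, hi.2, hi.3, hi.4, hi.5, hi.6, hi.7, hi.8, hi.9, hi.10, hi.11⟩
    · have := hi.map_str (pre.length - 1) (by omega)
      rw [RLSLP.word, RLSLP.start, hG, ← this, ← hl]
      simp

end WordRAM

/-! ### Path counts and central edges -/

open Finset

namespace BinRule

variable {α : Type*}

theorem sum_mult_mul (f : ℕ → ℕ) {r : BinRule α} {j : ℕ} (h : r.Ok j) :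
    ∑ v ∈ range j, r.mult v * f v = match (generalizing := false) r with
      | leaf _ => 0
      | pair x y => f x + f y
      | pow x t => t * f x := by
  cases r with
  | leaf a => simp [mult]
  | pair x y =>
    simp only [mult, add_mul, ite_mul, one_mul, zero_mul, sum_add_distrib, sum_ite_eq, mem_range,
      h.1, h.2, if_true]
  | pow x t => simp only [mult, ite_mul, zero_mul, sum_ite_eq, mem_range, h.1, if_true]

end BinRule

namespace BinGram

variable {α : Type*} (B : BinGram α)

/-- The length of the string derived from a variable. -/
def len (v : ℕ) : ℕ := (B.str v).length

theorem len_pos {v : ℕ} (hv : v < B.card) : 0 < B.len v :=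
  List.length_pos_iff.2 (B.str_ne_nil v hv)

theorem len_eq {v : ℕ} (hv : v < B.card) :
    B.len v = match B.rule v with
      | .leaf _ => 1
      | .pair x y => B.len x + B.len y
      | .pow x t => t * B.len x := by
  unfold len
  rw [B.str_eq v hv]
  cases B.rule v <;> simp [BinRule.str]

theorem sum_mult_mul_len_le {v : ℕ} (hv : v < B.card) :
    ∑ u ∈ range v, (B.rule v).mult u * B.len u ≤ B.len v := by
  rw [BinRule.sum_mult_mul _ (B.ok v hv), B.len_eq hv]
  cases B.rule v <;> simp

/-- `P` counts the paths from the greatest variable in the multigraph of the grammar, as far as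
they leave variables from `i` on. -/
structure CountsFrom (i : ℕ) (P : ℕ → ℕ) : Prop where
  eq : ∀ a < B.card, P a = (if a + 1 = B.card then 1 else 0) +
    ∑ z ∈ Ico i B.card, (B.rule z).mult a * P z
  sum_le : ∑ v ∈ range i, P v * B.len v ≤ B.len (B.card - 1)
  le : ∀ v < B.card, i ≤ v → P v * B.len v ≤ B.len (B.card - 1)

theorem countsFrom_card (hB : 0 < B.card) :
    B.CountsFrom B.card (fun a => if a = B.card - 1 then 1 else 0) where
  eq a ha := by
    rw [Ico_self, sum_empty, add_zero]
    congr 1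
    rw [eq_iff_iff]
    omega
  sum_le := by
    simp only [ite_mul, one_mul, zero_mul, sum_ite_eq', mem_range]
    rw [if_pos (by omega)]
  le v h1 h2 := by omega

/-- The variable `i` passes its count on to the variables of its rule. -/
theorem CountsFrom.step {i : ℕ} {P : ℕ → ℕ} (h : B.CountsFrom (i + 1) P) (hi : i < B.card) :
    B.CountsFrom i (fun a => P a + (B.rule i).mult a * P i) := by
  have stable : ∀ z, i ≤ z → P z + (B.rule i).mult z * P i = P z := fun z hz => by
    rw [(B.ok i hi).mult_eq_zero hz, zero_mul, add_zero]
  have hsum := h.sum_le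
  rw [sum_range_succ] at hsum
  refine ⟨fun a ha => ?_, ?_, fun v hv hiv => ?_⟩
  · rw [sum_eq_sum_Ico_succ_bot hi, stable i le_rfl, h.eq a ha]
    rw [sum_congr rfl (fun z hz => by rw [stable z (by have := mem_Ico.1 hz; omega)] :
      ∀ z ∈ Ico (i + 1) B.card, (B.rule z).mult a * (P z + (B.rule i).mult z * P i) =
        (B.rule z).mult a * P z)]
    ring
  · refine le_trans ?_ hsum
    simp only [add_mul, sum_add_distrib]
    refine Nat.add_le_add_left ?_ _
    calc ∑ v ∈ range i, (B.rule i).mult v * P i * B.len v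
        = P i * ∑ v ∈ range i, (B.rule i).mult v * B.len v := by
          rw [mul_sum]; exact sum_congr rfl fun v _ => by ring
      _ ≤ _ := Nat.mul_le_mul_left _ (B.sum_mult_mul_len_le hi)
  · rw [stable v hiv]
    rcases hiv.lt_or_eq with h1 | rfl
    · exact h.le v hv h1
    · omega

theorem CountsFrom.mul_len_le {i : ℕ} {P : ℕ → ℕ} (h : B.CountsFrom i P) {v : ℕ}
    (hv : v < B.card) : P v * B.len v ≤ B.len (B.card - 1) := by
  by_cases hi : i ≤ v
  · exact h.le v hv hi
  · exact (single_le_sum (f := fun v => P v * B.len v) (fun _ _ => Nat.zero_le _)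
      (mem_range.2 (by omega))).trans h.sum_le

theorem CountsFrom.le_len {i : ℕ} {P : ℕ → ℕ} (h : B.CountsFrom i P) {v : ℕ}
    (hv : v < B.card) : P v ≤ B.len (B.card - 1) :=
  (Nat.le_mul_of_pos_right _ (B.len_pos hv)).trans (h.mul_len_le B hv)

/-- The edge from `v` to `u` leaves the binary logarithms of the numbers of paths from the greatest
variable and to the leaves unchanged. -/
def SameLevel (P : ℕ → ℕ) (v u : ℕ) : Prop :=
  Nat.log 2 (B.len v) = Nat.log 2 (B.len u) ∧ Nat.log 2 (P v) = Nat.log 2 (P u)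

instance (P : ℕ → ℕ) (v u : ℕ) : Decidable (B.SameLevel P v u) := by
  unfold SameLevel; infer_instance

/-- Which of the two variables of the rule of `v` is the central child, `0` if there is none. -/
def side (P : ℕ → ℕ) (v : ℕ) : ℕ :=
  match B.rule v with
  | .pair x y => if B.SameLevel P v x then 1 else if B.SameLevel P v y then 2 else 0
  | _ => 0

/-- `u` is the central child of `v`: the two belong to the same path of the symmetric centroid
decomposition.  Only variables that occur in the parse tree count. -/
def CentralChild (P : ℕ → ℕ) (v u : ℕ) : Prop :=
  0 < P v ∧ match B.rule v with
    | .pair x y => (B.side P v = 1 ∧ u = x) ∨ (B.side P v = 2 ∧ u = y)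
    | _ => False

instance (P : ℕ → ℕ) (v u : ℕ) : Decidable (B.CentralChild P v u) := by
  unfold CentralChild
  cases B.rule v <;> infer_instance

/-- The number of paths to the central parents among the variables below `i`. -/
def centralIn (P : ℕ → ℕ) (i u : ℕ) : ℕ :=
  ∑ v ∈ range i, if B.CentralChild P v u then P v else 0

section
variable {B} {P : ℕ → ℕ}

theorem CentralChild.sameLevel {v u : ℕ} (h : B.CentralChild P v u) : B.SameLevel P v u := by
  obtain ⟨-, h⟩ := h
  cases hr : B.rule v with
  | leaf a => rw [hr] at h; exact h.elim
  | pow x t => rw [hr] at h; exact h.elim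
  | pair x y =>
    simp only [hr, side] at h
    rcases h with ⟨h, rfl⟩ | ⟨h, rfl⟩ <;> split_ifs at h <;> first | assumption | omega

theorem CentralChild.mult_pos {v u : ℕ} (h : B.CentralChild P v u) : 0 < (B.rule v).mult u := by
  obtain ⟨-, h⟩ := h
  cases hr : B.rule v with
  | leaf a => rw [hr] at h; exact h.elim
  | pow x t => rw [hr] at h; exact h.elim
  | pair x y =>
    simp only [hr] at h
    rcases h with ⟨h, rfl⟩ | ⟨h, rfl⟩ <;> simp [BinRule.mult]

theorem CentralChild.ok {v u : ℕ} (h : B.CentralChild P v u) (hv : v < B.card) : u < v := by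
  by_contra hu
  have := h.mult_pos
  rw [(B.ok v hv).mult_eq_zero (by omega)] at this
  omega

variable (hP : B.CountsFrom 0 P)
include hP

theorem CountsFrom.mult_mul_le {v a : ℕ} (ha : a < B.card) (hv : v < B.card) :
    (B.rule v).mult a * P v ≤ P a := by
  rw [hP.eq a ha]
  refine le_trans ?_ (Nat.le_add_left _ _)
  exact single_le_sum (f := fun z => (B.rule z).mult a * P z) (fun _ _ => Nat.zero_le _)
    (mem_Ico.2 ⟨Nat.zero_le _, hv⟩)

theorem CountsFrom.root (hB : 0 < B.card) : P (B.card - 1) = 1 := by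
  have h0 : ∑ z ∈ Ico 0 B.card, (B.rule z).mult (B.card - 1) * P z = 0 := by
    refine sum_eq_zero fun z hz => ?_
    have := mem_Ico.1 hz
    rw [(B.ok z this.2).mult_eq_zero (by omega), zero_mul]
  rw [hP.eq _ (by omega), if_pos (by omega), h0]

theorem CountsFrom.centralIn_le {u : ℕ} (hu : u < B.card) : B.centralIn P B.card u ≤ P u := by
  rw [hP.eq u hu, Nat.Ico_zero_eq_range]
  refine le_trans (sum_le_sum fun z hz => ?_) (Nat.le_add_left _ _)
  split_ifs with h
  · exact Nat.le_mul_of_pos_left _ h.mult_pos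
  · exact Nat.zero_le _

theorem CountsFrom.add_centralIn_le {v a : ℕ} (hv : v < B.card) (ha : a < B.card)
    (hm : 0 < (B.rule v).mult a) (hc : ¬ B.CentralChild P v a) :
    P v + B.centralIn P B.card a ≤ P a := by
  have h1 : P v = ∑ z ∈ range B.card, if z = v then P z else 0 := by
    rw [sum_ite_eq', if_pos (mem_range.2 hv)]
  rw [hP.eq a ha, Nat.Ico_zero_eq_range, centralIn, h1, ← sum_add_distrib]
  refine le_trans (sum_le_sum fun z hz => ?_) (Nat.le_add_left _ _)
  by_cases hz : z = v
  · subst hz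
    rw [if_pos rfl, if_neg hc]
    exact Nat.le_mul_of_pos_left _ hm
  · rw [if_neg hz, zero_add]
    split_ifs with h
    · exact Nat.le_mul_of_pos_left _ h.mult_pos
    · exact Nat.zero_le _

/-- A variable has at most one central parent. -/
theorem CentralChild.unique {v v' u : ℕ} (hv : v < B.card) (hv' : v' < B.card)
    (h : B.CentralChild P v u) (h' : B.CentralChild P v' u) : v = v' := by
  by_contra hne
  have hu := (h.ok hv).trans hv
  have h1 : P v + P v' ≤ B.centralIn P B.card u := by
    unfold centralIn
    have := sum_le_sum_of_subset (f := fun z => if B.CentralChild P z u then P z else 0)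
      (show ({v, v'} : Finset ℕ) ⊆ range B.card by
        intro z hz
        simp only [mem_insert, mem_singleton] at hz
        rcases hz with rfl | rfl <;> simpa)
    rw [sum_pair hne, if_pos h, if_pos h'] at this
    exact this
  have h2 := hP.centralIn_le hu
  have h3 := lt_two_mul_of_log_eq h.1 h.sameLevel.2.symm
  have h4 := lt_two_mul_of_log_eq h'.1 h'.sameLevel.2.symm
  omega

theorem CentralChild.centralIn_eq {v u : ℕ} (hv : v < B.card) (h : B.CentralChild P v u) :
    B.centralIn P B.card u = P v := by
  unfold centralIn
  rw [sum_eq_single v, if_pos h]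
  · intro z hz hzv
    rw [if_neg fun h' => hzv (CentralChild.unique hP (mem_range.1 hz) hv h' h)]
  · intro hn
    exact absurd (mem_range.2 hv) hn

omit hP

/-- The edge from `v` to `a` does not lie on a path of the symmetric centroid decomposition. -/
structure OffEdge (B : BinGram α) (P : ℕ → ℕ) (v a : ℕ) : Prop where
  lt : a < v
  pos : 0 < P a
  add_le : P v + B.centralIn P B.card a ≤ P a
  log_len_le : Nat.log 2 (B.len a) ≤ Nat.log 2 (B.len v)
  log_le : Nat.log 2 (P v) ≤ Nat.log 2 (P a)
  ne : Nat.log 2 (B.len a) < Nat.log 2 (B.len v) ∨ Nat.log 2 (P v) < Nat.log 2 (P a)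

include hP

theorem CountsFrom.offEdge {v a : ℕ} (hv : v < B.card) (hpos : 0 < P v)
    (hm : 0 < (B.rule v).mult a) (hl : B.len a ≤ B.len v) (hs : ¬ B.SameLevel P v a) :
    B.OffEdge P v a := by
  have hav : a < v := by
    by_contra hu
    rw [(B.ok v hv).mult_eq_zero (by omega)] at hm
    omega
  have h1 := hP.add_centralIn_le hv (hav.trans hv) hm (fun h => hs h.sameLevel)
  have h2 := Nat.log_mono_right (b := 2) hl
  have h3 : Nat.log 2 (P v) ≤ Nat.log 2 (P a) := Nat.log_mono_right (by omega)
  refine ⟨hav, by omega, h1, h2, h3, ?_⟩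
  unfold SameLevel at hs
  omega

theorem CountsFrom.offEdge_pow {v x t : ℕ} (hv : v < B.card) (hpos : 0 < P v)
    (hr : B.rule v = .pow x t) : B.OffEdge P v x := by
  have ok := B.ok v hv
  rw [hr] at ok
  have hl : B.len v = t * B.len x := by rw [B.len_eq hv, hr]
  have ok2 := ok.2
  have hx := B.len_pos (ok.1.trans hv)
  have h2 : 2 * B.len x ≤ B.len v := by
    rw [hl]; exact Nat.mul_le_mul_right _ (by omega)
  refine hP.offEdge hv hpos (by simp [hr, BinRule.mult]; omega) (by omega) fun hs => ?_
  have := lt_two_mul_of_log_eq hx hs.1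
  omega

theorem CountsFrom.pair_cases {v x y : ℕ} (hv : v < B.card) (hpos : 0 < P v)
    (hr : B.rule v = .pair x y) :
    (B.side P v = 0 ∧ B.OffEdge P v x ∧ B.OffEdge P v y) ∨
    (B.side P v = 1 ∧ B.CentralChild P v x ∧ B.OffEdge P v y) ∨
    (B.side P v = 2 ∧ B.CentralChild P v y ∧ B.OffEdge P v x) := by
  have ok := B.ok v hv
  rw [hr] at ok
  have hl : B.len v = B.len x + B.len y := by rw [B.len_eq hv, hr]
  have hx := B.len_pos (ok.1.trans hv)
  have hy := B.len_pos (ok.2.trans hv)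
  have hxy : ¬ (B.SameLevel P v x ∧ B.SameLevel P v y) := by
    rintro ⟨h1, h2⟩
    have := lt_two_mul_of_log_eq hx h1.1
    have := lt_two_mul_of_log_eq hy h2.1
    omega
  have ex := hP.offEdge (a := x) hv hpos (by simp [hr, BinRule.mult]) (by omega)
  have ey := hP.offEdge (a := y) hv hpos (by simp [hr, BinRule.mult]) (by omega)
  have hs : B.side P v = if B.SameLevel P v x then 1 else if B.SameLevel P v y then 2 else 0 := by
    unfold side; rw [hr]
  have hc : ∀ u, B.CentralChild P v u ↔
      0 < P v ∧ ((B.side P v = 1 ∧ u = x) ∨ (B.side P v = 2 ∧ u = y)) := fun u => by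
    unfold CentralChild; rw [hr]
  by_cases h1 : B.SameLevel P v x
  · rw [if_pos h1] at hs
    exact .inr (.inl ⟨hs, (hc x).2 ⟨hpos, .inl ⟨hs, rfl⟩⟩, ey fun h => hxy ⟨h1, h⟩⟩)
  · rw [if_neg h1] at hs
    by_cases h2 : B.SameLevel P v y
    · rw [if_pos h2] at hs
      exact .inr (.inr ⟨hs, (hc y).2 ⟨hpos, .inr ⟨hs, rfl⟩⟩, ex h1⟩)
    · rw [if_neg h2] at hs
      exact .inl ⟨hs, ex h1, ey h2⟩

end

end BinGram

/-!
Results of the analysis: the lengths `aL`, the sides `aSide` of the central children, and the numbers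
`aPP` of paths to the central parents.  The other names stand for a constant and for values that
belong to the current variable.
-/
notation "aL" => (6 : ℕ)
notation "aSide" => (7 : ℕ)
notation "aPP" => (8 : ℕ)
notation "rZero" => (11 : ℕ)
notation "rX" => (12 : ℕ)
notation "rY" => (13 : ℕ)
notation "rV" => (14 : ℕ)
notation "rL" => (15 : ℕ)
notation "rFlag" => (16 : ℕ)
notation "rS" => (17 : ℕ)
notation "rT" => (18 : ℕ)

namespace WordRAM

/-- The grammar `B` is in the memory, and the variables that the passes share are set. -/
structure Loaded {α : Type*} (code : α → ℕ) (b : ℕ) (B : BinGram α) (h : Store) : Prop where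
  stored : B.Stored code h.arr
  varB : h.var rB = b
  one : h.var rOne = 1
  two : h.var rTwo = 2
  varN : h.var rN = B.card

theorem Loaded.congr {α : Type*} {code : α → ℕ} {b : ℕ} {B : BinGram α} {h h' : Store}
    (hl : Loaded code b B h)
    (h1 : h'.arr aKind = h.arr aKind) (h2 : h'.arr aX = h.arr aX) (h3 : h'.arr aY = h.arr aY)
    (hv : h'.var rB = h.var rB ∧ h'.var rOne = h.var rOne ∧ h'.var rTwo = h.var rTwo ∧
      h'.var rN = h.var rN) : Loaded code b B h' where
  stored j hj := by rw [h1, h2, h3]; exact hl.stored j hj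
  varB := hv.1.trans hl.varB
  one := hv.2.1.trans hl.one
  two := hv.2.2.1.trans hl.two
  varN := hv.2.2.2.trans hl.varN

/-- Count the paths from the greatest variable to every variable, from the top down. -/
def countPaths : Cmd :=
  .asg rI ♯rN ;; .wr aP (♯rN - 1) 1 ;; .asg rZero 0 ;;
  .loop (.lt rZero rI) (
    .asg rI (♯rI - 1) ;; .asg rK (.rd aKind ♯rI) ;; .asg rX (.rd aX ♯rI) ;;
    .asg rY (.rd aY ♯rI) ;; .asg rV (.rd aP ♯rI) ;;
    .ite (.eq rK rOne)
      (.wr aP ♯rX (.rd aP ♯rX + ♯rV) ;; .wr aP ♯rY (.rd aP ♯rY + ♯rV))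
      (.ite (.eq rK rTwo)
        (.wr aP ♯rX (.rd aP ♯rX + ♯rY * ♯rV))
        (.asg rK 0)))

theorem runs_countPaths {α : Type*} {code : α → ℕ} {b w : ℕ} (hw : 64 * b + 64 < 2 ^ w)
    {B : BinGram α} {h : Store} (hl : Loaded code b B h) (h0 : ∀ i, h.arr aP i = 0)
    (hB : 0 < B.card) (hb : B.card < b) (hn : B.len (B.card - 1) < 2 ^ w) :
    Runs b w countPaths h fun t h' => t ≤ 100 * B.card + 20 ∧ Loaded code b B h' ∧
      B.CountsFrom 0 (h'.arr aP) ∧ h'.var rZero = 0 ∧ ∀ a, 6 ≤ a → h'.arr a = h.arr a := by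
  unfold countPaths
  apply Runs.of_wp hw
  simp [Cmd.wp, Expr.addrCost, hl.varN, hl.varB]
  refine ⟨by omega, ?_⟩
  refine (Runs.loop (fun (i : ℕ) h' => Loaded code b B h' ∧ B.CountsFrom i (h'.arr aP) ∧
    h'.var rZero = 0 ∧ (∀ a, 6 ≤ a → h'.arr a = h.arr a) ∧ h'.var rI = i ∧ i ≤ B.card)
    (fun i => 100 * i) (by simp) ?_ B.card _ ?_).mono ?_
  · rintro (_ | i) h' ⟨hl, hc, hz, ha, hi, hic⟩ ht
    · simp only [Test.inStore_lt] at ht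
      omega
    have hic : i < B.card := hic
    have hst := hl.stored i hic
    have hstep := hc.step B hic
    have ok := B.ok i hic
    have bound := fun v (hv : v < i) => (hstep.le_len B (hv.trans hic)).trans_lt hn
    have e0 : ∀ {h'' : Store}, h''.arr aP = (fun a => h'.arr aP a + (B.rule i).mult a * h'.arr aP i) →
        h''.arr aKind = h'.arr aKind → h''.arr aX = h'.arr aX → h''.arr aY = h'.arr aY →
        (∀ a, 6 ≤ a → h''.arr a = h'.arr a) →
        (h''.var rB = h'.var rB ∧ h''.var rOne = h'.var rOne ∧ h''.var rTwo = h'.var rTwo ∧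
          h''.var rN = h'.var rN) → h''.var rZero = 0 → h''.var rI = i →
        Loaded code b B h'' ∧ B.CountsFrom i (h''.arr aP) ∧ h''.var rZero = 0 ∧
          (∀ a, 6 ≤ a → h''.arr a = h.arr a) ∧ h''.var rI = i ∧ i ≤ B.card :=
      fun hP k1 k2 k3 h6 hv h8 h9 => ⟨hl.congr k1 k2 k3 hv, by rw [hP]; exact hstep, h8,
        fun a h => (h6 a h).trans (ha a h), h9, hic.le⟩
    refine Runs.intro hw fun Q hQ => ?_
    cases hr : B.rule i with
    | leaf a =>
      rw [hr] at hst
      simp only [hr, BinRule.mult, zero_mul, add_zero] at e0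
      simp [Cmd.wp, Expr.addrCost, hl.varB, hi, hst.1, hl.one, hl.two]
      refine ⟨by omega, hQ _ _ ⟨i, e0 ?_ ?_ ?_ ?_ ?_ ?_ ?_ ?_, by omega⟩⟩ <;> simp [hz]
    | pair x y =>
      rw [hr] at hst ok
      obtain ⟨k1, k2, k3⟩ := hst
      obtain ⟨hx, hy⟩ := ok
      simp only [hr] at e0 bound
      have bx := bound x hx
      have bY := bound y hy
      simp only [BinRule.mult, if_true] at bx bY e0
      have bx' : h'.arr aP x + h'.arr aP i < 2 ^ w := by split_ifs at bx <;> omega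
      have bY' : (if y = x then h'.arr aP x + h'.arr aP i else h'.arr aP y) + h'.arr aP i <
          2 ^ w := by
        by_cases hxy : y = x
        · rw [if_pos hxy]; rw [if_pos hxy.symm, hxy] at bY; omega
        · rw [if_neg hxy]; rw [if_neg (Ne.symm hxy)] at bY; omega
      simp [Cmd.wp, Expr.addrCost, hl.varB, hi, k1, k2, k3, hl.one, hl.two]
      refine ⟨by omega, ⟨by omega, bx'⟩, by omega, ⟨by omega, bY'⟩, by omega, hQ _ _ ⟨i,
        e0 ?_ ?_ ?_ ?_ ?_ ?_ ?_ ?_, by omega⟩⟩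
      · funext a
        simp only [Store.setArr_arr, Store.setVar_arr, true_and]
        by_cases h1 : a = y
        · subst h1
          by_cases h2 : a = x
          · subst h2; simp; ring
          · simp [h2, Ne.symm h2]
        · by_cases h2 : a = x
          · subst h2; simp [h1, Ne.symm h1]
          · simp [h1, h2, Ne.symm h1, Ne.symm h2]
      · funext a; simp
      · funext a; simp
      · funext a; simp
      · intro a h6; funext j; simp [show a ≠ 5 by omega]
      · simp
      · simpa using hz
      · simp
    | pow x t =>
      rw [hr] at hst ok
      obtain ⟨k1, k2, k3⟩ := hst
      obtain ⟨hx, -⟩ := ok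
      simp only [hr] at e0 bound
      have bx := bound x hx
      simp only [BinRule.mult, if_true] at bx e0
      simp [Cmd.wp, Expr.addrCost, hl.varB, hi, k1, k2, k3, hl.one, hl.two]
      refine ⟨by omega, ⟨by omega, by omega, bx⟩, by omega, hQ _ _ ⟨i,
        e0 ?_ ?_ ?_ ?_ ?_ ?_ ?_ ?_, by omega⟩⟩
      · funext a
        simp only [Store.setArr_arr, Store.setVar_arr, true_and]
        by_cases h2 : a = x
        · subst h2; simp
        · simp [h2, Ne.symm h2]
      · funext a; simp
      · funext a; simp
      · funext a; simp
      · intro a h6; funext j; simp [show a ≠ 5 by omega]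
      · simp
      · simpa using hz
      · simp
  · refine ⟨hl.congr ?_ ?_ ?_ ?_, ?_, ?_, ?_, ?_, ?_⟩
    · funext a; simp
    · funext a; simp
    · funext a; simp
    · simp
    · convert B.countsFrom_card hB using 1
      funext a
      simp [h0]
    · simp
    · intro a h6; funext j; simp [show a ≠ 5 by omega]
    · simp
    · exact le_rfl
  · rintro t h' ⟨i, ⟨hl, hc, hz, ha, hi, hic⟩, ht, hle⟩
    simp only [Test.inStore_lt] at ht
    obtain rfl : i = 0 := by omega
    exact ⟨by omega, hl, hc, hz, ha⟩

/-- Set `rFlag` if the edge from the variable `rI` to the variable in `r` is on a central path: two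
positive words have the same leading digit if and only if their exclusive disjunction is less than
their conjunction. -/
def testCentral (r : ℕ) : Cmd :=
  .asg rFlag 0 ;;
  .asg rT (.rd aL ♯r) ;; .asg rS (.op .bxor ♯rL ♯rT) ;; .asg rT (.op .band ♯rL ♯rT) ;;
  .ite (.lt rS rT)
    (.asg rT (.rd aP ♯r) ;; .asg rS (.op .bxor ♯rV ♯rT) ;; .asg rT (.op .band ♯rV ♯rT) ;;
     .ite (.lt rS rT) (.asg rFlag 1) (.asg rS 0))
    (.asg rS 0)

theorem wp_testCentral {α : Type*} {b w : ℕ}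
    {B : BinGram α} {P : ℕ → ℕ} {h : Store} {r v u : ℕ} (hr : r = rX ∨ r = rY) (hu : h.var r = u)
    (hub : u < b) (hB : h.var rB = b) (hL : h.var rL = B.len v) (hV : h.var rV = P v)
    (hLu : h.arr aL u = B.len u) (hPu : h.arr aP = P) (p1 : 0 < B.len v) (p2 : 0 < B.len u)
    (p3 : 0 < P v) (p4 : 0 < P u) {Q : ℕ → Store → Prop}
    (hQ : ∀ t h', t ≤ 40 → h'.arr = h.arr → h'.var rFlag = (if B.SameLevel P v u then 1 else 0) →
      (∀ x, x ≠ rFlag → x ≠ rS → x ≠ rT → h'.var x = h.var x) → Q t h') :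
    (testCentral r).wp b w Q h := by
  unfold testCentral
  have hr' : r < 64 ∧ r ≠ rFlag ∧ r ≠ rS ∧ r ≠ rT := by omega
  obtain ⟨a1, a2, a3, a4⟩ := hr'
  simp only [BinGram.SameLevel, BinGram.log_eq_log_iff_xor_lt_and p1 p2,
    BinGram.log_eq_log_iff_xor_lt_and p3 p4] at hQ
  simp [Cmd.wp, Expr.addrCost, hu, hub, hB, a1, a2, a3, a4, hLu, hL, hV, hPu]
  refine ⟨fun h1 => ⟨fun h2 => ?_, fun h2 => ?_⟩, fun h1 => ?_⟩
  · refine hQ _ _ (by norm_num) rfl (by simp [h1, h2]) fun x h3 h4 h5 => by simp [h3, h4, h5]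
  · refine hQ _ _ (by norm_num) rfl ?_ fun x h3 h4 h5 => by simp [h3, h4, h5]
    rw [if_neg (by omega)]; simp
  · refine hQ _ _ (by norm_num) rfl ?_ fun x h3 h4 h5 => by simp [h3, h4, h5]
    rw [if_neg (by omega)]; simp

/-- Compute the lengths of the derived strings, the central children and the numbers of paths to
the central parents, from the bottom up. -/
def centralEdges : Cmd :=
  .asg rI 0 ;;
  .loop (.lt rI rN) (
    .asg rV (.rd aP ♯rI) ;;
    .ite (.lt rZero rV)
      (.asg rK (.rd aKind ♯rI) ;; .asg rX (.rd aX ♯rI) ;; .asg rY (.rd aY ♯rI) ;;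
       .ite (.eq rK rOne)
        (.asg rL (.rd aL ♯rX + .rd aL ♯rY) ;; .wr aL ♯rI ♯rL ;;
         testCentral rX ;;
         .ite (.eq rFlag rOne)
          (.wr aSide ♯rI 1 ;; .wr aPP ♯rX (.rd aPP ♯rX + ♯rV))
          (testCentral rY ;;
           .ite (.eq rFlag rOne)
            (.wr aSide ♯rI 2 ;; .wr aPP ♯rY (.rd aPP ♯rY + ♯rV))
            (.asg rS 0)))
        (.ite (.eq rK rTwo) (.wr aL ♯rI (♯rY * .rd aL ♯rX)) (.wr aL ♯rI 1)))
      (.asg rS 0) ;;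
    .asg rI (♯rI + 1))

/-- The memory contains the analysis of the variables below `i`. -/
structure Analyzed {α : Type*} (code : α → ℕ) (b : ℕ) (B : BinGram α) (P : ℕ → ℕ) (i : ℕ)
    (h : Store) : Prop where
  loaded : Loaded code b B h
  paths : h.arr aP = P
  zero : h.var rZero = 0
  len : ∀ v < i, 0 < P v → h.arr aL v = B.len v
  side : ∀ v < i, 0 < P v → h.arr aSide v = B.side P v
  centralIn : ∀ u, h.arr aPP u = B.centralIn P i u

theorem runs_centralEdges {α : Type*} {code : α → ℕ} {b w : ℕ} (hw : 64 * b + 64 < 2 ^ w)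
    {B : BinGram α} {h : Store} (hl : Loaded code b B h) {P : ℕ → ℕ} (hP : h.arr aP = P)
    (hc : B.CountsFrom 0 P) (h0 : ∀ i, h.arr aSide i = 0) (h0' : ∀ i, h.arr aPP i = 0)
    (hz : h.var rZero = 0) (hb : B.card < b) (hn : B.len (B.card - 1) < 2 ^ w) :
    Runs b w centralEdges h fun t h' => t ≤ 200 * B.card + 20 ∧
      Analyzed code b B P B.card h' := by
  unfold centralEdges
  apply Runs.of_wp hw
  simp [Cmd.wp]
  refine (Runs.loop (fun (i : ℕ) h' => Analyzed code b B P i h' ∧ h'.var rI = i ∧ i ≤ B.card ∧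
    ∀ v, i ≤ v → h'.arr aSide v = 0)
    (fun i => 200 * (B.card - i)) (by simp) ?_ 0 _ ?_).mono ?_
  · rintro i h' ⟨hA, hi, hic, hs⟩ ht
    simp only [Test.inStore_lt, hA.loaded.varN, hi] at ht
    have hl := hA.loaded
    have hst := hl.stored i ht
    have ok := B.ok i ht
    have hlen := B.len_eq ht
    have hPi := hA.paths
    have hz := hA.zero
    have hCI : ∀ u, B.centralIn P (i + 1) u =
        B.centralIn P i u + if B.CentralChild P i u then P i else 0 := fun u => sum_range_succ _ _
    have hCI' : ∀ u, u < B.card → B.CentralChild P i u → B.centralIn P i u + P i < 2 ^ w := by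
      intro u hu hcc
      have h1 := hCI u
      rw [if_pos hcc] at h1
      have h2 : B.centralIn P (i + 1) u ≤ B.centralIn P B.card u :=
        sum_le_sum_of_subset (range_subset_range.2 ht)
      have h3 := hc.centralIn_le hu
      have h4 := hc.le_len B hu
      omega
    have hch : ∀ u, u < B.card → 0 < P i → 0 < (B.rule i).mult u → 0 < P u := fun u hu h1 h2 =>
      (Nat.mul_pos h2 h1).trans_le (hc.mult_mul_le hu ht)
    have hlen_lt : 0 < P i → B.len i < 2 ^ w := fun h1 =>
      ((Nat.le_mul_of_pos_left _ h1).trans (hc.mul_len_le B ht)).trans_lt hn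
    have fin : ∀ {h'' : Store} {t : ℕ}, t ≤ 190 → h''.arr aKind = h'.arr aKind →
        h''.arr aX = h'.arr aX → h''.arr aY = h'.arr aY →
        (h''.var rB = h'.var rB ∧ h''.var rOne = h'.var rOne ∧ h''.var rTwo = h'.var rTwo ∧
          h''.var rN = h'.var rN) → h''.arr aP = h'.arr aP → h''.var rZero = h'.var rZero →
        h''.var rI = i + 1 →
        (∀ v, v ≠ i → h''.arr aL v = h'.arr aL v ∧ h''.arr aSide v = h'.arr aSide v) →
        (0 < P i → h''.arr aL i = B.len i ∧ h''.arr aSide i = B.side P i) →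
        (∀ u, h''.arr aPP u = h'.arr aPP u + if B.CentralChild P i u then P i else 0) →
        ∃ j, (Analyzed code b B P j h'' ∧ h''.var rI = j ∧ j ≤ B.card ∧
          ∀ v, j ≤ v → h''.arr aSide v = 0) ∧ t + 1 + 200 * (B.card - j) ≤ 200 * (B.card - i) := by
      intro h'' t e0 e1 e2 e3 e4 e5 e6 e7 e8 e9 e10
      refine ⟨i + 1, ⟨⟨hl.congr e1 e2 e3 e4, e5.trans hPi, e6.trans hz, fun v hv hpv => ?_,
        fun v hv hpv => ?_, fun u => ?_⟩, e7, ht, fun v hv => ?_⟩, by omega⟩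
      · rcases Nat.lt_succ_iff_lt_or_eq.1 hv with h1 | rfl
        · rw [(e8 v h1.ne).1, hA.len v h1 hpv]
        · exact (e9 hpv).1
      · rcases Nat.lt_succ_iff_lt_or_eq.1 hv with h1 | rfl
        · rw [(e8 v h1.ne).2, hA.side v h1 hpv]
        · exact (e9 hpv).2
      · rw [e10, hA.centralIn, hCI]
      · rw [(e8 v (by omega)).2, hs v (by omega)]
    refine Runs.intro hw fun Q hQ => ?_
    have fin' := fun {h'' : Store} {t : ℕ} a1 a2 a3 a4 a5 a6 a7 a8 a9 a10 a11 =>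
      hQ t h'' (fin (h'' := h'') (t := t) a1 a2 a3 a4 a5 a6 a7 a8 a9 a10 a11)
    simp only [Cmd.wp]
    simp [Expr.addrCost, hl.varB, hi, hPi, hz]
    refine ⟨by omega, fun hpos => ?_, fun hpos => ?_⟩
    · refine ⟨by omega, ?_⟩
      cases hr : B.rule i with
      | leaf a =>
        rw [hr] at hst hlen
        have hsd : B.side P i = 0 := by simp [BinGram.side, hr]
        have hcc : ∀ u, ¬ B.CentralChild P i u := fun u => by simp [BinGram.CentralChild, hr]
        simp [hst.1, hl.one, hl.two]
        refine ⟨by omega, by omega, ?_⟩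
        refine fin' (by norm_num) ?_ ?_ ?_ ?_ ?_ ?_ ?_ ?_ ?_ ?_
        · funext a; simp
        · funext a; simp
        · funext a; simp
        · simp
        · funext a; simp
        · simp
        · simp
        · intro v hv; simp [hv]
        · intro _; simp [hlen, hsd, hs]
        · intro u; simp [hcc]
      | pow x t =>
        rw [hr] at hst hlen ok
        obtain ⟨k1, k2, k3⟩ := hst
        have hx := hA.len x ok.1 (hch x (ok.1.trans ht) hpos (by
          have := ok.2
          simp [hr, BinRule.mult]; omega))
        dsimp only at hlen
        have hlen_lt := hlen_lt hpos
        have hsd : B.side P i = 0 := by simp [BinGram.side, hr]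
        have hcc : ∀ u, ¬ B.CentralChild P i u := fun u => by simp [BinGram.CentralChild, hr]
        simp [k1, k2, k3, hl.one, hl.two, hx, ← hlen]
        have := ok.1
        repeat refine And.intro (by omega) ?_
        refine fin' (by norm_num) ?_ ?_ ?_ ?_ ?_ ?_ ?_ ?_ ?_ ?_
        · funext a; simp
        · funext a; simp
        · funext a; simp
        · simp
        · funext a; simp
        · simp
        · simp
        · intro v hv; simp [hv]
        · intro _; simp [hsd, hs]
        · intro u; simp [hcc]
      | pair x y =>
        rw [hr] at hst hlen ok
        obtain ⟨k1, k2, k3⟩ := hst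
        obtain ⟨ox, oy⟩ := ok
        dsimp only at hlen
        have px := hch x (ox.trans ht) hpos (by simp [hr, BinRule.mult])
        have py := hch y (oy.trans ht) hpos (by simp [hr, BinRule.mult])
        have lx := hA.len x ox px
        have ly := hA.len y oy py
        have hlen_lt := hlen_lt hpos
        have hsd : B.side P i = if B.SameLevel P i x then 1 else if B.SameLevel P i y then 2 else 0 :=
          by simp [BinGram.side, hr]
        have hcc : ∀ u, B.CentralChild P i u ↔
            (B.side P i = 1 ∧ u = x) ∨ (B.side P i = 2 ∧ u = y) := fun u => by
          simp [BinGram.CentralChild, hr, hpos]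
        have p0 := B.len_pos ht
        have px' := B.len_pos (ox.trans ht)
        have py' := B.len_pos (oy.trans ht)
        simp [k1, k2, k3, hl.one, lx, ly, ← hlen]
        refine ⟨⟨by omega, by omega, by omega⟩, by omega, ?_⟩
        refine wp_testCentral (B := B) (P := P) (v := i) (u := x) (.inl rfl) (by simp) (by omega)
          (by simpa using hl.varB) (by simp) (by simp) (by simp; rw [if_neg ox.ne, lx])
          (by funext a; simp [hPi]) p0 px' hpos px ?_
        intro t₁ h₁ ht₁ ha₁ hf₁ hv₁
        simp [hf₁, hv₁, ha₁, hi, hl.one, hl.varB, hA.centralIn]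
        refine ⟨fun hsx => ?_, fun hsx => ?_⟩
        · rw [if_pos hsx] at hsd
          have hcx : B.CentralChild P i x := (hcc x).2 (.inl ⟨hsd, rfl⟩)
          have := hCI' x (by omega) hcx
          repeat refine And.intro (by omega) ?_
          refine fin' (by omega) ?_ ?_ ?_ ?_ ?_ ?_ ?_ ?_ ?_ ?_
          · funext a; simp [ha₁]
          · funext a; simp [ha₁]
          · funext a; simp [ha₁]
          · simp [hv₁]
          · funext a; simp [ha₁]
          · simp [hv₁]
          · simp
          · intro v hv; simp [hv, ha₁]
          · intro _; simp [hsd, ha₁]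
          · intro u
            have : B.CentralChild P i u ↔ u = x := by rw [hcc, hsd]; simp
            by_cases hu : u = x <;> simp [this, hu, hcx, ha₁, hA.centralIn]
        · rw [if_neg hsx] at hsd
          refine wp_testCentral (B := B) (P := P) (v := i) (u := y) (.inr rfl) (by simp [hv₁])
            (by omega) (by simpa [hv₁] using hl.varB) (by simp [hv₁]) (by simp [hv₁])
            (by simp [ha₁]; rw [if_neg oy.ne, ly]) (by funext a; simp [ha₁, hPi]) p0 py' hpos py ?_
          intro t₂ h₂ ht₂ ha₂ hf₂ hv₂
          simp [hf₂, hv₂, ha₂, hv₁, ha₁, hi, hl.one, hl.varB, hA.centralIn]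
          refine ⟨fun hsy => ?_, fun hsy => ?_⟩
          · rw [if_pos hsy] at hsd
            have hcy : B.CentralChild P i y := (hcc y).2 (.inr ⟨hsd, rfl⟩)
            have := hCI' y (by omega) hcy
            repeat refine And.intro (by omega) ?_
            refine fin' (by omega) ?_ ?_ ?_ ?_ ?_ ?_ ?_ ?_ ?_ ?_
            · funext a; simp [ha₂, ha₁]
            · funext a; simp [ha₂, ha₁]
            · funext a; simp [ha₂, ha₁]
            · simp [hv₂, hv₁]
            · funext a; simp [ha₂, ha₁]
            · simp [hv₂, hv₁]
            · simp
            · intro v hv; simp [hv, ha₂, ha₁]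
            · intro _; simp [hsd, ha₂, ha₁]
            · intro u
              have : B.CentralChild P i u ↔ u = y := by rw [hcc, hsd]; simp
              by_cases hu : u = y <;> simp [this, hu, hcy, ha₂, ha₁, hA.centralIn]
          · rw [if_neg hsy] at hsd
            repeat refine And.intro (by omega) ?_
            refine fin' (by omega) ?_ ?_ ?_ ?_ ?_ ?_ ?_ ?_ ?_ ?_
            · funext a; simp [ha₂, ha₁]
            · funext a; simp [ha₂, ha₁]
            · funext a; simp [ha₂, ha₁]
            · simp [hv₂, hv₁]
            · funext a; simp [ha₂, ha₁]
            · simp [hv₂, hv₁]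
            · simp
            · intro v hv; simp [hv, ha₂, ha₁]
            · intro _; simp [hsd, ha₂, ha₁, hs]
            · intro u
              have : ¬ B.CentralChild P i u := by rw [hcc, hsd]; simp
              simp [this, ha₂, ha₁]
    · refine ⟨by omega, ?_⟩
      refine fin' (by norm_num) rfl rfl rfl (by simp) rfl (by simp) (by simp) (by simp) ?_ ?_
      · intro h1; omega
      · intro u
        have : ¬ B.CentralChild P i u := fun h => by have := h.1; omega
        simp [this]
  · refine ⟨⟨hl.congr rfl rfl rfl (by simp), hP, by simpa using hz, by simp, by simp, ?_⟩, by simp,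
      by simp, fun v _ => h0 v⟩
    intro u
    simp [BinGram.centralIn, h0']
  · rintro t h' ⟨i, ⟨hA, hi, hic, hs⟩, ht, hle⟩
    simp only [Test.inStore_lt, hA.loaded.varN, hi] at ht
    obtain rfl : i = B.card := by omega
    exact ⟨by omega, hA⟩

end WordRAM

/-! ### Emitting the output grammar -/

/-!
Results of the balancing pass for the variables of the binarized grammar: `aSym` is an equivalent
variable of the output grammar (plus one), and the other arrays are explained at `BinGram.Built`.
The output `aOut` starts with the number of rules; `rOp` is the writing position and `rCnt` counts
the rules.  `rU` and `rA` are the central and the other child of the current variable, `rG` is the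
current variable of a chain, and `rWl`, `rWr` collect what surrounds its string.
-/
notation "aSym" => (9 : ℕ)
notation "aZl" => (10 : ℕ)
notation "aZr" => (11 : ℕ)
notation "aNext" => (12 : ℕ)
notation "aBeta" => (13 : ℕ)
notation "aKey" => (14 : ℕ)
notation "aML" => (15 : ℕ)
notation "aMP" => (16 : ℕ)
notation "aOut" => (17 : ℕ)
notation "rOp" => (20 : ℕ)
notation "rCnt" => (21 : ℕ)
notation "rU" => (22 : ℕ)
notation "rA" => (23 : ℕ)
notation "rML" => (24 : ℕ)
notation "rMP" => (25 : ℕ)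
notation "rKey" => (26 : ℕ)
notation "rWl" => (27 : ℕ)
notation "rWr" => (28 : ℕ)
notation "rG" => (29 : ℕ)

namespace BinGram

variable {α : Type*}

/-- The string of an optional variable: `0` stands for the empty string and `x + 1` for the
variable `x`. -/
def sym (O : BinGram α) (x : ℕ) : List α := if x = 0 then [] else O.str (x - 1)

@[simp] theorem sym_zero (O : BinGram α) : O.sym 0 = [] := rfl

theorem sym_of_pos (O : BinGram α) {x : ℕ} (hx : 0 < x) : O.sym x = O.str (x - 1) := by
  rw [sym, if_neg hx.ne']

theorem Extends.sym_eq {O O' : BinGram α} (h : O.Extends O') {x : ℕ} (hx : x ≤ O.card) :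
    O'.sym x = O.sym x := by
  rcases Nat.eq_zero_or_pos x with rfl | h0
  · rfl
  · rw [sym_of_pos _ h0, sym_of_pos _ h0, h.str_eq _ (by omega)]

/-- `O'` extends `O` by at most one variable such that the optional variable `z` of `O'` derives the
concatenation of the strings of `x` and `y`. -/
structure Concat (O : BinGram α) (x y : ℕ) (O' : BinGram α) (z : ℕ) : Prop where
  ext : O.Extends O'
  card_le : O'.card ≤ O.card + 1
  le : z ≤ O'.card
  sym_eq : O'.sym z = O.sym x ++ O.sym y
  dep_le : ∀ K, (x ≠ 0 → O.dep (x - 1) + 1 ≤ K) → (y ≠ 0 → O.dep (y - 1) + 1 ≤ K) →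
    z ≠ 0 → O'.dep (z - 1) ≤ K
  ne_zero : x ≠ 0 ∨ y ≠ 0 → z ≠ 0
  eq_card : x ≠ 0 → y ≠ 0 → z = O'.card
  eq_left : y = 0 → z = x ∧ O' = O

theorem concat_zero_left (O : BinGram α) {y : ℕ} (hy : y ≤ O.card) : O.Concat 0 y O y where
  ext := .refl O
  card_le := Nat.le_succ _
  le := hy
  sym_eq := rfl
  dep_le K _ h2 hz := by have := h2 hz; omega
  ne_zero h := by simpa using h
  eq_card h := absurd rfl h
  eq_left h := ⟨h, rfl⟩

theorem concat_zero_right (O : BinGram α) {x : ℕ} (hx : x ≤ O.card) : O.Concat x 0 O x where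
  ext := .refl O
  card_le := Nat.le_succ _
  le := hx
  sym_eq := by simp
  dep_le K h1 _ hz := by have := h1 hz; omega
  ne_zero h := by simpa using h
  eq_card _ h := absurd rfl h
  eq_left _ := ⟨rfl, rfl⟩

theorem concat_push (O : BinGram α) {x y : ℕ} (hx : 0 < x) (hy : 0 < y)
    (hr : (BinRule.pair (x - 1) (y - 1) : BinRule α).Ok O.card) :
    O.Concat x y (O.push _ hr) (O.card + 1) where
  ext := O.extends_push hr
  card_le := le_rfl
  le := le_rfl
  sym_eq := by
    rw [sym_of_pos _ (Nat.succ_pos _), sym_of_pos _ hx, sym_of_pos _ hy, Nat.succ_sub_one,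
      push_str_card]
    rfl
  dep_le K h1 h2 _ := by
    have := h1 hx.ne'
    have := h2 hy.ne'
    rw [Nat.add_sub_cancel, push_dep_card]
    simp only [BinRule.dep]
    omega
  ne_zero _ := Nat.succ_ne_zero _
  eq_card _ _ := rfl
  eq_left h := by omega

end BinGram

namespace WordRAM

/-- The rules of `O` have been written to the output array, after a cell for their number. -/
structure Emitted {α : Type*} (code : α → ℕ) (O : BinGram α) (h : Store) : Prop where
  out : At (h.arr aOut) 1 (O.rules.flatMap (RLRule.encode code))
  varOp : h.var rOp = 1 + (O.rules.flatMap (RLRule.encode code)).length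
  varCnt : h.var rCnt = O.card

theorem length_flatMap_rules_le {α : Type*} (code : α → ℕ) (O : BinGram α) :
    (O.rules.flatMap (RLRule.encode code)).length ≤ 4 * O.card := by
  have := (RLSLP.length_rules_le_size O.rules (fun r hr => by
    rcases Nat.eq_zero_or_pos O.card with h | h
    · simp [BinGram.rules, h] at hr
    · exact (O.toRLSLP h).admissible r hr) code).2.2
  rcases Nat.eq_zero_or_pos O.card with h | h
  · simp [BinGram.rules, h]
  · have h2 := O.size_toRLSLP_le h
    have h3 : (O.toRLSLP h).size = (O.rules.map RLRule.size).sum := rfl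
    omega

theorem Emitted.varOp_le {α : Type*} {code : α → ℕ} {O : BinGram α} {h : Store}
    (he : Emitted code O h) : h.var rOp ≤ 1 + 4 * O.card := by
  have := length_flatMap_rules_le code O
  have := he.varOp
  omega

theorem Emitted.push {α : Type*} {code : α → ℕ} {O : BinGram α} {h h' : Store}
    (he : Emitted code O h) {r : BinRule α} (hr : r.Ok O.card)
    (h1 : ∀ i < h.var rOp, h'.arr aOut i = h.arr aOut i)
    (h2 : At (h'.arr aOut) (h.var rOp) (r.toRule.encode code))
    (h3 : h'.var rOp = h.var rOp + (r.toRule.encode code).length)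
    (h4 : h'.var rCnt = h.var rCnt + 1) : Emitted code (O.push r hr) h' := by
  have e1 := he.varOp
  refine ⟨?_, ?_, ?_⟩
  · rw [O.rules_push hr, List.flatMap_append, At.append_iff, List.flatMap_singleton, ← e1]
    exact ⟨he.out.congr fun i hi => h1 i (by omega), h2⟩
  · rw [O.rules_push hr, List.flatMap_append, List.flatMap_singleton, List.length_append, h3, e1]
    omega
  · rw [h4, he.varCnt]; rfl

theorem Emitted.congr {α : Type*} {code : α → ℕ} {O : BinGram α} {h h' : Store}
    (he : Emitted code O h) (h1 : h'.arr aOut = h.arr aOut) (h2 : h'.var rOp = h.var rOp)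
    (h3 : h'.var rCnt = h.var rCnt) : Emitted code O h' :=
  ⟨by rw [h1]; exact he.out, h2.trans he.varOp, h3.trans he.varCnt⟩

/-- Concatenate the optional variables in `x` and `y`, with a new rule if both are nonempty. -/
def cat (d x y : ℕ) : Cmd :=
  .ite (.eq x rZero) (.asg d ♯y)
    (.ite (.eq y rZero) (.asg d ♯x)
      (.wr aOut ♯rOp 1 ;; .wr aOut (♯rOp + 1) 2 ;; .wr aOut (♯rOp + 2) (♯x - 1) ;;
       .wr aOut (♯rOp + 3) (♯y - 1) ;; .asg rOp (♯rOp + 4) ;; .asg rCnt (♯rCnt + 1) ;;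
       .asg d ♯rCnt))

theorem wp_cat {α : Type*} {code : α → ℕ} {b w : ℕ} (hw : 64 * b + 64 < 2 ^ w) {O : BinGram α}
    {h : Store} (he : Emitted code O h) (hB : h.var rB = b) (hz : h.var rZero = 0)
    (hcard : O.card ≤ 5 * b) (hb : 0 < b) {d x y : ℕ} (hx : h.var x ≤ O.card)
    (hy : h.var y ≤ O.card)
    (hreg : x < 64 ∧ y < 64 ∧ d ≠ rOp ∧ d ≠ rCnt)
    {Q : ℕ → Store → Prop}
    (hQ : ∀ t h' O', t ≤ 60 → O.Concat (h.var x) (h.var y) O' (h'.var d) → Emitted code O' h' →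
      (∀ a, a ≠ aOut → h'.arr a = h.arr a) →
      (∀ r, r ≠ d → r ≠ rOp → r ≠ rCnt → h'.var r = h.var r) → Q t h') :
    (cat d x y).wp b w Q h := by
  obtain ⟨x1, y1, d2, d3⟩ := hreg
  have hop := he.varOp_le
  have hcnt := he.varCnt
  unfold cat
  simp [Cmd.wp, Expr.addrCost, hB, hz, x1, y1]
  refine ⟨fun h1 => ?_, fun h1 => ⟨fun h2 => ?_, fun h2 => ?_⟩⟩
  · refine hQ _ _ O (by norm_num) ?_ (he.congr rfl ?_ ?_) (fun _ _ => rfl) (fun r hr _ _ => ?_)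
    · simpa [h1] using O.concat_zero_left hy
    · simp [d2.symm]
    · simp [d3.symm]
    · simp [hr]
  · refine hQ _ _ O (by norm_num) ?_ (he.congr rfl ?_ ?_) (fun _ _ => rfl) (fun r hr _ _ => ?_)
    · simpa [h2] using O.concat_zero_right hx
    · simp [d2.symm]
    · simp [d3.symm]
    · simp [hr]
  · have hr : (BinRule.pair (h.var x - 1) (h.var y - 1) : BinRule α).Ok O.card :=
      ⟨by omega, by omega⟩
    repeat refine And.intro (by omega) ?_
    refine hQ _ _ (O.push _ hr) (by norm_num) ?_ (he.push hr ?_ ?_ ?_ ?_) ?_ ?_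
    · simpa [hcnt] using O.concat_push (Nat.pos_of_ne_zero h1) (Nat.pos_of_ne_zero h2) hr
    · intro i hi
      simp [show i ≠ h.var rOp by omega, show i ≠ h.var rOp + 1 by omega,
        show i ≠ h.var rOp + 2 by omega, show i ≠ h.var rOp + 3 by omega]
    · simp [BinRule.toRule, RLRule.encode, add_assoc]
    · simp [BinRule.toRule, RLRule.encode, d2.symm]
    · simp [d3.symm]
    · intro a ha; funext j; simp [ha]
    · intro r h1 h2 h3; simp [h1, h2, h3]

end WordRAM

/-! ### The invariant of the balancing pass -/

namespace BinGram

variable {α : Type*}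

/-- What the arrays `f` and the output grammar `O` hold for a variable `v` of `B` when it has been
processed; `F` is the logarithm of the length of the string, and `ℓ v` the length of the chain
`v, next v, next (next v), …`.  A variable is a core if it has no central child.

* `aSym` is a variable of `O` that derives the string of `v` (plus one);
* `aML`, `aMP` are `len` and `P` of the core of the path of `v`: they have the same logarithms as
  those of `v`, but the same values on the whole path, which makes positions comparable;
* `aBeta` is the position of `v` on its path, `0` for the core;
* `aKey` is the exclusive disjunction of the positions of `v` and of its central child, and a number
  with a greater logarithm than all of these for a core;
* `aNext` is the successor of `v`, the first variable on the way to the core whose key has a greater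
  logarithm, and `aZl`, `aZr` are optional variables of `O` for what surrounds its string in that
  of `v`.

In `le_log_key`, the difference counts the paths that do not enter `v` by a central edge; if there
are none, no noncentral edge into `v` has to be paid for. -/
structure Built (B : BinGram α) (P : ℕ → ℕ) (F : ℕ) (ℓ : ℕ → ℕ) (O : BinGram α)
    (f : ℕ → ℕ → ℕ) (v : ℕ) : Prop where
  sym_pos : 0 < f aSym v
  sym_le : f aSym v ≤ O.card
  str_eq : O.sym (f aSym v) = B.str v
  ml_pos : 0 < f aML v
  mp_pos : 0 < f aMP v
  log_ml : Nat.log 2 (f aML v) = Nat.log 2 (B.len v)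
  log_mp : Nat.log 2 (f aMP v) = Nat.log 2 (P v)
  ml_mul_mp : f aML v * f aMP v ≤ B.len (B.card - 1)
  beta_le : f aBeta v + B.centralIn P B.card v * f aML v ≤ B.len v * f aMP v
  key_pos : 0 < f aKey v
  le_log_key : 0 < P v - B.centralIn P B.card v →
    Nat.log 2 (B.len v) + Nat.log 2 (P v - B.centralIn P B.card v) ≤ Nat.log 2 (f aKey v)
  dep_le : O.dep (f aSym v - 1) + 2 * Nat.log 2 (f aKey v) ≤
    20 * Nat.log 2 (B.len v) + 17 * (F - Nat.log 2 (P v)) + 2 * Nat.log 2 (P v) + 7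
  core : B.side P v = 0 → f aKey v = 4 * (f aML v * f aMP v) ∧ f aBeta v = 0 ∧ ℓ v = 0
  key_lt : B.side P v ≠ 0 → Nat.log 2 (f aKey v) < Nat.log 2 (4 * (f aML v * f aMP v))
  digit : B.side P v ≠ 0 → f aBeta v / 2 ^ Nat.log 2 (f aKey v) % 2 = 1
  next_lt : B.side P v ≠ 0 → f aNext v < v
  next_pos : B.side P v ≠ 0 → 0 < P (f aNext v)
  next_ml : B.side P v ≠ 0 → f aML (f aNext v) = f aML v
  next_mp : B.side P v ≠ 0 → f aMP (f aNext v) = f aMP v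
  next_key : B.side P v ≠ 0 → Nat.log 2 (f aKey v) < Nat.log 2 (f aKey (f aNext v))
  next_beta : B.side P v ≠ 0 → f aBeta v / 2 ^ (Nat.log 2 (f aKey v) + 1) =
    f aBeta (f aNext v) / 2 ^ (Nat.log 2 (f aKey v) + 1)
  next_len : B.side P v ≠ 0 → ℓ v = ℓ (f aNext v) + 1
  zl_le : B.side P v ≠ 0 → f aZl v ≤ O.card
  zr_le : B.side P v ≠ 0 → f aZr v ≤ O.card
  z_str : B.side P v ≠ 0 → O.sym (f aZl v) ++ B.str (f aNext v) ++ O.sym (f aZr v) = B.str v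
  zl_dep : B.side P v ≠ 0 → f aZl v ≠ 0 → O.dep (f aZl v - 1) + 3 * Nat.log 2 (P v) + 7 ≤
    15 * Nat.log 2 (B.len v) + 17 * (F - Nat.log 2 (P v)) + 3 * Nat.log 2 (f aKey v)
  zr_dep : B.side P v ≠ 0 → f aZr v ≠ 0 → O.dep (f aZr v - 1) + 3 * Nat.log 2 (P v) + 7 ≤
    15 * Nat.log 2 (B.len v) + 17 * (F - Nat.log 2 (P v)) + 3 * Nat.log 2 (f aKey v)

variable {B : BinGram α} {P : ℕ → ℕ} {F : ℕ} {ℓ ℓ' : ℕ → ℕ} {O O' : BinGram α}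
  {f f' : ℕ → ℕ → ℕ} {v : ℕ}

theorem Built.congr (h : B.Built P F ℓ O f v) (hO : O.Extends O')
    (hf : ∀ u ≤ v, ∀ a, 9 ≤ a → a ≤ 16 → f' a u = f a u) (hℓ : ∀ u ≤ v, ℓ' u = ℓ u) :
    B.Built P F ℓ' O' f' v := by
  have e := hf v le_rfl
  have e1 : B.side P v ≠ 0 → ∀ a, 9 ≤ a → a ≤ 16 → f' a (f aNext v) = f a (f aNext v) :=
    fun hs => hf _ (h.next_lt hs).le
  have hc := hO.card_le
  refine ⟨?_, ?_, ?_, ?_, ?_, ?_, ?_, ?_, ?_, ?_, ?_, ?_, ?_, ?_, ?_, ?_, ?_, ?_, ?_, ?_, ?_, ?_, ?_,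
    ?_, ?_, ?_, ?_⟩
  all_goals
    try rw [e 9 (by norm_num) (by norm_num)]
    try rw [e 10 (by norm_num) (by norm_num)]
    try rw [e 11 (by norm_num) (by norm_num)]
    try rw [e 12 (by norm_num) (by norm_num)]
    try rw [e 13 (by norm_num) (by norm_num)]
    try rw [e 14 (by norm_num) (by norm_num)]
    try rw [e 15 (by norm_num) (by norm_num)]
    try rw [e 16 (by norm_num) (by norm_num)]
  · exact h.sym_pos
  · exact h.sym_le.trans hc
  · rw [hO.sym_eq h.sym_le]; exact h.str_eq
  · exact h.ml_pos
  · exact h.mp_pos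
  · exact h.log_ml
  · exact h.log_mp
  · exact h.ml_mul_mp
  · exact h.beta_le
  · exact h.key_pos
  · exact h.le_log_key
  · rw [hO.dep_eq _ (by have := h.sym_pos; have := h.sym_le; omega)]; exact h.dep_le
  · rw [hℓ v le_rfl]; exact h.core
  · exact h.key_lt
  · exact h.digit
  · exact h.next_lt
  · exact h.next_pos
  · intro hs; rw [e1 hs _ (by norm_num) (by norm_num)]; exact h.next_ml hs
  · intro hs; rw [e1 hs _ (by norm_num) (by norm_num)]; exact h.next_mp hs
  · intro hs; rw [e1 hs _ (by norm_num) (by norm_num)]; exact h.next_key hs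
  · intro hs; rw [e1 hs _ (by norm_num) (by norm_num)]; exact h.next_beta hs
  · intro hs; rw [hℓ v le_rfl, hℓ _ (h.next_lt hs).le]; exact h.next_len hs
  · exact fun hs => (h.zl_le hs).trans hc
  · exact fun hs => (h.zr_le hs).trans hc
  · intro hs; rw [hO.sym_eq (h.zl_le hs), hO.sym_eq (h.zr_le hs)]; exact h.z_str hs
  · intro hs h0
    rw [hO.dep_eq _ (by have := h.zl_le hs; omega)]; exact h.zl_dep hs h0
  · intro hs h0
    rw [hO.dep_eq _ (by have := h.zr_le hs; omega)]; exact h.zr_dep hs h0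

/-- The parse tree below an edge that does not lie on a central path is shallow, in terms of the
levels of the upper end of the edge.  The term `15` is the gain over the bound for that end: at such
an edge one of the levels changes by at least one. -/
theorem Built.dep_le_of_offEdge {a : ℕ} (h : B.Built P F ℓ O f a) (hoff : B.OffEdge P v a)
    (hv : 0 < P v) (hF : Nat.log 2 (P a) ≤ F) :
    O.dep (f aSym a - 1) + 15 ≤ 3 * Nat.log 2 (B.len a) + 15 * Nat.log 2 (B.len v) +
      17 * (F - Nat.log 2 (P v)) + 7 := by
  have h1 := h.dep_le
  have h2 := h.le_log_key (by have := hoff.add_le; omega)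
  have h3 := hoff.log_len_le
  have h4 := hoff.log_le
  have h5 := hoff.ne
  have h6 : Nat.log 2 (P v) ≤ Nat.log 2 (P a - B.centralIn P B.card a) :=
    Nat.log_mono_right (by have := hoff.add_le; omega)
  omega

theorem log_four_mul {x : ℕ} (hx : 0 < x) : Nat.log 2 (4 * x) = Nat.log 2 x + 2 := by
  rw [show 4 * x = x * 2 * 2 by ring, Nat.log_mul_base (by norm_num) (by omega),
    Nat.log_mul_base (by norm_num) (by omega)]

theorem log_core_key {x y : ℕ} (hx : 0 < x) (hy : 0 < y) :
    Nat.log 2 x + Nat.log 2 y + 2 ≤ Nat.log 2 (4 * (x * y)) ∧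
    Nat.log 2 (4 * (x * y)) ≤ Nat.log 2 x + Nat.log 2 y + 3 := by
  rw [log_four_mul (Nat.mul_pos hx hy)]
  have := log_add_log_le hx hy
  have := log_mul_lt hx hy
  omega

/-- A core is processed by copying its rule. -/
theorem built_core (hc : B.CountsFrom 0 P) (hv : v < B.card) (hpos : 0 < P v)
    (hs : B.side P v = 0) (hsym : f aSym v = O.card) (hO : 0 < O.card)
    (hstr : O.str (O.card - 1) = B.str v) (hml : f aML v = B.len v) (hmp : f aMP v = P v)
    (hb : f aBeta v = 0) (hk : f aKey v = 4 * (B.len v * P v)) (hℓ : ℓ v = 0)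
    (hdep : O.dep (O.card - 1) ≤ 1 ∧ B.len v = 1 ∨ O.dep (O.card - 1) + 14 ≤
      3 * Nat.log 2 (B.len v) + 15 * Nat.log 2 (B.len v) + 17 * (F - Nat.log 2 (P v)) + 7) :
    B.Built P F ℓ O f v := by
  have hlen := B.len_pos hv
  have hlog := log_core_key hlen hpos
  have h0 : ¬ B.side P v ≠ 0 := fun h => h hs
  refine ⟨by omega, hsym.le, ?_, by omega, by omega, by rw [hml], by rw [hmp], ?_, ?_, ?_, ?_, ?_,
    fun _ => ⟨by rw [hk, hml, hmp], hb, hℓ⟩, ?_, ?_, ?_, ?_, ?_, ?_, ?_, ?_, ?_, ?_, ?_, ?_, ?_, ?_⟩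
  · rw [hsym, sym_of_pos _ hO, hstr]
  · rw [hml, hmp, mul_comm]; exact hc.mul_len_le B hv
  · rw [hb, hml, hmp, zero_add, mul_comm]; exact Nat.mul_le_mul_left _ (hc.centralIn_le hv)
  · rw [hk]; have := Nat.mul_pos hlen hpos; omega
  · intro _
    rw [hk]
    have : Nat.log 2 (P v - B.centralIn P B.card v) ≤ Nat.log 2 (P v) :=
      Nat.log_mono_right (Nat.sub_le _ _)
    omega
  · rw [hk, hsym]
    rcases hdep with ⟨h1, h2⟩ | h1
    · rw [h2, one_mul, log_four_mul hpos]; simp; omega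
    · omega
  all_goals exact fun h => absurd h h0

end BinGram

/-! ### Following a chain -/

namespace BinGram

variable {α : Type*} {B : BinGram α} {P : ℕ → ℕ} {F : ℕ} {ℓ : ℕ → ℕ} {O₀ O : BinGram α}
  {f f' : ℕ → ℕ → ℕ} {v u a m x y β k ml mp βu : ℕ}

/-- The properties of the position `β` and the key `k` of a variable `v` with a central child, at
position `βu`, and another child `a`.  The lower bounds for `k` come from the distance of the
positions, the upper bounds from the size of the interval of positions. -/
structure ItemKey (B : BinGram α) (P : ℕ → ℕ) (v a ml mp βu β k : ℕ) : Prop where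
  beta_le : β + B.centralIn P B.card v * ml ≤ B.len v * mp
  pos : 0 < k
  log_len_le : Nat.log 2 (B.len a) + Nat.log 2 (P v) ≤ Nat.log 2 k
  le_log : 0 < P v - B.centralIn P B.card v →
    Nat.log 2 (B.len v) + Nat.log 2 (P v - B.centralIn P B.card v) ≤ Nat.log 2 k
  log_lt : Nat.log 2 k < Nat.log 2 (4 * (ml * mp))
  log_le : Nat.log 2 k ≤ Nat.log 2 (B.len v) + Nat.log 2 (P v) + 2
  digit : β / 2 ^ Nat.log 2 k % 2 = 1
  digit_child : βu / 2 ^ Nat.log 2 k % 2 = 0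
  div_eq : β / 2 ^ (Nat.log 2 k + 1) = βu / 2 ^ (Nat.log 2 k + 1)

theorem Built.itemKey (h : B.Built P F ℓ O f u) (hP : B.CountsFrom 0 P) (hv : v < B.card)
    (hc : B.CentralChild P v u) (ha : a < B.card) (hlen : B.len v = B.len u + B.len a)
    (hβ : β = f aBeta u + (B.len v - B.len u) * f aMP u +
      (P v - B.centralIn P B.card v) * f aML u) (hk : k = β ^^^ f aBeta u) :
    B.ItemKey P v a (f aML u) (f aMP u) (f aBeta u) β k := by
  have hlvl := hc.sameLevel
  have hlm := h.log_ml
  have hlp := h.log_mp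
  have hm0 := h.ml_pos
  have hp0 := h.mp_pos
  have hla := B.len_pos ha
  -- the paths that enter `u` by its central parent are those through `v`
  have hup := h.beta_le
  rw [CentralChild.centralIn_eq hP hv hc] at hup
  have hcv := hP.centralIn_le hv
  set ml := f aML u
  set mp := f aMP u
  set βu := f aBeta u
  set q := B.centralIn P B.card v
  rw [show B.len v - B.len u = B.len a by omega] at hβ
  obtain ⟨X, hX⟩ : ∃ X, P v = X + q := ⟨P v - q, by omega⟩
  have hXX : P v - q = X := by omega
  rw [hXX] at hβ
  have b1 : β + q * ml ≤ B.len v * mp := by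
    rw [hβ, hlen]; rw [hX] at hup; nlinarith
  have b2 : βu + B.len a * mp + X * ml = β := hβ.symm
  have hamp : 0 < B.len a * mp := Nat.mul_pos hla hp0
  have hlt : βu < β := by omega
  have hkpos : 0 < k := by
    rw [hk]
    exact xor_pos_of_lt hlt
  have hkge : B.len a * mp + X * ml ≤ k := by
    have := sub_le_xor β βu
    rw [hk]
    omega
  have hlv : B.len v < 2 * ml := lt_two_mul_of_log_eq hm0 (by rw [hlvl.1, hlm])
  have hmm := Nat.mul_pos hm0 hp0
  -- both positions are below `2 * (ml * mp)`, hence so is, up to rounding, their distance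
  have hβlt : β < 2 * (ml * mp) := by
    have : B.len v * mp < 2 * ml * mp := Nat.mul_lt_mul_of_pos_right hlv hp0
    rw [← mul_assoc]; omega
  have hklt : k < 2 ^ (Nat.log 2 (2 * (ml * mp)) + 1) := by
    have := Nat.lt_pow_succ_log_self (b := 2) (by norm_num) (2 * (ml * mp))
    rw [hk]
    exact Nat.xor_lt_two_pow (by omega) (by omega)
  have hκ : Nat.log 2 k ≤ Nat.log 2 (2 * (ml * mp)) :=
    Nat.lt_succ_iff.1 (Nat.log_lt_of_lt_pow hkpos.ne' hklt)
  have e2 : Nat.log 2 (2 * (ml * mp)) = Nat.log 2 (ml * mp) + 1 := by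
    rw [mul_comm, Nat.log_mul_base (by norm_num) hmm.ne']
  have e4 := log_four_mul hmm
  have e5 := log_mul_lt hm0 hp0
  have hd := div_two_pow_log_xor_mod hlt
  have hd2 := div_two_pow_log_xor βu β
  rw [← hk] at hd hd2
  refine ⟨b1, hkpos, ?_, ?_, by omega, ?_, hd.1, hd.2, hd2⟩
  · have h1 := log_add_log_le hla hp0
    have h2 : Nat.log 2 (B.len a * mp) ≤ Nat.log 2 k := Nat.log_mono_right (by omega)
    rw [hlvl.2, ← hlp]; omega
  · intro h0
    rw [hXX] at h0 ⊢
    have h1 := log_add_log_le h0 hm0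
    have h2 : Nat.log 2 (X * ml) ≤ Nat.log 2 k := Nat.log_mono_right (by omega)
    rw [hlvl.1, ← hlm]; omega
  · rw [hlvl.1, hlvl.2, ← hlm, ← hlp]; omega

/-- The invariant of the loop that processes a variable `v` with central child `u` and key `k`: the
chain of `u` has been followed to `m`, and the optional variables `x` and `y` derive what surrounds
the string of `m` in that of `u`. -/
structure Popping (B : BinGram α) (P : ℕ → ℕ) (F : ℕ) (ℓ : ℕ → ℕ) (f : ℕ → ℕ → ℕ) (v u k : ℕ)
    (O₀ O : BinGram α) (m x y : ℕ) : Prop where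
  ext : O₀.Extends O
  lt : m < v
  pos : 0 < P m
  ml_eq : f aML m = f aML u
  mp_eq : f aMP m = f aMP u
  beta_eq : f aBeta u / 2 ^ Nat.log 2 k = f aBeta m / 2 ^ Nat.log 2 k
  le_left : x ≤ O.card
  le_right : y ≤ O.card
  str_eq : O.sym x ++ B.str m ++ O.sym y = B.str u
  dep_left : x ≠ 0 → O.dep (x - 1) + 3 * Nat.log 2 (P v) + 9 ≤ 15 * Nat.log 2 (B.len v) +
    17 * (F - Nat.log 2 (P v)) + 3 * min (Nat.log 2 k) (Nat.log 2 (f aKey m))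
  dep_right : y ≠ 0 → O.dep (y - 1) + 3 * Nat.log 2 (P v) + 9 ≤ 15 * Nat.log 2 (B.len v) +
    17 * (F - Nat.log 2 (P v)) + 3 * min (Nat.log 2 k) (Nat.log 2 (f aKey m))
  card_le : O.card + 2 * ℓ m ≤ O₀.card + 2 * ℓ u

theorem Popping.start (hu : u < v) (hpos : 0 < P u) : B.Popping P F ℓ f v u k O O u 0 0 := by
  refine ⟨.refl O, hu, hpos, rfl, rfl, rfl, by simp, by simp, by simp, by simp, by simp, le_rfl⟩

section
variable (h : B.Popping P F ℓ f v u k O₀ O m x y) (hm : B.Built P F ℓ O f m)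
  (hu : B.Built P F ℓ O f u) (hc : B.CentralChild P v u)
  (hk : B.ItemKey P v a (f aML u) (f aMP u) (f aBeta u) β k)

include h hm hu hc in
theorem Popping.logs : Nat.log 2 (B.len m) = Nat.log 2 (B.len v) ∧
    Nat.log 2 (P m) = Nat.log 2 (P v) := by
  have := hc.sameLevel
  rw [this.1, this.2, ← hu.log_ml, ← hu.log_mp, ← h.ml_eq, ← h.mp_eq, hm.log_ml, hm.log_mp]
  exact ⟨rfl, rfl⟩

include h hm hk in
/-- No variable of the chain has a key with the same logarithm as `k`: its position would have the
digit `1` there, that of `u` has the digit `0`, but the two agree from this digit on. -/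
theorem Popping.log_ne : Nat.log 2 (f aKey m) ≠ Nat.log 2 k := by
  intro he
  have hlt := hk.log_lt
  by_cases hs : B.side P m = 0
  · have := (hm.core hs).1
    rw [h.ml_eq, h.mp_eq] at this
    rw [this] at he
    omega
  · have h1 := hm.digit hs
    have h2 := hk.digit_child
    rw [h.beta_eq, ← he] at h2
    omega

include h hm hk in
theorem Popping.side_ne_zero (hlt : f aKey m < k) : B.side P m ≠ 0 := by
  intro hs
  have h1 := (hm.core hs).1
  rw [h.ml_eq, h.mp_eq] at h1
  have h2 := hk.log_lt
  have h3 : Nat.log 2 (f aKey m) ≤ Nat.log 2 k := Nat.log_mono_right hlt.le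
  rw [h1] at h3
  omega

include h hm hk in
theorem Popping.log_lt_of_lt (hlt : f aKey m < k) : Nat.log 2 (f aKey m) < Nat.log 2 k :=
  lt_of_le_of_ne (Nat.log_mono_right hlt.le) (h.log_ne hm hk)

include h hm hk in
/-- The chain stops at a variable that may succeed `v`. -/
theorem Popping.exit (hge : ¬ f aKey m < k) : Nat.log 2 k < Nat.log 2 (f aKey m) ∧
    β / 2 ^ (Nat.log 2 k + 1) = f aBeta m / 2 ^ (Nat.log 2 k + 1) := by
  refine ⟨lt_of_le_of_ne (Nat.log_mono_right (not_lt.1 hge)) (h.log_ne hm hk).symm, ?_⟩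
  rw [hk.div_eq]
  exact div_two_pow_eq_of_le h.beta_eq (Nat.le_succ _)

include h hm hu hc hk in
/-- One step along the chain: the surroundings of `m` are extended by those that are recorded for
the successor of `m`. -/
theorem Popping.step (hlt : f aKey m < k) {O₁ O₂ : BinGram α} {x' y' : ℕ}
    (hx : O.Concat x (f aZl m) O₁ x') (hy : O₁.Concat (f aZr m) y O₂ y') :
    B.Popping P F ℓ f v u k O₀ O₂ (f aNext m) x' y' ∧ ℓ m = ℓ (f aNext m) + 1 := by
  have hs := h.side_ne_zero hm hk hlt
  have hκ := h.log_lt_of_lt hm hk hlt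
  obtain ⟨e1, e2⟩ := h.logs hm hu hc
  have hnk := hm.next_key hs
  have hl := hm.next_len hs
  have hzl := hm.zl_dep hs
  have hzr := hm.zr_dep hs
  rw [e1, e2] at hzl hzr
  have c1 := hx.card_le
  have c2 := hy.card_le
  have c3 := h.card_le
  have zl := hm.zl_le hs
  have zr := hm.zr_le hs
  have hx1 := h.le_left
  have hy1 := h.le_right
  have hdl := h.dep_left
  have hdr := h.dep_right
  have oc := hx.ext.card_le
  refine ⟨⟨(h.ext.trans hx.ext).trans hy.ext, (hm.next_lt hs).trans h.lt, hm.next_pos hs,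
    (hm.next_ml hs).trans h.ml_eq, (hm.next_mp hs).trans h.mp_eq,
    h.beta_eq.trans (div_two_pow_eq_of_le (hm.next_beta hs) hκ),
    hx.le.trans hy.ext.card_le, hy.le, ?_, ?_, ?_, by omega⟩, hl⟩
  · rw [hy.ext.sym_eq hx.le, hx.sym_eq, hy.sym_eq, hx.ext.sym_eq hy1,
      hx.ext.sym_eq zr, ← h.str_eq, ← hm.z_str hs]
    simp only [List.append_assoc]
  · intro h0
    rw [hy.ext.dep_eq _ (by have := hx.le; omega)]
    have := hx.dep_le (15 * Nat.log 2 (B.len v) + 17 * (F - Nat.log 2 (P v)) +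
      3 * (Nat.log 2 (f aKey m) + 1) - 3 * Nat.log 2 (P v) - 9)
      (fun h1 => by have := hdl h1; omega) (fun h1 => by have := hzl h1; omega) h0
    have hpos : x ≠ 0 ∨ f aZl m ≠ 0 := by
      by_contra hcon
      push Not at hcon
      exact h0 (by have := (hx.eq_left hcon.2).1; omega)
    rcases hpos with h1 | h1
    · have := hdl h1; omega
    · have := hzl h1; omega
  · intro h0
    have key1 : y ≠ 0 → O₁.dep (y - 1) = O.dep (y - 1) := fun h1 => hx.ext.dep_eq _ (by omega)
    have key2 : f aZr m ≠ 0 → O₁.dep (f aZr m - 1) = O.dep (f aZr m - 1) :=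
      fun h1 => hx.ext.dep_eq _ (by omega)
    have := hy.dep_le (15 * Nat.log 2 (B.len v) + 17 * (F - Nat.log 2 (P v)) +
      3 * (Nat.log 2 (f aKey m) + 1) - 3 * Nat.log 2 (P v) - 9)
      (fun h1 => by rw [key2 h1]; have := hzr h1; omega)
      (fun h1 => by rw [key1 h1]; have := hdr h1; omega) h0
    have hpos : y ≠ 0 ∨ f aZr m ≠ 0 := by
      by_contra hcon
      push Not at hcon
      exact h0 (by have := (hy.eq_left hcon.1).1; omega)
    rcases hpos with h1 | h1
    · have := hdr h1; omega
    · have := hzr h1; omega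

/-- The optional variables `x` and `y` derive what surrounds the string of `m` in that of `v`. -/
structure Wrapped (B : BinGram α) (P : ℕ → ℕ) (F v k : ℕ) (O O' : BinGram α) (m x y : ℕ) :
    Prop where
  ext : O.Extends O'
  card_le : O'.card ≤ O.card + 1
  le_left : x ≤ O'.card
  le_right : y ≤ O'.card
  str_eq : O'.sym x ++ B.str m ++ O'.sym y = B.str v
  dep_left : x ≠ 0 → O'.dep (x - 1) + 3 * Nat.log 2 (P v) + 7 ≤ 15 * Nat.log 2 (B.len v) +
    17 * (F - Nat.log 2 (P v)) + 3 * Nat.log 2 k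
  dep_right : y ≠ 0 → O'.dep (y - 1) + 3 * Nat.log 2 (P v) + 7 ≤ 15 * Nat.log 2 (B.len v) +
    17 * (F - Nat.log 2 (P v)) + 3 * Nat.log 2 k
  ne_zero : x ≠ 0 ∨ y ≠ 0

include h hk in
theorem Popping.wrap_right (ha : B.Built P F ℓ O f a) (hoff : B.OffEdge P v a) (hv : 0 < P v)
    (hF : Nat.log 2 (P a) ≤ F) (hstr : B.str v = B.str u ++ B.str a) {O' : BinGram α} {y' : ℕ}
    (hy : O.Concat y (f aSym a) O' y') : B.Wrapped P F v k O O' m x y' := by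
  have hd := ha.dep_le_of_offEdge hoff hv hF
  have hl := hk.log_len_le
  have hx1 := h.le_left
  have hdl := h.dep_left
  have hdr := h.dep_right
  have hsp := ha.sym_pos
  refine ⟨hy.ext, hy.card_le, hx1.trans hy.ext.card_le, hy.le, ?_, ?_, ?_,
    .inr (hy.ne_zero (.inr hsp.ne'))⟩
  · rw [hy.sym_eq, ha.str_eq, hy.ext.sym_eq hx1, hstr, ← h.str_eq]
    simp only [List.append_assoc]
  · intro h0
    rw [hy.ext.dep_eq _ (by omega)]
    have := hdl h0
    omega
  · intro h0
    have := hy.dep_le (15 * Nat.log 2 (B.len v) + 17 * (F - Nat.log 2 (P v)) +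
      3 * Nat.log 2 k - 3 * Nat.log 2 (P v) - 7)
      (fun h1 => by have := hdr h1; omega) (fun h1 => by omega) h0
    omega

include h hk in
theorem Popping.wrap_left (ha : B.Built P F ℓ O f a) (hoff : B.OffEdge P v a) (hv : 0 < P v)
    (hF : Nat.log 2 (P a) ≤ F) (hstr : B.str v = B.str a ++ B.str u) {O' : BinGram α} {x' : ℕ}
    (hx : O.Concat (f aSym a) x O' x') : B.Wrapped P F v k O O' m x' y := by
  have hd := ha.dep_le_of_offEdge hoff hv hF
  have hl := hk.log_len_le
  have hy1 := h.le_right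
  have hdl := h.dep_left
  have hdr := h.dep_right
  have hsp := ha.sym_pos
  refine ⟨hx.ext, hx.card_le, hx.le, hy1.trans hx.ext.card_le, ?_, ?_, ?_,
    .inl (hx.ne_zero (.inl hsp.ne'))⟩
  · rw [hx.sym_eq, ha.str_eq, hx.ext.sym_eq hy1, hstr, ← h.str_eq]
    simp only [List.append_assoc]
  · intro h0
    have := hx.dep_le (15 * Nat.log 2 (B.len v) + 17 * (F - Nat.log 2 (P v)) +
      3 * Nat.log 2 k - 3 * Nat.log 2 (P v) - 7)
      (fun h1 => by omega) (fun h1 => by have := hdl h1; omega) h0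
    omega
  · intro h0
    rw [hx.ext.dep_eq _ (by omega)]
    have := hdr h0
    omega

include h hm hu hc hk in
/-- Processing a variable `v` that has a central child `u`. -/
theorem Popping.built (hge : ¬ f aKey m < k) (hs : B.side P v ≠ 0) {O₃ O₄ O₅ : BinGram α}
    {x' y' z r : ℕ} (hw : B.Wrapped P F v k O O₃ m x' y') (hz : O₃.Concat x' (f aSym m) O₄ z)
    (hr : O₄.Concat z y' O₅ r) (hf : ∀ a, 9 ≤ a → a ≤ 16 → f' a m = f a m)
    (hsym : f' aSym v = r) (hzl : f' aZl v = x') (hzr : f' aZr v = y') (hnext : f' aNext v = m)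
    (hbeta : f' aBeta v = β) (hkey : f' aKey v = k) (hml : f' aML v = f aML u)
    (hmp : f' aMP v = f aMP u) {ℓ' : ℕ → ℕ} (hℓ : ℓ' v = ℓ m + 1) (hℓm : ℓ' m = ℓ m) :
    B.Built P F ℓ' O₅ f' v ∧ f' aSym v = O₅.card ∧
      O₅.card + 2 * ℓ' v ≤ O₀.card + 2 * ℓ u + 5 := by
  obtain ⟨e1, e2⟩ := h.logs hm hu hc
  obtain ⟨x1, x2⟩ := h.exit hm hk hge
  have hlvl := hc.sameLevel
  have hms := hm.sym_le
  have hmp0 := hm.sym_pos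
  have c1 := hw.card_le
  have c2 := hz.card_le
  have c3 := hr.card_le
  have c4 := h.card_le
  have g1 := hw.ext.card_le
  have g2 := hz.ext.card_le
  have g3 := hr.ext.card_le
  have wl := hw.le_left
  have wr := hw.le_right
  have wdl := hw.dep_left
  have wdr := hw.dep_right
  have hmd := hm.dep_le
  rw [e1, e2] at hmd
  have hkl := hk.log_le
  have hz0 : z ≠ 0 := hz.ne_zero (.inr hmp0.ne')
  have hr0 : r ≠ 0 := hr.ne_zero (.inl hz0)
  have hrc : r = O₅.card := by
    by_cases hy : y' = 0
    · obtain ⟨q1, q2⟩ := hr.eq_left hy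
      have hx : x' ≠ 0 := by rcases hw.ne_zero with h | h <;> [exact h; exact absurd hy h]
      rw [q1, q2, hz.eq_card hx hmp0.ne']
    · exact hr.eq_card hz0 hy
  have hms3 : O₃.dep (f aSym m - 1) = O.dep (f aSym m - 1) := hw.ext.dep_eq _ (by omega)
  have hdz : O₄.dep (z - 1) + 2 * Nat.log 2 k + 1 ≤
      20 * Nat.log 2 (B.len v) + 17 * (F - Nat.log 2 (P v)) + 2 * Nat.log 2 (P v) + 7 := by
    have := hz.dep_le (20 * Nat.log 2 (B.len v) + 17 * (F - Nat.log 2 (P v)) +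
      2 * Nat.log 2 (P v) + 6 - 2 * Nat.log 2 k)
      (fun h1 => by have := wdl h1; omega) (fun _ => by rw [hms3]; omega) hz0
    omega
  have hdr : O₅.dep (r - 1) + 2 * Nat.log 2 k ≤
      20 * Nat.log 2 (B.len v) + 17 * (F - Nat.log 2 (P v)) + 2 * Nat.log 2 (P v) + 7 := by
    have := hr.dep_le (20 * Nat.log 2 (B.len v) + 17 * (F - Nat.log 2 (P v)) +
      2 * Nat.log 2 (P v) + 7 - 2 * Nat.log 2 k) (fun _ => by omega)
      (fun h1 => by rw [hz.ext.dep_eq _ (by omega)]; have := wdr h1; omega) hr0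
    omega
  have hwz : O₅.sym x' = O₃.sym x' := by
    rw [hr.ext.sym_eq (by omega), hz.ext.sym_eq wl]
  have hwy : O₅.sym y' = O₃.sym y' := by
    rw [hr.ext.sym_eq (by omega), hz.ext.sym_eq wr]
  refine ⟨⟨?_, ?_, ?_, ?_, ?_, ?_, ?_, ?_, ?_, ?_, ?_, ?_, fun h0 => absurd h0 hs, ?_, ?_, ?_, ?_,
    ?_, ?_, ?_, ?_, ?_, ?_, ?_, ?_, ?_, ?_⟩, hsym.trans hrc, by omega⟩
  · omega
  · omega
  · rw [hsym, hr.sym_eq, hz.ext.sym_eq wr, hz.sym_eq, hw.ext.sym_eq hms, hm.str_eq, hw.str_eq]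
  · rw [hml]; exact hu.ml_pos
  · rw [hmp]; exact hu.mp_pos
  · rw [hml, hu.log_ml, hlvl.1]
  · rw [hmp, hu.log_mp, hlvl.2]
  · rw [hml, hmp]; exact hu.ml_mul_mp
  · rw [hml, hmp, hbeta]; exact hk.beta_le
  · rw [hkey]; exact hk.pos
  · rw [hkey]; exact hk.le_log
  · rw [hkey, hsym]; exact hdr
  · intro _; rw [hkey, hml, hmp]; exact hk.log_lt
  · intro _; rw [hkey, hbeta]; exact hk.digit
  · intro _; rw [hnext]; exact h.lt
  · intro _; rw [hnext]; exact h.pos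
  · intro _; rw [hnext, hf _ (by norm_num) (by norm_num), hml]; exact h.ml_eq
  · intro _; rw [hnext, hf _ (by norm_num) (by norm_num), hmp]; exact h.mp_eq
  · intro _; rw [hnext, hf _ (by norm_num) (by norm_num), hkey]; exact x1
  · intro _; rw [hnext, hf _ (by norm_num) (by norm_num), hkey, hbeta]; exact x2
  · intro _; rw [hnext, hℓ, hℓm]
  · intro _; omega
  · intro _; omega
  · intro _; rw [hnext, hzl, hzr, hwz, hwy, hw.str_eq]
  · intro _ h0
    rw [hzl] at h0 ⊢
    rw [hkey, hr.ext.dep_eq _ (by omega), hz.ext.dep_eq _ (by omega)]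
    exact wdl h0
  · intro _ h0
    rw [hzr] at h0 ⊢
    rw [hkey, hr.ext.dep_eq _ (by omega), hz.ext.dep_eq _ (by omega)]
    exact wdr h0

end

end BinGram

/-! ### The balancing pass -/

namespace WordRAM

variable {α : Type*} {code : α → ℕ} {b w : ℕ} {B : BinGram α} {P : ℕ → ℕ} {F : ℕ} {ℓ : ℕ → ℕ}
  {O O' : BinGram α} {S : Finset ℕ} {h h' : Store} {i : ℕ}

/-- The store `h'` differs from `h` in the output, the results of the balancing pass for the
variable `i`, and auxiliary variables. -/
structure ProcessedAt (i : ℕ) (h h' : Store) : Prop where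
  low : ∀ a ≤ 8, h'.arr a = h.arr a
  high : ∀ a, 9 ≤ a → a ≤ 16 → ∀ u, u ≠ i → h'.arr a u = h.arr a u
  var : ∀ r ∈ [rB, rOne, rTwo, rN, rZero, rI], h'.var r = h.var r

/-- The invariant of the balancing pass: the variables below `i` have been processed.  The finite
set `S` contains those of them whose central parent, if there is one, is still to be processed; the
lengths of their chains pay for the output grammar `O` and for the running time. -/
structure Balanced (code : α → ℕ) (b : ℕ) (B : BinGram α) (P : ℕ → ℕ) (F i : ℕ) (O : BinGram α)
    (ℓ : ℕ → ℕ) (S : Finset ℕ) (h : Store) : Prop where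
  analyzed : Analyzed code b B P B.card h
  emitted : Emitted code O h
  built : ∀ v < i, 0 < P v → B.Built P F ℓ O h.arr v
  tops : S ⊆ range i
  mem_tops : ∀ v < B.card, i ≤ v → ∀ u < i, B.CentralChild P v u → u ∈ S
  card_le : O.card + 2 * ∑ u ∈ S, ℓ u ≤ 5 * i
  sym_last : ∀ j, i = j + 1 → 0 < P j → h.arr aSym j = O.card

theorem Analyzed.congr (ha : Analyzed code b B P i h) (h1 : ∀ a ≤ 8, h'.arr a = h.arr a)
    (h2 : ∀ r ∈ [rB, rOne, rTwo, rN, rZero], h'.var r = h.var r) :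
    Analyzed code b B P i h' where
  loaded := ha.loaded.congr (h1 _ (by norm_num)) (h1 _ (by norm_num)) (h1 _ (by norm_num))
    ⟨h2 _ (by simp), h2 _ (by simp), h2 _ (by simp), h2 _ (by simp)⟩
  paths := (h1 _ (by norm_num)).trans ha.paths
  zero := (h2 _ (by simp)).trans ha.zero
  len := by rw [h1 _ (by norm_num)]; exact ha.len
  side := by rw [h1 _ (by norm_num)]; exact ha.side
  centralIn := by rw [h1 _ (by norm_num)]; exact ha.centralIn

theorem Balanced.succ (hb : Balanced code b B P F i O ℓ S h) (hp : ProcessedAt i h h')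
    (hO : O.Extends O') (he : Emitted code O' h') {L : ℕ} {S' : Finset ℕ}
    (hbuilt : 0 < P i → B.Built P F (Function.update ℓ i L) O' h'.arr i)
    (hS : S' ⊆ range (i + 1))
    (hS' : ∀ v < B.card, i < v → ∀ u ≤ i, B.CentralChild P v u → u ∈ S')
    (hcard : O'.card + 2 * ∑ u ∈ S', Function.update ℓ i L u ≤ 5 * (i + 1))
    (hsym : 0 < P i → h'.arr aSym i = O'.card) :
    Balanced code b B P F (i + 1) O' (Function.update ℓ i L) S' h' where
  analyzed := hb.analyzed.congr hp.low fun r hr => hp.var r (by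
    simp only [List.mem_cons, List.not_mem_nil, or_false] at hr ⊢; omega)
  emitted := he
  built v hv hpos := by
    rcases Nat.lt_succ_iff_lt_or_eq.1 hv with h1 | rfl
    · exact (hb.built v h1 hpos).congr hO (fun u hu a h9 h16 => hp.high a h9 h16 u (by omega))
        (fun u hu => Function.update_of_ne (by omega) _ _)
    · exact hbuilt hpos
  tops := hS
  mem_tops v hv hiv u hu := hS' v hv hiv u (by omega)
  card_le := hcard
  sym_last j hj := by obtain rfl : i = j := by omega
                      exact hsym

theorem Balanced.congr (hb : Balanced code b B P F i O ℓ S h) (h1 : h'.arr = h.arr)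
    (h2 : ∀ r ∈ [rB, rOne, rTwo, rN, rZero, rOp, rCnt], h'.var r = h.var r) :
    Balanced code b B P F i O ℓ S h' where
  analyzed := hb.analyzed.congr (fun a _ => by rw [h1]) fun r hr => h2 r (by
    simp only [List.mem_cons, List.not_mem_nil, or_false] at hr ⊢; omega)
  emitted := hb.emitted.congr (by rw [h1]) (h2 _ (by simp)) (h2 _ (by simp))
  built := by rw [h1]; exact hb.built
  tops := hb.tops
  mem_tops := hb.mem_tops
  card_le := hb.card_le
  sym_last := by rw [h1]; exact hb.sym_last

/-- Process a variable without a central child. -/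
def buildCore : Cmd :=
  .wr aML ♯rI ♯rL ;; .wr aMP ♯rI ♯rV ;; .wr aBeta ♯rI 0 ;; .wr aKey ♯rI (4 * (♯rL * ♯rV)) ;;
  .asg rK (.rd aKind ♯rI) ;;
  .ite (.eq rK rOne)
    (.wr aOut ♯rOp 1 ;; .wr aOut (♯rOp + 1) 2 ;; .wr aOut (♯rOp + 2) (.rd aSym ♯rX - 1) ;;
     .wr aOut (♯rOp + 3) (.rd aSym ♯rY - 1) ;; .asg rOp (♯rOp + 4))
    (.ite (.eq rK rTwo)
      (.wr aOut ♯rOp 2 ;; .wr aOut (♯rOp + 1) (.rd aSym ♯rX - 1) ;; .wr aOut (♯rOp + 2) ♯rY ;;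
       .asg rOp (♯rOp + 3))
      (.wr aOut ♯rOp 0 ;; .wr aOut (♯rOp + 1) ♯rX ;; .asg rOp (♯rOp + 2))) ;;
  .asg rCnt (♯rCnt + 1) ;; .wr aSym ♯rI ♯rCnt

theorem wp_buildCore (hw : 64 * b + 64 < 2 ^ w) (hb : Balanced code b B P F i O ℓ S h)
    (hP : B.CountsFrom 0 P) (hF : F = Nat.log 2 (B.len (B.card - 1)))
    (hn : 4 * B.len (B.card - 1) < 2 ^ w) (hi : i < B.card) (hib : B.card < b) (hpos : 0 < P i)
    (hs : B.side P i = 0) (hI : h.var rI = i) (hL : h.var rL = B.len i) (hV : h.var rV = P i)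
    (hX : h.var rX = h.arr aX i) (hY : h.var rY = h.arr aY i)
    {Q : ℕ → Store → Prop}
    (hQ : ∀ t h' O', t ≤ 200 → ProcessedAt i h h' → O.Extends O' → Emitted code O' h' →
      O'.card = O.card + 1 → B.Built P F (Function.update ℓ i 0) O' h'.arr i →
      h'.arr aSym i = O'.card → Q t h') :
    buildCore.wp b w Q h := by
  have hl := hb.analyzed.loaded
  have hst := hl.stored i hi
  have he := hb.emitted
  have hop := he.varOp_le
  have hcnt := he.varCnt
  have hcard := hb.card_le
  have hlv := hP.mul_len_le B hi
  have hlen := B.len_eq hi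
  have hstr := B.str_eq i hi
  have ok := B.ok i hi
  have hPF : ∀ v < B.card, Nat.log 2 (P v) ≤ F := fun v hv => by
    rw [hF]; exact Nat.log_mono_right (hP.le_len B hv)
  have hlp : B.len i * P i ≤ B.len (B.card - 1) := by rw [mul_comm]; exact hlv
  have hfit : 4 * (B.len i * P i) < 2 ^ w := by omega
  have hfit1 : B.len i * P i < 2 ^ w := by omega
  have fin : ∀ {t : ℕ} {h' : Store} {r : BinRule α} (hr : r.Ok O.card), t ≤ 200 →
      (∀ a ≤ 8, h'.arr a = h.arr a) →
      (∀ a, 9 ≤ a → a ≤ 16 → ∀ u, u ≠ i → h'.arr a u = h.arr a u) →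
      (∀ r, r ≠ rK → r ≠ rOp → r ≠ rCnt → h'.var r = h.var r) →
      (∀ j < h.var rOp, h'.arr aOut j = h.arr aOut j) →
      At (h'.arr aOut) (h.var rOp) (r.toRule.encode code) →
      h'.var rOp = h.var rOp + (r.toRule.encode code).length →
      h'.var rCnt = h.var rCnt + 1 →
      (h'.arr aSym i = O.card + 1 ∧ h'.arr aML i = B.len i ∧ h'.arr aMP i = P i ∧
        h'.arr aBeta i = 0 ∧ h'.arr aKey i = 4 * (B.len i * P i)) →
      r.str O.str = B.str i →
      (r.dep O.dep ≤ 1 ∧ B.len i = 1 ∨ r.dep O.dep + 14 ≤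
        3 * Nat.log 2 (B.len i) + 15 * Nat.log 2 (B.len i) + 17 * (F - Nat.log 2 (P i)) + 7) →
      Q t h' := by
    intro t h' r hr e1 e2 e3 e4 e5 e6 e7 e8 e9 e10 e11
    refine hQ t h' (O.push r hr) e1 ⟨e2, e3, fun r hr => e4 r ?_ ?_ ?_⟩ (O.extends_push hr)
      (he.push hr e5 e6 e7 e8) rfl ?_ e9.1
    any_goals simp only [List.mem_cons, List.not_mem_nil, or_false] at hr; omega
    refine BinGram.built_core hP hi hpos hs e9.1 (Nat.succ_pos _) ?_ e9.2.1 e9.2.2.1 e9.2.2.2.1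
      e9.2.2.2.2 (by simp) ?_
    · rw [← e10]; exact O.push_str_card hr
    · rw [← O.push_dep_card hr] at e11; exact e11
  have hZ : ∀ {u : ℕ}, B.OffEdge P i u → 0 < h.arr aSym u ∧ h.arr aSym u ≤ O.card ∧
      O.str (h.arr aSym u - 1) = B.str u ∧ O.dep (h.arr aSym u - 1) + 15 ≤
        3 * Nat.log 2 (B.len i) + 15 * Nat.log 2 (B.len i) + 17 * (F - Nat.log 2 (P i)) + 7 := by
    intro u hu
    have hB := hb.built u hu.lt hu.pos
    have h1 := hB.dep_le_of_offEdge hu hpos (hPF u (hu.lt.trans hi))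
    have h2 := hu.log_len_le
    refine ⟨hB.sym_pos, hB.sym_le, ?_, by omega⟩
    rw [← O.sym_of_pos hB.sym_pos, hB.str_eq]
  unfold buildCore
  have p9 : ∀ a ≤ 8, a ≠ 9 ∧ a ≠ 13 ∧ a ≠ 14 ∧ a ≠ 15 ∧ a ≠ 16 ∧ a ≠ 17 := fun a ha => by omega
  cases hr : B.rule i with
  | leaf c =>
    rw [hr] at hst hlen hstr
    simp [Cmd.wp, Expr.addrCost, hl.varB, hl.one, hl.two, hI, hL, hV, hX, hst.1, hst.2]
    repeat refine And.intro (by omega) ?_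
    refine fin (r := .leaf c) trivial (by norm_num) ?_ ?_ ?_ ?_ ?_ ?_ ?_ ?_ ?_ ?_
    · intro a ha; obtain ⟨h1, h2, h3, h4, h5, h6⟩ := p9 a ha; funext j; simp [h1, h2, h3, h4, h5, h6]
    · intro a h9 h16 u hu; simp [hu, show a ≠ 17 by omega]
    · intro r h1 h2 h3; simp [h1, h2, h3]
    · intro j hj; simp [show j ≠ h.var rOp by omega, show j ≠ h.var rOp + 1 by omega]
    · simp [BinRule.toRule, RLRule.encode]
    · simp [BinRule.toRule, RLRule.encode]
    · simp
    · simp [hcnt]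
    · rw [hstr]; rfl
    · exact .inl ⟨by simp [BinRule.dep], hlen⟩
  | pow x t =>
    rw [hr] at hst hlen hstr ok
    obtain ⟨k1, k2, k3⟩ := hst
    obtain ⟨z1, z2, z3, z4⟩ := hZ (hP.offEdge_pow hi hpos hr)
    have okx := ok.1
    have hxi : x ≠ i := okx.ne
    simp [Cmd.wp, Expr.addrCost, hl.varB, hl.one, hl.two, hI, hL, hV, hX, hY, k1, k2, k3]
    repeat refine And.intro (by omega) ?_
    refine fin (r := .pow (h.arr aSym x - 1) t) ⟨by omega, ok.2⟩ (by norm_num) ?_ ?_ ?_ ?_ ?_ ?_ ?_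
      ?_ ?_ ?_
    · intro a ha; obtain ⟨h1, h2, h3, h4, h5, h6⟩ := p9 a ha; funext j; simp [h1, h2, h3, h4, h5, h6]
    · intro a h9 h16 u hu; simp [hu, show a ≠ 17 by omega]
    · intro r h1 h2 h3; simp [h1, h2, h3]
    · intro j hj
      simp [show j ≠ h.var rOp by omega, show j ≠ h.var rOp + 1 by omega,
        show j ≠ h.var rOp + 2 by omega]
    · simp [BinRule.toRule, RLRule.encode, add_assoc]
    · simp [BinRule.toRule, RLRule.encode]
    · simp
    · simp [hcnt]
    · rw [hstr]; simp only [BinRule.str, z3]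
    · refine .inr ?_
      simp only [BinRule.dep]; omega
  | pair x y =>
    rw [hr] at hst hlen hstr ok
    obtain ⟨k1, k2, k3⟩ := hst
    obtain ⟨-, ox, oy⟩ : B.side P i = 0 ∧ B.OffEdge P i x ∧ B.OffEdge P i y := by
      rcases hP.pair_cases hi hpos hr with h1 | ⟨h1, -⟩ | ⟨h1, -⟩
      · exact h1
      · omega
      · omega
    obtain ⟨z1, z2, z3, z4⟩ := hZ ox
    obtain ⟨y1, y2, y3, y4⟩ := hZ oy
    have okx := ok.1
    have oky := ok.2
    have hxi : x ≠ i := okx.ne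
    have hyi : y ≠ i := oky.ne
    simp [Cmd.wp, Expr.addrCost, hl.varB, hl.one, hl.two, hI, hL, hV, hX, hY, k1, k2, k3]
    repeat refine And.intro (by omega) ?_
    refine fin (r := .pair (h.arr aSym x - 1) (h.arr aSym y - 1)) ⟨by omega, by omega⟩
      (by norm_num) ?_ ?_ ?_ ?_ ?_ ?_ ?_ ?_ ?_ ?_
    · intro a ha; obtain ⟨h1, h2, h3, h4, h5, h6⟩ := p9 a ha; funext j; simp [h1, h2, h3, h4, h5, h6]
    · intro a h9 h16 u hu; simp [hu, show a ≠ 17 by omega]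
    · intro r h1 h2 h3; simp [h1, h2, h3]
    · intro j hj
      simp [show j ≠ h.var rOp by omega, show j ≠ h.var rOp + 1 by omega,
        show j ≠ h.var rOp + 2 by omega, show j ≠ h.var rOp + 3 by omega]
    · simp [BinRule.toRule, RLRule.encode, add_assoc]
    · simp [BinRule.toRule, RLRule.encode]
    · simp
    · simp [hcnt]
    · rw [hstr]; simp only [BinRule.str, z3, y3]
    · refine .inr ?_
      simp only [BinRule.dep]; omega

/-! ### Variables with a central child -/

/-- Follow the chain from the variable in `rG` as long as the keys are less than `rKey`. -/
def followChain : Cmd :=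
  .loop (.lt rT rKey) (
    .asg rS (.rd aZl ♯rG) ;; cat rWl rWl rS ;;
    .asg rS (.rd aZr ♯rG) ;; cat rWr rS rWr ;;
    .asg rG (.rd aNext ♯rG) ;; .asg rT (.rd aKey ♯rG))

theorem runs_followChain (hw : 64 * b + 64 < 2 ^ w) {u a β k : ℕ}
    (hbuilt : ∀ v < i, 0 < P v → B.Built P F ℓ O h.arr v)
    (hc : B.CentralChild P i u) (hu : u < i) (hpos : 0 < P u)
    (hk : B.ItemKey P i a (h.arr aML u) (h.arr aMP u) (h.arr aBeta u) β k) (he : Emitted code O h)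
    (hB : h.var rB = b) (hZ : h.var rZero = 0) (hi : i < b) (hO : O.card + 2 * ℓ u ≤ 5 * i)
    (hK : h.var rKey = k) (hG : h.var rG = u) (hT : h.var rT = h.arr aKey u)
    (hWl : h.var rWl = 0) (hWr : h.var rWr = 0) :
    Runs b w followChain h fun t h' => ∃ O' m, t + 200 * ℓ m ≤ 200 * ℓ u + 1 ∧
      B.Popping P F ℓ h.arr i u k O O' m (h'.var rWl) (h'.var rWr) ∧ Emitted code O' h' ∧
      (∀ a, a ≠ aOut → h'.arr a = h.arr a) ∧
      (∀ r, r ∉ [rS, rT, rWl, rWr, rG, rOp, rCnt] → h'.var r = h.var r) ∧ h'.var rG = m ∧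
      ¬ h.arr aKey m < k := by
  unfold followChain
  refine (Runs.loop (fun (g : BinGram α × ℕ) h' =>
    B.Popping P F ℓ h.arr i u k O g.1 g.2 (h'.var rWl) (h'.var rWr) ∧ Emitted code g.1 h' ∧
      (∀ a, a ≠ aOut → h'.arr a = h.arr a) ∧
      (∀ r, r ∉ [rS, rT, rWl, rWr, rG, rOp, rCnt] → h'.var r = h.var r) ∧ h'.var rG = g.2 ∧
      h'.var rT = h.arr aKey g.2)
    (fun g => 200 * ℓ g.2) (by simp) ?_ (O, u) h ?_).mono ?_
  · rintro ⟨O₁, m⟩ h₁ ⟨hp, he₁, ha₁, hv₁, hg₁, ht₁⟩ ht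
    dsimp only at hp he₁ hg₁ ht₁
    have hK₁ : h₁.var rKey = k := (hv₁ _ (by simp)).trans hK
    have hB₁ : h₁.var rB = b := (hv₁ _ (by simp)).trans hB
    have hZ₁ : h₁.var rZero = 0 := (hv₁ _ (by simp)).trans hZ
    simp only [Test.inStore_lt, ht₁, hK₁] at ht
    have hm : B.Built P F ℓ O₁ h.arr m :=
      (hbuilt m hp.lt hp.pos).congr hp.ext (fun _ _ _ _ _ => rfl) (fun _ _ => rfl)
    have hu₁ : B.Built P F ℓ O₁ h.arr u :=
      (hbuilt u hu hpos).congr hp.ext (fun _ _ _ _ _ => rfl) (fun _ _ => rfl)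
    have hs := hp.side_ne_zero hm hk ht
    have hlt := hp.lt
    have hnl := hm.next_lt hs
    have zl := hm.zl_le hs
    have zr := hm.zr_le hs
    have hl := hm.next_len hs
    have hcd := hp.card_le
    refine Runs.intro hw fun Q hQ => ?_
    simp [Cmd.wp, Expr.addrCost, hg₁, hB₁]
    refine ⟨by omega, ?_⟩
    refine wp_cat (code := code) (O := O₁) hw (he₁.congr (by simp) (by simp) (by simp))
      (by simpa using hB₁) (by simpa using hZ₁) (by omega) (by omega)
      (by simpa using hp.le_left) (by simpa [ha₁] using zl) (by simp) ?_
    intro t₂ h₂ O₂ ht₂ hc₂ he₂ ha₂ hv₂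
    simp [ha₁] at hc₂
    have oc₂ := hc₂.ext.card_le
    have oc₂' := hc₂.card_le
    simp [ha₂, ha₁, hv₂, hg₁, hB₁]
    refine ⟨by omega, ?_⟩
    refine wp_cat (code := code) (O := O₂) hw (he₂.congr (by simp) (by simp) (by simp))
      (by simpa [hv₂] using hB₁) (by simpa [hv₂] using hZ₁) (by omega) (by omega)
      (by simpa using zr.trans oc₂) (by simpa [hv₂] using hp.le_right.trans oc₂) (by simp) ?_
    intro t₃ h₃ O₃ ht₃ hc₃ he₃ ha₃ hv₃
    simp [hv₂] at hc₃
    have hx : h₃.var rWl = h₂.var rWl := by simp [hv₃]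
    obtain ⟨hp', -⟩ := hp.step hm hu₁ hc hk ht hc₂ hc₃
    simp [ha₃, ha₂, ha₁, hv₃, hv₂, hg₁, hB₁]
    refine ⟨by omega, by omega, ?_⟩
    refine hQ _ _ ⟨(O₃, h.arr aNext m), ⟨?_, he₃.congr (by simp) (by simp) (by simp), ?_, ?_, ?_, ?_⟩,
      ?_⟩
    · simpa [hx] using hp'
    · intro a ha; simp [ha₃ _ ha, ha₂ _ ha, ha₁ _ ha]
    · intro r hr
      rw [← hv₁ r hr]
      simp only [List.mem_cons, List.not_mem_nil, or_false, not_or] at hr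
      obtain ⟨r1, r2, r3, r4, r5, r6, r7⟩ := hr
      simp [r1, r2, r3, r4, r5, r6, r7, hv₃, hv₂]
    · simp
    · simp
    · dsimp only; omega
  · refine ⟨?_, he, fun _ _ => rfl, fun _ _ => rfl, hG, hT⟩
    rw [hWl, hWr]
    exact .start hu hpos
  · rintro t h' ⟨⟨O₁, m⟩, ⟨hp, he₁, ha₁, hv₁, hg₁, ht₁⟩, ht, hle⟩
    have hK₁ : h'.var rKey = k := (hv₁ _ (by simp)).trans hK
    simp only [Test.inStore_lt, ht₁, hK₁] at ht
    exact ⟨O₁, m, hle, hp, he₁, ha₁, hv₁, hg₁, ht⟩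

/-- The central child and the other child of a variable that has a central child. -/
theorem _root_.BinGram.CountsFrom.exists_centralChild (hP : B.CountsFrom 0 P) (hi : i < B.card)
    (hpos : 0 < P i) (hs : B.side P i ≠ 0) : ∃ x y, B.rule i = .pair x y ∧
      (B.side P i = 1 ∧ B.CentralChild P i x ∧ B.OffEdge P i y ∨
        B.side P i = 2 ∧ B.CentralChild P i y ∧ B.OffEdge P i x) := by
  cases hr : B.rule i with
  | leaf c => simp [BinGram.side, hr] at hs
  | pow x t => simp [BinGram.side, hr] at hs
  | pair x y =>
    refine ⟨x, y, rfl, ?_⟩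
    rcases hP.pair_cases hi hpos hr with h1 | h1 | h1
    · exact absurd h1.1 hs
    · exact .inl h1
    · exact .inr h1

/-- Concatenate the variables in `rWl`, `aSym rG` and `rWr`, and record the results for `rI`. -/
def recordItem : Cmd :=
  .wr aZl ♯rI ♯rWl ;; .wr aZr ♯rI ♯rWr ;; .asg rS (.rd aSym ♯rG) ;;
  cat rS rWl rS ;; cat rS rS rWr ;; .wr aSym ♯rI ♯rS

section
variable {f : ℕ → ℕ → ℕ} {O₀ O₃ : BinGram α} {u a m β k : ℕ} {x y : ℕ}

theorem wp_recordItem (hw : 64 * b + 64 < 2 ^ w)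
    (hf : ∀ a, a ≠ aOut → ∀ v, a ≠ aNext ∨ v ≠ i → h.arr a v = f a v)
    (hp : B.Popping P F ℓ f i u k O₀ O m x y) (hge : ¬ f aKey m < k)
    (hbuilt : ∀ v < i, 0 < P v → B.Built P F ℓ O₀ f v) (hs : B.side P i ≠ 0)
    (hc : B.CentralChild P i u) (hu : u < i) (hpos : 0 < P u)
    (hk : B.ItemKey P i a (f aML u) (f aMP u) (f aBeta u) β k)
    (hwr : B.Wrapped P F i k O O₃ m (h.var rWl) (h.var rWr)) (he : Emitted code O₃ h)
    (hB : h.var rB = b) (hZ : h.var rZero = 0) (hI : h.var rI = i) (hG : h.var rG = m)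
    (hi : i < b) (hO : O₃.card + 1 ≤ 5 * b) (hnext : h.arr aNext i = m) (hbeta : f aBeta i = β)
    (hkey : f aKey i = k) (hml : f aML i = f aML u) (hmp : f aMP i = f aMP u)
    {Q : ℕ → Store → Prop}
    (hQ : ∀ t h' O', t ≤ 200 → ProcessedAt i h h' → O₃.Extends O' → Emitted code O' h' →
      B.Built P F (Function.update ℓ i (ℓ m + 1)) O' h'.arr i → h'.arr aSym i = O'.card →
      O'.card + 2 * (ℓ m + 1) ≤ O₀.card + 2 * ℓ u + 5 → Q t h') :
    recordItem.wp b w Q h := by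
  have hext := hp.ext.trans hwr.ext
  have hm : B.Built P F ℓ O f m :=
    (hbuilt m hp.lt hp.pos).congr hp.ext (fun _ _ _ _ _ => rfl) (fun _ _ => rfl)
  have hub : B.Built P F ℓ O f u :=
    (hbuilt u hu hpos).congr hp.ext (fun _ _ _ _ _ => rfl) (fun _ _ => rfl)
  have hms := hm.sym_le
  have hlt := hp.lt
  have hmi : m ≠ i := hlt.ne
  have e0 := hwr.ext.card_le
  unfold recordItem
  have hfm : h.arr aSym m = f aSym m := hf _ (by norm_num) _ (.inr hmi)
  simp [Cmd.wp, Expr.addrCost, hB, hI, hG, hfm]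
  repeat refine And.intro (by omega) ?_
  refine wp_cat (code := code) (O := O₃) hw (he.congr (by funext j; simp) (by simp) (by simp))
    (by simpa using hB) (by simpa using hZ) (by omega) (by omega)
    (by simpa using hwr.le_left) (by simpa using hms.trans e0) (by simp) ?_
  intro t₄ h₄ O₄ ht₄ hc₄ he₄ ha₄ hv₄
  simp at hc₄
  have e1 := hc₄.ext.card_le
  refine wp_cat (code := code) (O := O₄) hw he₄
    (by simpa [hv₄] using hB) (by simpa [hv₄] using hZ) (by have := hc₄.card_le; omega) (by omega)
    hc₄.le (by simpa [hv₄] using hwr.le_right.trans e1) (by simp) ?_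
  intro t₅ h₅ O₅ ht₅ hc₅ he₅ ha₅ hv₅
  simp [hv₄] at hc₅
  simp [hv₅, hv₄, hB, hI]
  refine ⟨by omega, ?_⟩
  have hother : ∀ a, a ≠ aOut → ∀ v, h₅.arr a v =
      if a = aZr ∧ v = i then h.var rWr else if a = aZl ∧ v = i then h.var rWl else h.arr a v := by
    intro a ha v
    rw [ha₅ a ha, ha₄ a ha]
    simp
  obtain ⟨r1, r2, r3⟩ := hp.built (f' := (h₅.setArr aSym i (h₅.var rS)).arr) (r := h₅.var rS)
    (ℓ' := Function.update ℓ i (ℓ m + 1))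
    hm hub hc hk hge hs hwr hc₄ hc₅
    (by intro a h9 h16
        have := hf a (by omega) m (.inr hmi)
        simp [hother a (by omega), hmi, this])
    (by simp) (by simp [hother]) (by simp [hother]) (by simp [hother, hnext])
    (by simp [hother, hf, hbeta]) (by simp [hother, hf, hkey]) (by simp [hother, hf, hml])
    (by simp [hother, hf, hmp]) (by simp) (by simp [hmi])
  simp only [Function.update_self] at r3
  refine hQ _ _ O₅ (by omega) ⟨?_, ?_, ?_⟩ (hc₄.ext.trans hc₅.ext)
    (he₅.congr (by funext j; simp) (by simp) (by simp)) r1 r2 r3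
  · intro a ha
    funext v
    simp [hother a (by omega), show a ≠ 9 by omega, show a ≠ 10 by omega, show a ≠ 11 by omega]
  · intro a h9 h16 v hv
    simp [hother a (by omega), hv]
  · intro r hr
    simp only [List.mem_cons, List.not_mem_nil, or_false] at hr
    have g1 : r ≠ rS := by omega
    have g2 : r ≠ rOp := by omega
    have g3 : r ≠ rCnt := by omega
    simp [hv₅, hv₄, g1, g2, g3]

/-- Set the successor of the variable `rI` to `rG`, and combine the variable of `rA` with what has
been collected along the chain. -/
def closeItem : Cmd :=
  .wr aNext ♯rI ♯rG ;; .asg rS (.rd aSym ♯rA) ;;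
  .ite (.eq rK rOne) (cat rWr rWr rS) (cat rWl rS rWl) ;; recordItem

theorem ProcessedAt.trans {h'' : Store} (h1 : ProcessedAt i h h') (h2 : ProcessedAt i h' h'') :
    ProcessedAt i h h'' where
  low a ha := (h2.low a ha).trans (h1.low a ha)
  high a h9 h16 u hu := (h2.high a h9 h16 u hu).trans (h1.high a h9 h16 u hu)
  var r hr := (h2.var r hr).trans (h1.var r hr)

theorem wp_closeItem (hw : 64 * b + 64 < 2 ^ w)
    (hf : ∀ a, a ≠ aOut → h.arr a = f a)
    (hp : B.Popping P F ℓ f i u k O₀ O m (h.var rWl) (h.var rWr)) (hge : ¬ f aKey m < k)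
    (hbuilt : ∀ v < i, 0 < P v → B.Built P F ℓ O₀ f v) (hs : B.side P i ≠ 0)
    (hc : B.CentralChild P i u) (hu : u < i) (hpos : 0 < P u) (hPi : 0 < P i)
    (hk : B.ItemKey P i a (f aML u) (f aMP u) (f aBeta u) β k)
    (hoff : B.OffEdge P i a) (hF : Nat.log 2 (P a) ≤ F)
    (hstr : h.var rK = 1 ∧ B.str i = B.str u ++ B.str a ∨
      h.var rK ≠ 1 ∧ B.str i = B.str a ++ B.str u) (he : Emitted code O h)
    (hB : h.var rB = b) (hZ : h.var rZero = 0) (hone : h.var rOne = 1) (hI : h.var rI = i)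
    (hG : h.var rG = m) (hA : h.var rA = a)
    (hi : i < b) (hO : O.card + 2 ≤ 5 * b) (hbeta : f aBeta i = β)
    (hkey : f aKey i = k) (hml : f aML i = f aML u) (hmp : f aMP i = f aMP u)
    {Q : ℕ → Store → Prop}
    (hQ : ∀ t h' O', t ≤ 300 → ProcessedAt i h h' → O.Extends O' → Emitted code O' h' →
      B.Built P F (Function.update ℓ i (ℓ m + 1)) O' h'.arr i → h'.arr aSym i = O'.card →
      O'.card + 2 * (ℓ m + 1) ≤ O₀.card + 2 * ℓ u + 5 → Q t h') :
    closeItem.wp b w Q h := by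
  have hext := hp.ext
  have hab : B.Built P F ℓ O f a :=
    (hbuilt a hoff.lt hoff.pos).congr hp.ext (fun _ _ _ _ _ => rfl) (fun _ _ => rfl)
  have hav := hoff.lt
  have hai : a ≠ i := hav.ne
  have hsa := hab.sym_le
  have hfa : h.arr aSym a = f aSym a := by rw [hf _ (by norm_num)]
  have mid : ∀ {t : ℕ} {h₃ : Store} {O₃ : BinGram α}, t ≤ 90 →
      B.Wrapped P F i k O O₃ m (h₃.var rWl) (h₃.var rWr) → Emitted code O₃ h₃ →
      (∀ c, c ≠ aOut → ∀ v, h₃.arr c v = if c = aNext ∧ v = i then m else h.arr c v) →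
      (∀ r, r ∉ [rS, rWl, rWr, rOp, rCnt] → h₃.var r = h.var r) →
      recordItem.wp b w (fun t' h' => Q (t + t') h') h₃ := by
    intro t h₃ O₃ e1 e2 e3 e4 e5
    have := e2.card_le
    refine wp_recordItem (code := code) hw ?_ hp hge hbuilt hs hc hu hpos hk e2 e3
      ((e5 _ (by simp)).trans hB)
      ((e5 _ (by simp)).trans hZ) ((e5 _ (by simp)).trans hI) ((e5 _ (by simp)).trans hG) hi
      (by omega) (by simp [e4]) hbeta hkey hml hmp ?_
    · intro c hc v hv
      rw [e4 c hc, if_neg (by rintro ⟨h1, h2⟩; rcases hv with hv | hv <;> contradiction), hf c hc]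
    · intro t' h' O' g1 g2 g3 g4 g5 g6 g7
      refine hQ _ _ O' (by omega) (ProcessedAt.trans ⟨?_, ?_, ?_⟩ g2) (e2.ext.trans g3) g4 g5 g6 g7
      · intro c hc; funext v; rw [e4 c (by omega), if_neg (by omega)]
      · intro c h9 h16 v hv; rw [e4 c (by omega), if_neg (by omega)]
      · intro r hr
        refine e5 r ?_
        simp only [List.mem_cons, List.not_mem_nil, or_false] at hr ⊢
        omega
  unfold closeItem
  simp [Cmd.wp, Expr.addrCost, hB, hI, hG, hA, hfa, hone]
  refine ⟨hi, by omega, fun h1 => ?_, fun h1 => ?_⟩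
  · have hstr : B.str i = B.str u ++ B.str a := by
      rcases hstr with h2 | h2
      · exact h2.2
      · exact absurd h1 h2.1
    refine wp_cat (code := code) (O := O) hw (he.congr (by funext j; simp) (by simp) (by simp))
      (by simpa using hB) (by simpa using hZ) (by omega) (by omega)
      (by simpa using hp.le_right) (by simpa using hsa) (by simp) ?_
    intro t₃ h₃ O₃ ht₃ hc₃ he₃ ha₃ hv₃
    simp at hc₃
    simp only [← add_assoc]
    refine mid (by omega) ?_ he₃ ?_ ?_
    · have : h₃.var rWl = h.var rWl := by simp [hv₃]
      rw [this]
      exact hp.wrap_right hk hab hoff hPi hF hstr hc₃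
    · intro c hc v; simp [ha₃ c hc]
    · intro r hr
      simp only [List.mem_cons, List.not_mem_nil, or_false, not_or] at hr
      obtain ⟨r1, r2, r3, r4, r5⟩ := hr
      simp [hv₃, r1, r3, r4, r5]
  · have hstr : B.str i = B.str a ++ B.str u := by
      rcases hstr with h2 | h2
      · exact absurd h2.1 h1
      · exact h2.2
    refine wp_cat (code := code) (O := O) hw (he.congr (by funext j; simp) (by simp) (by simp))
      (by simpa using hB) (by simpa using hZ) (by omega) (by omega)
      (by simpa using hsa) (by simpa using hp.le_left) (by simp) ?_
    intro t₃ h₃ O₃ ht₃ hc₃ he₃ ha₃ hv₃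
    simp at hc₃
    simp only [← add_assoc]
    refine mid (by omega) ?_ he₃ ?_ ?_
    · have : h₃.var rWr = h.var rWr := by simp [hv₃]
      rw [this]
      exact hp.wrap_left hk hab hoff hPi hF hstr hc₃
    · intro c hc v; simp [ha₃ c hc]
    · intro r hr
      simp only [List.mem_cons, List.not_mem_nil, or_false, not_or] at hr
      obtain ⟨r1, r2, r3, r4, r5⟩ := hr
      simp [hv₃, r1, r2, r4, r5]

end

open BinGram

variable {u a β k : ℕ}

theorem wp_followChain_closeItem (hw : 64 * b + 64 < 2 ^ w)
    (hbuilt : ∀ v < i, 0 < P v → B.Built P F ℓ O h.arr v) (hs : B.side P i ≠ 0)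
    (hc : B.CentralChild P i u) (hu : u < i) (hpos : 0 < P u) (hPi : 0 < P i)
    (hk : B.ItemKey P i a (h.arr aML u) (h.arr aMP u) (h.arr aBeta u) β k)
    (hoff : B.OffEdge P i a) (hF : Nat.log 2 (P a) ≤ F)
    (hstr : h.var rK = 1 ∧ B.str i = B.str u ++ B.str a ∨
      h.var rK ≠ 1 ∧ B.str i = B.str a ++ B.str u) (he : Emitted code O h)
    (hB : h.var rB = b) (hZ : h.var rZero = 0) (hone : h.var rOne = 1) (hI : h.var rI = i)
    (hA : h.var rA = a) (hi : i < b) (hO : O.card + 2 * ℓ u ≤ 5 * i)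
    (hbeta : h.arr aBeta i = β) (hkey : h.arr aKey i = k) (hml : h.arr aML i = h.arr aML u)
    (hmp : h.arr aMP i = h.arr aMP u)
    (hK : h.var rKey = k) (hG : h.var rG = u) (hT : h.var rT = h.arr aKey u)
    (hWl : h.var rWl = 0) (hWr : h.var rWr = 0) {Q : ℕ → Store → Prop}
    (hQ : ∀ t h' O' L, t + 200 * L ≤ 200 * ℓ u + 600 → ProcessedAt i h h' → O.Extends O' →
      Emitted code O' h' → B.Built P F (Function.update ℓ i L) O' h'.arr i →
      h'.arr aSym i = O'.card → O'.card + 2 * L ≤ O.card + 2 * ℓ u + 5 → Q t h') :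
    (followChain ;; closeItem).wp b w Q h := by
  refine (runs_followChain hw hbuilt hc hu hpos hk he hB hZ hi hO hK hG hT hWl hWr).mono ?_
  rintro t₁ h₁ ⟨O₁, m, ht₁, hp, he₁, ha₁, hv₁, hg₁, hge⟩
  have := hp.card_le
  have hKe : h₁.var rK = h.var rK := hv₁ _ (by simp)
  refine wp_closeItem (code := code) hw ha₁ hp hge hbuilt hs hc hu hpos hPi hk hoff hF
    (by rw [hKe]; exact hstr) he₁ ((hv₁ _ (by simp)).trans hB) ((hv₁ _ (by simp)).trans hZ)
    ((hv₁ _ (by simp)).trans hone) ((hv₁ _ (by simp)).trans hI) hg₁ ((hv₁ _ (by simp)).trans hA)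
    hi (by omega) hbeta hkey hml hmp ?_
  intro t₂ h₂ O₂ ht₂ g1 g2 g3 g4 g5 g6
  refine hQ _ _ O₂ (ℓ m + 1) (by omega) (ProcessedAt.trans ⟨?_, ?_, ?_⟩ g1) (hp.ext.trans g2) g3 g4
    g5 g6
  · intro c hc; exact ha₁ c (by omega)
  · intro c h9 h16 v hv; rw [ha₁ c (by omega)]
  · intro r hr
    refine hv₁ r ?_
    simp only [List.mem_cons, List.not_mem_nil, or_false] at hr ⊢
    omega

/-- Process the variable `rI` with the central child `rU` and the other child `rA`. -/
def buildItemFrom : Cmd :=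
  .asg rML (.rd aML ♯rU) ;; .asg rMP (.rd aMP ♯rU) ;; .wr aML ♯rI ♯rML ;; .wr aMP ♯rI ♯rMP ;;
  .asg rS (.rd aBeta ♯rU) ;;
  .asg rT (♯rS + (♯rL - .rd aL ♯rU) * ♯rMP + (♯rV - .rd aPP ♯rI) * ♯rML) ;;
  .wr aBeta ♯rI ♯rT ;; .asg rKey (.op .bxor ♯rT ♯rS) ;; .wr aKey ♯rI ♯rKey ;;
  .asg rWl 0 ;; .asg rWr 0 ;; .asg rG ♯rU ;; .asg rT (.rd aKey ♯rG) ;;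
  followChain ;; closeItem

theorem wp_buildItemFrom (hw : 64 * b + 64 < 2 ^ w) (hb : Balanced code b B P F i O ℓ S h)
    (hP : B.CountsFrom 0 P) (hF : F = Nat.log 2 (B.len (B.card - 1)))
    (hn : 4 * B.len (B.card - 1) < 2 ^ w) (hi : i < B.card) (hib : B.card < b) (hPi : 0 < P i)
    (hs : B.side P i ≠ 0) (hc : B.CentralChild P i u) (hoff : B.OffEdge P i a)
    (hstr : h.var rK = 1 ∧ B.str i = B.str u ++ B.str a ∨
      h.var rK ≠ 1 ∧ B.str i = B.str a ++ B.str u)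
    (hI : h.var rI = i) (hL : h.var rL = B.len i) (hV : h.var rV = P i)
    (hU : h.var rU = u) (hA : h.var rA = a) (huS : u ∈ S) {Q : ℕ → Store → Prop}
    (hQ : ∀ t h' O' L, t + 200 * L ≤ 200 * ℓ u + 900 → ProcessedAt i h h' → O.Extends O' →
      Emitted code O' h' → B.Built P F (Function.update ℓ i L) O' h'.arr i →
      h'.arr aSym i = O'.card → O'.card + 2 * L ≤ O.card + 2 * ℓ u + 5 → Q t h') :
    buildItemFrom.wp b w Q h := by
  have hl := hb.analyzed.loaded
  have hui := hc.ok hi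
  have hun : u ≠ i := hui.ne
  have hai := hoff.lt
  have hPu : 0 < P u := by
    have h1 := CentralChild.centralIn_eq hP hi hc
    have h2 := hP.centralIn_le (hui.trans hi)
    omega
  have hub := hb.built u hui hPu
  have hlen : B.len i = B.len u + B.len a := by
    unfold BinGram.len
    rcases hstr with h1 | h1 <;> rw [h1.2, List.length_append]
    exact Nat.add_comm _ _
  have hlu : h.arr aL u = B.len u := hb.analyzed.len u (hui.trans hi) hPu
  have hpp : h.arr aPP i = B.centralIn P B.card i := hb.analyzed.centralIn i
  obtain ⟨β, hβ⟩ : ∃ β, β = h.arr aBeta u + (B.len i - B.len u) * h.arr aMP u +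
    (P i - B.centralIn P B.card i) * h.arr aML u := ⟨_, rfl⟩
  obtain ⟨k, hk⟩ : ∃ k, k = β ^^^ h.arr aBeta u := ⟨_, rfl⟩
  have hkey := hub.itemKey hP hi hc (hai.trans hi) hlen hβ hk
  have hsum : 2 * ℓ u ≤ 2 * ∑ v ∈ S, ℓ v :=
    Nat.mul_le_mul_left _ (single_le_sum (fun _ _ => Nat.zero_le _) huS)
  have hcard := hb.card_le
  have hfit : β < 2 ^ w := by
    have h1 := hkey.beta_le
    have h2 : B.len i < 2 * h.arr aML u :=
      lt_two_mul_of_log_eq hub.ml_pos (by rw [hc.sameLevel.1, hub.log_ml])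
    have h3 : B.len i * h.arr aMP u ≤ 2 * h.arr aML u * h.arr aMP u := Nat.mul_le_mul_right _ h2.le
    have h4 := hub.ml_mul_mp
    rw [mul_assoc] at h3
    omega
  unfold buildItemFrom
  simp [Cmd.wp, Expr.addrCost, hl.varB, hI, hL, hV, hU, hlu, hpp, hun, ← hβ, ← hk]
  have hf1 : (B.len i - B.len u) * h.arr aMP u < 2 ^ w := by omega
  have hf2 : (P i - B.centralIn P B.card i) * h.arr aML u < 2 ^ w := by omega
  have hf3 : h.arr aBeta u + (B.len i - B.len u) * h.arr aMP u < 2 ^ w := by omega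
  refine ⟨by omega, by omega, by omega, by omega, by omega, by omega, ?_⟩
  -- the postcondition as a function of the steps of the rest, which unification does not find
  refine wp_followChain_closeItem
    (Q := fun s h₂ => Q (8 + (8 + (8 + (8 + (8 + (26 + (8 + (4 + (8 + (2 + (2 + (2 + (8 + s)))))))))))))
      h₂) (code := code) (F := F) (ℓ := ℓ) (O := O) (k := k) (β := β)
    (B := B) (P := P) (u := u) (a := a) (i := i) hw ?_ hs hc hui hPu hPi ?_ hoff
    ?_ ?_ ?_ ?_ ?_ ?_ ?_ ?_ (by omega) (by omega) ?_ ?_ ?_ ?_ ?_ ?_ ?_ ?_ ?_ ?_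
  · intro v hv hpv
    refine (hb.built v hv hpv).congr (.refl O) (fun x hx c h9 h16 => ?_) (fun _ _ => rfl)
    simp [show x ≠ i by omega]
  · simpa [hun] using hkey
  · rw [hF]; exact Nat.log_mono_right (hP.le_len B (hai.trans hi))
  · simpa using hstr
  · exact hb.emitted.congr (by funext j; simp) (by simp) (by simp)
  · simpa using hl.varB
  · simpa using hb.analyzed.zero
  · simpa using hl.one
  · simpa using hI
  · simpa using hA
  · simp
  · simp
  · simp [hun]
  · simp [hun]
  · simp
  · simp
  · simp [hun]
  · simp
  · simp
  · intro t h' O' L g0 g1 g2 g3 g4 g5 g6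
    refine hQ _ _ O' L (by omega) (ProcessedAt.trans ⟨?_, ?_, ?_⟩ g1) g2 g3 g4 g5 g6
    · intro c hc
      funext j
      simp [show c ≠ 13 by omega, show c ≠ 14 by omega, show c ≠ 15 by omega, show c ≠ 16 by omega]
    · intro c h9 h16 v hv; simp [hv]
    · intro r hr
      simp only [List.mem_cons, List.not_mem_nil, or_false] at hr
      rcases hr with rfl | rfl | rfl | rfl | rfl | rfl <;> simp

/-- Process a variable with a central child. -/
def buildItem : Cmd :=
  .ite (.eq rK rOne) (.asg rU ♯rX ;; .asg rA ♯rY) (.asg rU ♯rY ;; .asg rA ♯rX) ;; buildItemFrom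

theorem wp_buildItem (hw : 64 * b + 64 < 2 ^ w) (hb : Balanced code b B P F i O ℓ S h)
    (hP : B.CountsFrom 0 P) (hF : F = Nat.log 2 (B.len (B.card - 1)))
    (hn : 4 * B.len (B.card - 1) < 2 ^ w) (hi : i < B.card) (hib : B.card < b) (hPi : 0 < P i)
    (hs : B.side P i ≠ 0) (hK : h.var rK = B.side P i)
    (hI : h.var rI = i) (hL : h.var rL = B.len i) (hV : h.var rV = P i)
    (hX : h.var rX = h.arr aX i) (hY : h.var rY = h.arr aY i) {Q : ℕ → Store → Prop}
    (hQ : ∀ t h' O' L u, u ∈ S → B.CentralChild P i u →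
      t + 200 * L ≤ 200 * ℓ u + 1000 → ProcessedAt i h h' → O.Extends O' →
      Emitted code O' h' → B.Built P F (Function.update ℓ i L) O' h'.arr i →
      h'.arr aSym i = O'.card → O'.card + 2 * L ≤ O.card + 2 * ℓ u + 5 → Q t h') :
    buildItem.wp b w Q h := by
  have hl := hb.analyzed.loaded
  have hst := hl.stored i hi
  have hstr := B.str_eq i hi
  obtain ⟨x, y, hr, hxy⟩ := hP.exists_centralChild hi hPi hs
  rw [hr] at hst hstr
  obtain ⟨k1, k2, k3⟩ := hst
  have hpa : ∀ {h₁ : Store}, h₁.arr = h.arr → (∀ r, r ≠ rU → r ≠ rA → h₁.var r = h.var r) →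
      ProcessedAt i h h₁ := fun e1 e2 => ⟨fun a _ => by rw [e1], fun a _ _ u _ => by rw [e1],
        fun r hr => e2 r (by rintro rfl; simp at hr) (by rintro rfl; simp at hr)⟩
  unfold buildItem
  simp [Cmd.wp, hl.one]
  refine ⟨fun h1 => ?_, fun h1 => ?_⟩
  · obtain ⟨-, hc, hoff⟩ : B.side P i = 1 ∧ B.CentralChild P i x ∧ B.OffEdge P i y := by
      rcases hxy with h2 | h2
      · exact h2
      · omega
    have huS := hb.mem_tops i hi le_rfl x (hc.ok hi) hc
    refine wp_buildItemFrom (O := O) (ℓ := ℓ) (code := code) (S := S) (u := x) (a := y) hw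
      (hb.congr (by simp) ?_) hP hF hn
      hi hib hPi hs hc hoff (.inl ⟨by simpa using h1, hstr⟩) (by simpa using hI)
      (by simpa using hL) (by simpa using hV) (by simp [hX, k2]) (by simp [hY, k3]) huS ?_
    · intro r hr
      simp only [List.mem_cons, List.not_mem_nil, or_false] at hr
      simp [show r ≠ rU by omega, show r ≠ rA by omega]
    · intro t h' O' L g0 g1 g2 g3 g4 g5 g6
      refine hQ _ _ O' L x huS hc (by omega) (ProcessedAt.trans (hpa (by simp) ?_) g1) g2 g3 g4 g5
        g6
      intro r h1 h2; simp [h1, h2]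
  · obtain ⟨-, hc, hoff⟩ : B.side P i = 2 ∧ B.CentralChild P i y ∧ B.OffEdge P i x := by
      rcases hxy with h2 | h2
      · omega
      · exact h2
    have huS := hb.mem_tops i hi le_rfl y (hc.ok hi) hc
    refine wp_buildItemFrom (O := O) (ℓ := ℓ) (code := code) (S := S) (u := y) (a := x) hw
      (hb.congr (by simp) ?_) hP hF hn
      hi hib hPi hs hc hoff (.inr ⟨by simpa using h1, hstr⟩) (by simpa using hI)
      (by simpa using hL) (by simpa using hV) (by simp [hY, k3]) (by simp [hX, k2]) huS ?_
    · intro r hr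
      simp only [List.mem_cons, List.not_mem_nil, or_false] at hr
      simp [show r ≠ rU by omega, show r ≠ rA by omega]
    · intro t h' O' L g0 g1 g2 g3 g4 g5 g6
      refine hQ _ _ O' L y huS hc (by omega) (ProcessedAt.trans (hpa (by simp) ?_) g1) g2 g3 g4 g5
        g6
      intro r h1 h2; simp [h1, h2]

/-! ### All variables -/

/-- Write the output grammar, processing the variables from the bottom up. -/
def balance : Cmd :=
  .asg rI 0 ;; .asg rOp 1 ;; .asg rCnt 0 ;;
  .loop (.lt rI rN) (
    .asg rV (.rd aP ♯rI) ;;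
    .ite (.lt rZero rV)
      (.asg rK (.rd aSide ♯rI) ;; .asg rL (.rd aL ♯rI) ;; .asg rX (.rd aX ♯rI) ;;
       .asg rY (.rd aY ♯rI) ;; .ite (.eq rK rZero) buildCore buildItem)
      (.asg rS 0) ;;
    .asg rI (♯rI + 1))

theorem runs_balance (hw : 64 * b + 64 < 2 ^ w) (ha : Analyzed code b B P B.card h)
    (hP : B.CountsFrom 0 P) (hF : F = Nat.log 2 (B.len (B.card - 1)))
    (hn : 4 * B.len (B.card - 1) < 2 ^ w) (hib : B.card < b) :
    Runs b w balance h fun t h' => ∃ O ℓ S, t ≤ 2000 * B.card + 20 ∧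
      Balanced code b B P F B.card O ℓ S h' := by
  unfold balance
  apply Runs.of_wp hw
  simp [Cmd.wp]
  refine (Runs.loop (fun (g : ℕ × BinGram α × (ℕ → ℕ) × Finset ℕ) h' =>
    Balanced code b B P F g.1 g.2.1 g.2.2.1 g.2.2.2 h' ∧ h'.var rI = g.1 ∧ g.1 ≤ B.card)
    -- the second summand pays for following chains
    (fun g => 2000 * (B.card - g.1) + 200 * ∑ u ∈ g.2.2.2, g.2.2.1 u) (by simp) ?_
    (0, BinGram.empty, fun _ => 0, ∅) _ ?_).mono ?_
  · rintro ⟨i, O, ℓ, S⟩ h ⟨hb, hI, hic⟩ ht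
    dsimp only at hb hI hic
    have hl := hb.analyzed.loaded
    simp only [Test.inStore_lt, hI, hl.varN] at ht
    have hPa := hb.analyzed.paths
    have hz := hb.analyzed.zero
    have huniq : ∀ {u v : ℕ}, B.CentralChild P i u → i < v → v < B.card → ¬ B.CentralChild P v u :=
      fun h1 h2 h3 h4 => h2.ne (CentralChild.unique hP ht h3 h1 h4)
    have hiS : i ∉ S := fun hh => by have := mem_range.1 (hb.tops hh); omega
    have hSi : ∀ {T : Finset ℕ} {L : ℕ}, i ∉ T →
        ∑ u ∈ T, Function.update ℓ i L u = ∑ u ∈ T, ℓ u := fun {T L} hT =>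
      sum_congr rfl fun u hu => Function.update_of_ne (by rintro rfl; exact hT hu) _ _
    have hcard := hb.card_le
    refine Runs.intro hw fun Q hQ => ?_
    simp only [Cmd.wp]
    simp [Expr.addrCost, hl.varB, hI, hPa, hz]
    refine ⟨by omega, fun hpos => ?_, fun hpos => ?_⟩
    · have hside := hb.analyzed.side i ht hpos
      have hleni := hb.analyzed.len i ht hpos
      refine ⟨by omega, fun hs => ?_, fun hs => ?_⟩
      · rw [hside] at hs
        refine wp_buildCore (O := O) (ℓ := ℓ) (code := code) (S := S) hw (hb.congr (by simp) ?_) hP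
          hF hn ht hib hpos hs (by simpa using hI) (by simp [hleni]) (by simp)
          (by simp) (by simp) ?_
        · intro r hr
          simp only [List.mem_cons, List.not_mem_nil, or_false] at hr
          rcases hr with rfl | rfl | rfl | rfl | rfl | rfl | rfl <;> simp
        · intro t h' O' g0 g1 g2 g3 g4 g5 g6
          have hI' : h'.var rI = i := by rw [g1.var _ (by simp)]; simpa using hI
          have hsum : ∑ u ∈ insert i S, Function.update ℓ i 0 u = ∑ u ∈ S, ℓ u := by
            rw [sum_insert hiS, hSi hiS]; simp
          have hnew : Balanced code b B P F (i + 1) O' (Function.update ℓ i 0) (insert i S) h' := by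
            refine hb.succ (ProcessedAt.trans ⟨?_, ?_, ?_⟩ g1) g2 g3 (fun _ => g5) ?_ ?_ ?_
              (fun _ => g6)
            · intro a _; simp
            · intro a _ _ u _; simp
            · intro r hr
              simp only [List.mem_cons, List.not_mem_nil, or_false] at hr
              rcases hr with rfl | rfl | rfl | rfl | rfl | rfl <;> simp
            · intro u hu
              rcases mem_insert.1 hu with rfl | h1
              · simp
              · have := mem_range.1 (hb.tops h1)
                simp; omega
            · intro v hv hiv u hu hcc
              rcases hu.lt_or_eq with h1 | rfl
              · exact mem_insert_of_mem (hb.mem_tops v hv hiv.le u h1 hcc)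
              · exact mem_insert_self _ _
            · rw [hsum]; omega
          simp [hI']
          refine ⟨by omega, hQ _ _ ⟨(i + 1, O', Function.update ℓ i 0, insert i S),
            ⟨hnew.congr (by simp) ?_, by simp, ht⟩, ?_⟩⟩
          · intro r hr
            simp only [List.mem_cons, List.not_mem_nil, or_false] at hr
            rcases hr with rfl | rfl | rfl | rfl | rfl | rfl | rfl <;> simp
          · dsimp only
            rw [hsum]
            omega
      · rw [hside] at hs
        refine wp_buildItem (O := O) (ℓ := ℓ) (code := code) (S := S) hw (hb.congr (by simp) ?_) hP
          hF hn ht hib hpos hs (by simp [hside]) (by simpa using hI) (by simp [hleni]) (by simp)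
          (by simp) (by simp) ?_
        · intro r hr
          simp only [List.mem_cons, List.not_mem_nil, or_false] at hr
          rcases hr with rfl | rfl | rfl | rfl | rfl | rfl | rfl <;> simp
        · intro t h' O' L u huS hcu g0 g1 g2 g3 g4 g5 g6
          have hI' : h'.var rI = i := by rw [g1.var _ (by simp)]; simpa using hI
          have hiE : i ∉ S.erase u := fun hh => hiS (mem_of_mem_erase hh)
          have hsum : ∑ x ∈ insert i (S.erase u), Function.update ℓ i L x + ℓ u =
              L + ∑ u ∈ S, ℓ u := by
            rw [sum_insert hiE, hSi hiE, Function.update_self, add_assoc, sum_erase_add _ _ huS]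
          have hnew : Balanced code b B P F (i + 1) O' (Function.update ℓ i L)
              (insert i (S.erase u)) h' := by
            refine hb.succ (ProcessedAt.trans ⟨?_, ?_, ?_⟩ g1) g2 g3 (fun _ => g4) ?_ ?_ ?_
              (fun _ => g5)
            · intro a _; simp
            · intro a _ _ u _; simp
            · intro r hr
              simp only [List.mem_cons, List.not_mem_nil, or_false] at hr
              rcases hr with rfl | rfl | rfl | rfl | rfl | rfl <;> simp
            · intro x hx
              rcases mem_insert.1 hx with rfl | h1
              · simp
              · have := mem_range.1 (hb.tops (mem_of_mem_erase h1))
                simp; omega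
            · intro v hv hiv x hx hcc
              rcases hx.lt_or_eq with h1 | rfl
              · refine mem_insert_of_mem (mem_erase.2 ⟨?_, hb.mem_tops v hv hiv.le x h1 hcc⟩)
                rintro rfl
                exact huniq hcu hiv hv hcc
              · exact mem_insert_self _ _
            · omega
          simp [hI']
          refine ⟨by omega, hQ _ _ ⟨(i + 1, O', Function.update ℓ i L, insert i (S.erase u)),
            ⟨hnew.congr (by simp) ?_, by simp, ht⟩, ?_⟩⟩
          · intro r hr
            simp only [List.mem_cons, List.not_mem_nil, or_false] at hr
            rcases hr with rfl | rfl | rfl | rfl | rfl | rfl | rfl <;> simp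
          · dsimp only
            omega
    · have hsum := hSi (L := 0) hiS
      have hnew : Balanced code b B P F (i + 1) O (Function.update ℓ i 0) S h := by
        refine hb.succ ⟨fun _ _ => rfl, fun _ _ _ _ _ => rfl, fun _ _ => rfl⟩ (.refl O) hb.emitted
          (fun h1 => by omega) (fun u hu => ?_) ?_ ?_ (fun h1 => by omega)
        · have := mem_range.1 (hb.tops hu)
          simp; omega
        · intro v hv hiv u hu hcc
          rcases hu.lt_or_eq with h1 | rfl
          · exact hb.mem_tops v hv hiv.le u h1 hcc
          · have h1 := CentralChild.centralIn_eq hP hv hcc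
            have h2 := hP.centralIn_le ht
            have h3 := hcc.1
            omega
        · rw [hsum]; omega
      refine ⟨by omega, hQ _ _ ⟨(i + 1, O, Function.update ℓ i 0, S),
        ⟨hnew.congr (by simp) ?_, by simp, ht⟩, ?_⟩⟩
      · intro r hr
        simp only [List.mem_cons, List.not_mem_nil, or_false] at hr
        rcases hr with rfl | rfl | rfl | rfl | rfl | rfl | rfl <;> simp
      · dsimp only
        rw [hsum]
        omega
  · refine ⟨⟨ha.congr (fun a _ => by simp) ?_, ⟨?_, ?_, ?_⟩, ?_, ?_, ?_, ?_, ?_⟩, by simp, by simp⟩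
    · intro r hr
      simp only [List.mem_cons, List.not_mem_nil, or_false] at hr
      rcases hr with rfl | rfl | rfl | rfl | rfl <;> simp
    · simp [BinGram.rules, BinGram.empty]
    · simp [BinGram.rules, BinGram.empty]
    · simp [BinGram.empty]
    · intro v hv; simp at hv
    · simp
    · intro v _ _ u hu; simp at hu
    · simp [BinGram.empty]
    · intro j hj; simp at hj
  · rintro t h' ⟨⟨i, O, ℓ, S⟩, ⟨hb, hI, hic⟩, ht, hle⟩
    dsimp only at hb hI hic hle
    simp only [Test.inStore_lt, hb.analyzed.loaded.varN, hI] at ht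
    obtain rfl : i = B.card := by omega
    refine ⟨?_, O, ℓ, S, hb⟩
    simp at hle
    omega

end WordRAM

/-! ### The whole program -/

namespace WordRAM

/-- The input in the first array, everything else zero. -/
def Store.init (input : List ℕ) : Store where
  var _ := 0
  arr a i := if a = 0 then input.getD i 0 else 0

theorem represents_init (input : List ℕ) :
    Represents input.length (State.init input) (Store.init input) where
  reg _ _ := rfl
  mem a i hc := by
    unfold Cell at hc
    simp only [State.init, Store.init, addr]
    split_ifs with h0 h17
    · rfl
    · rw [List.getD_eq_default _ _ (by omega)]
    · rw [List.getD_eq_default _ _ (by omega)]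

/-- The algorithm; finally variable `0` is set to the address of the output. -/
def balanceAll : Cmd :=
  scan ;; binarize ;; countPaths ;; centralEdges ;; balance ;; .wr aOut 0 ♯rCnt ;;
  .asg 0 (17 * ♯rB)

theorem runs_balanceAll {α : Type*} {code : α → ℕ} {G : RLSLP α} {b w : ℕ}
    (hw : 64 * b + 64 < 2 ^ w) (hn : 4 * G.word.length < 2 ^ w)
    (hlen : (G.encode code).length = b) :
    Runs b w balanceAll (Store.init (G.encode code)) fun t h => ∃ G' : RLSLP α,
      t ≤ 3000 * G.size + 200 ∧ G'.word = G.word ∧ G'.size ≤ 10 * G.size ∧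
      G'.depth ≤ 37 * Nat.log 2 G.word.length + 7 ∧
      (∀ r ∈ G'.rules, r.Admissible ∧ r.IsBinary) ∧ h.var 0 = 17 * b ∧
      At (h.arr aOut) 0 (G'.encode code) ∧ (G'.encode code).length ≤ 40 * b := by
  have hsz := RLSLP.length_rules_le_size G.rules G.admissible code
  have hb' : b = 1 + (G.rules.flatMap (RLRule.encode code)).length := by
    rw [← hlen, RLSLP.encode, List.length_cons, add_comm]
  have hin : At ((Store.init (G.encode code)).arr aIn) 0 (G.encode code) := by
    intro i hi
    simp [Store.init, hi]
  have hz : ∀ a, a ≠ 0 → ∀ i, (Store.init (G.encode code)).arr a i = 0 := fun a ha i => if_neg ha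
  have hGs : (G.rules.map RLRule.size).sum = G.size := rfl
  rw [hGs] at hsz
  unfold balanceAll
  refine .seq ((runs_scan hw hlen hin).mono ?_)
  rintro t₁ h₁ ⟨ht₁, ha₁, b₁, m₁, o₁, w₁⟩
  rw [← ha₁] at hin hz
  refine .seq ((runs_binarize hw hlen hin b₁ m₁ o₁ w₁).mono ?_)
  rintro t₂ h₂ ⟨B, ht₂, hB, hcard, hpos, hword⟩
  have hn' : B.len (B.card - 1) = G.word.length := by rw [BinGram.len, hword]
  rw [← hn'] at hn ⊢
  refine .seq ((runs_countPaths (B := B) (code := code) hw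
    ⟨hB.stored, hB.varB, hB.one, hB.two, hB.varN⟩
    (fun i => by rw [hB.zero _ le_rfl]; exact hz _ (by norm_num) i) hpos (by omega) (by omega)).mono
      ?_)
  rintro t₃ h₃ ⟨ht₃, hl₃, hP, hz₃, ha₃⟩
  have hz' : ∀ a, 6 ≤ a → ∀ i, h₃.arr a i = 0 := fun a ha i => by
    rw [ha₃ a ha, hB.zero a (by omega)]; exact hz a (by omega) i
  refine .seq ((runs_centralEdges (code := code) hw hl₃ rfl hP (hz' _ (by norm_num))
    (hz' _ (by norm_num)) hz₃ (by omega) (by omega)).mono ?_)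
  rintro t₄ h₄ ⟨ht₄, hA⟩
  refine .seq ((runs_balance (code := code) hw hA hP rfl hn (by omega)).mono ?_)
  rintro t₅ h₅ ⟨O, ℓ, S, ht₅, hbal⟩
  have hroot := hP.root hpos
  have hr := hbal.built (B.card - 1) (by omega) (by omega)
  have hO : h₅.arr aSym (B.card - 1) = O.card := hbal.sym_last _ (by omega) (by omega)
  have hOpos : 0 < O.card := hO ▸ hr.sym_pos
  have hOc := hbal.card_le
  have he := hbal.emitted
  have hlB := hbal.analyzed.loaded.varB
  refine Runs.intro hw fun Q hQ => ?_
  simp [Cmd.wp, Expr.addrCost, hlB]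
  refine ⟨by omega, by omega, hQ _ _ ⟨O.toRLSLP hOpos, ?_, ?_, ?_, ?_, O.isBinary_toRLSLP hOpos, ?_,
    ?_, ?_⟩⟩
  · omega
  · have hstart : (O.toRLSLP hOpos).start = O.card - 1 := by
      simp [RLSLP.start, BinGram.toRLSLP, BinGram.rules]
    rw [RLSLP.word, hstart, O.exp_toRLSLP hOpos _ (by omega), ← hword, ← hr.str_eq, hO,
      O.sym_of_pos hOpos]
  · have := O.size_toRLSLP_le hOpos
    omega
  · have hstart : (O.toRLSLP hOpos).start = O.card - 1 := by
      simp [RLSLP.start, BinGram.toRLSLP, BinGram.rules]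
    rw [RLSLP.depth, hstart]
    have h1 := O.depthOf_toRLSLP_le hOpos (O.card - 1) (by omega)
    have h2 := hr.dep_le
    rw [hroot, hO] at h2
    simp only [Nat.log_one_right] at h2
    omega
  · simp
  · rw [RLSLP.encode, At.cons_iff]
    have hcnt : (O.toRLSLP hOpos).rules.length = O.card := by simp [BinGram.toRLSLP, BinGram.rules]
    refine ⟨by simp [he.varCnt, hcnt], ?_⟩
    change At _ _ (O.rules.flatMap (RLRule.encode code))
    exact fun j hj => by simpa using (he.out j hj :)
  · have := length_flatMap_rules_le code O
    have hr2 : (O.toRLSLP hOpos).rules = O.rules := rfl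
    rw [RLSLP.encode, List.length_cons, hr2]
    omega

end WordRAM

theorem theorem1 : ∃ (P : WordRAM.Prog) (c : ℕ),
    ∀ (α : Type*) (code : α ↪ ℕ) (G : RLSLP α) (w : ℕ),
      (∀ x ∈ G.encode code, x < 2 ^ w) →
      c * (G.word.length + G.size) ≤ 2 ^ w →
      ∃ G' : RLSLP α,
        G'.word = G.word ∧
        G'.size ≤ c * G.size ∧
        G'.depth ≤ c * (1 + Nat.log 2 G.word.length) ∧
        (∀ r ∈ G'.rules, r.Admissible ∧ r.IsBinary) ∧
        ∃ (t : ℕ) (s : WordRAM.State),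
          t ≤ c * G.size ∧
          WordRAM.Exec w P (WordRAM.State.init (G.encode code)) t s ∧
          s.HasOutput (G'.encode code) := by
  -- the records and the output occupy `O(|G|)` cells, and all computed numbers are at most `4 n`
  -- or of the order of an address
  refine ⟨balanceAll.code, 4000, fun α code G w _ hw => ?_⟩
  have hsz := RLSLP.length_rules_le_size G.rules G.admissible code
  have hGs : (G.rules.map RLRule.size).sum = G.size := rfl
  rw [hGs] at hsz
  have hpos : 0 < G.size := (List.length_pos_iff.2 G.nonempty).trans_le hsz.1
  have hlen : (G.encode code).length = (G.rules.flatMap (RLRule.encode code)).length + 1 := by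
    rw [RLSLP.encode, List.length_cons]
  obtain ⟨t, s, h, hx, hrep, G', ht, h1, h2, h3, h4, h5, h6, h7⟩ :=
    runs_balanceAll (G := G) (code := code) (b := (G.encode code).length) (w := w) (by omega)
      (by omega) rfl _ (represents_init _)
  refine ⟨G', h1, by omega, by omega, h4, t, s, by omega, hx, fun i hi => ?_⟩
  have hreg : s.reg 0 = 17 * (G.encode code).length := (hrep.reg 0 (by norm_num)).trans h5
  have hmem := hrep.mem aOut i (.inr ⟨rfl, hi.trans_le h7⟩)
  rw [hreg]
  refine (hmem.trans ?_)
  rw [← h6 i hi, zero_add]
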